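/- Let $\Delta$ be a finite simplicial complex in $\mathbb{R}^2$ whose support $|\Delta|$ is a disk (i.e. homeomorphic to the closed unit disk), and let $r,k\ge 0$ be integers. Let $C^r_k(\Delta)$ be the real vector space of functions of class $C^r$ on $|\Delta|$ whose restriction to every simplex of $\Delta$ is a polynomial of degree at most $k$. The boundary $\partial\Delta$ consists of the edges of $\Delta$ lying on exactly one triangle together with their vertices; all other vertices and edges of $\Delta$ are called interior, and $f_0^0$, $f_1^0$ denote the numbers of interior vertices and of interior edges. Let $\gamma_1,\dots,\gamma_{f_0^0}$ be any numbering of the interior vertices. For each $i$ let $t_i$ be the number of different slopes of the edges containing $\gamma_i$, and let $\tilde t_i$ be the number of different slopes of the edges joining $\gamma_i$ to one of $\gamma_1,\dots,\gamma_{i-1}$ or to a vertex on the boundary. For an integer $t>1$ put $$\Omega(t)=\left\lfloor\frac{t\,r}{t-1}\right\rfloor+1,\qquad a(t)=t(r+1)+(1-t)\,\Omega(t),\qquad b(t)=t-1-a(t),$$ and put $\Omega(t)=a(t)=b(t)=0$ for $t\le 1$. With the convention $\binom{m}{2}=0$ for $m<2$, let $$S(t)=t\binom{k+2-(r+1)}{2}-b(t)\binom{k+2-\Omega(t)}{2}-a(t)\binom{k+2-(\Omega(t)+1)}{2},$$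 $$L=\binom{k+2}{2}+f_1^0\binom{k+2-(r+1)}{2}-\sum_{i=1}^{f_0^0}S(t_i),\qquad U=\binom{k+2}{2}+f_1^0\binom{k+2-(r+1)}{2}-\sum_{i=1}^{f_0^0}S(\tilde t_i).$$ Suppose that for every $i$ either $\tilde t_i=t_i$ or $\tilde t_i>r+1$. Then $U=L$, the space $C^r_k(\Delta)$ is finite-dimensional, and $$\dim C^r_k(\Delta)=U=L.$$ -/

import Mathlib

noncomputable section

namespace BivariateSpline

/-- The Euclidean plane. -/
abbrev Plane : Type := EuclideanSpace ℝ (Fin 2)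

/-- A triangulation of a disk: a finite simplicial complex in the plane whose support `|Δ|` is
homeomorphic to the closed unit disk. -/
structure IsTriangulatedDisk (Δ : Geometry.SimplicialComplex ℝ Plane) : Prop where
  finite_faces : Δ.faces.Finite
  homeomorphic_disk : Nonempty (Δ.space ≃ₜ Metric.closedBall (0 : Plane) 1)

/-- The edges (`1`-faces) of `Δ`, each given by its set of two vertices. -/
def edges (Δ : Geometry.SimplicialComplex ℝ Plane) : Set (Finset Plane) :=
  {e | e ∈ Δ.faces ∧ e.card = 2}

/-- The triangles (`2`-faces) of `Δ`, each given by its set of three vertices. -/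
def triangles (Δ : Geometry.SimplicialComplex ℝ Plane) : Set (Finset Plane) :=
  {s | s ∈ Δ.faces ∧ s.card = 3}

/-- The faces of the boundary complex `∂Δ`: the edges lying on exactly one triangle, together
with all their vertices. -/
def boundaryFaces (Δ : Geometry.SimplicialComplex ℝ Plane) : Set (Finset Plane) :=
  {s | s ∈ Δ.faces ∧ ∃ e ∈ edges Δ, s ⊆ e ∧ ∃! σ, σ ∈ triangles Δ ∧ e ⊆ σ}

/-- The boundary vertices of `Δ`. -/
def boundaryVertices (Δ : Geometry.SimplicialComplex ℝ Plane) : Set Plane :=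
  {v | {v} ∈ boundaryFaces Δ}

/-- The set `Δ₀⁰` of interior vertices of `Δ`. -/
def interiorVertices (Δ : Geometry.SimplicialComplex ℝ Plane) : Set Plane :=
  {v | {v} ∈ Δ.faces ∧ {v} ∉ boundaryFaces Δ}

/-- The set `Δ₁⁰` of interior edges of `Δ`. -/
def interiorEdges (Δ : Geometry.SimplicialComplex ℝ Plane) : Set (Finset Plane) :=
  {e | e ∈ edges Δ ∧ e ∉ boundaryFaces Δ}

/-- `v` and `w` are the two ends of an edge of `Δ`. -/
def IsEdge (Δ : Geometry.SimplicialComplex ℝ Plane) (v w : Plane) : Prop :=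
  v ≠ w ∧ ∃ e ∈ edges Δ, v ∈ e ∧ w ∈ e

/-- The slopes of the edges of `Δ` joining `v` to a vertex in the set `S`; the slope of an edge is
recorded as the line through the origin which is parallel to it. -/
def slopes (Δ : Geometry.SimplicialComplex ℝ Plane) (v : Plane) (S : Set Plane) :
    Set (Submodule ℝ Plane) :=
  {L | ∃ w ∈ S, IsEdge Δ v w ∧ L = Submodule.span ℝ {w - v}}

/-- `t`: the number of different slopes of the edges containing the vertex `v`. -/
def slopeCount (Δ : Geometry.SimplicialComplex ℝ Plane) (v : Plane) : ℕ :=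
  (slopes Δ v Set.univ).ncard

/-- `t̃ᵢ`, for a numbering `γ` of the interior vertices: the number of different slopes of the edges
joining `γ i` to a vertex that precedes it in the numbering or to a boundary vertex. -/
def earlierSlopeCount (Δ : Geometry.SimplicialComplex ℝ Plane) {n : ℕ}
    (γ : Fin n ≃ interiorVertices Δ) (i : Fin n) : ℕ :=
  (slopes Δ (γ i) ({w | ∃ j < i, w = γ j} ∪ boundaryVertices Δ)).ncard

/-- `Ω = ⌊t r / (t - 1)⌋ + 1` for `t > 1`, and `Ω = 0` otherwise. -/
def Omega (r t : ℕ) : ℕ := if 1 < t then t * r / (t - 1) + 1 else 0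

/-- `a = t (r + 1) + (1 - t) Ω` for `t > 1`, and `a = 0` otherwise. -/
def coeffA (r t : ℕ) : ℤ := if 1 < t then t * (r + 1) + (1 - t) * Omega r t else 0

/-- `b = t - 1 - a` for `t > 1`, and `b = 0` otherwise. -/
def coeffB (r t : ℕ) : ℤ := if 1 < t then t - 1 - coeffA r t else 0

/-- The binomial coefficient `(k + 2 - d choose 2)`, which is zero if `k + 2 - d < 2`. -/
def binom (k d : ℕ) : ℤ := ((k + 2 - d).choose 2 : ℕ)

/-- The contribution of a vertex with `t` slopes to the bounds,
`t (k+2-(r+1) choose 2) - b (k+2-Ω choose 2) - a (k+2-(Ω+1) choose 2)`. -/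
def vertexTerm (r k t : ℕ) : ℤ :=
  t * binom k (r + 1) - coeffB r t * binom k (Omega r t) - coeffA r t * binom k (Omega r t + 1)

/-- The lower bound on the dimension of the spline space. (The sum is independent of the
numbering `γ`.) -/
def lowerBound (Δ : Geometry.SimplicialComplex ℝ Plane) {n : ℕ} (γ : Fin n ≃ interiorVertices Δ)
    (r k : ℕ) : ℤ :=
  binom k 0 + (interiorEdges Δ).ncard * binom k (r + 1)
    - ∑ i, vertexTerm r k (slopeCount Δ (γ i))

/-- The upper bound on the dimension of the spline space given by the numbering `γ`. -/
def upperBound (Δ : Geometry.SimplicialComplex ℝ Plane) {n : ℕ} (γ : Fin n ≃ interiorVertices Δ)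
    (r k : ℕ) : ℤ :=
  binom k 0 + (interiorEdges Δ).ncard * binom k (r + 1)
    - ∑ i, vertexTerm r k (earlierSlopeCount Δ γ i)

/-- `f` is given on the set `s` by a polynomial of degree at most `k`. -/
def IsPolynomialOn (k : ℕ) (f : Plane → ℝ) (s : Set Plane) : Prop :=
  ∃ p : MvPolynomial (Fin 2) ℝ, p.totalDegree ≤ k ∧ ∀ x ∈ s, f x = MvPolynomial.eval (x ·) p

/-- The spline space `C^r_k(Δ)`: the real functions on `|Δ|` which are of class `C^r` on `|Δ|` and
are given on every simplex of `Δ` by a polynomial of degree at most `k`. (Whether a function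
`F` on the plane satisfies the two conditions depends only on its values on `|Δ|`.) -/
def splineSpace (Δ : Geometry.SimplicialComplex ℝ Plane) (r k : ℕ) :
    Submodule ℝ (Δ.space → ℝ) where
  carrier := {f | ∃ F : Plane → ℝ, (∀ x : Δ.space, F x = f x) ∧ ContDiffOn ℝ r F Δ.space ∧
    ∀ s ∈ Δ.faces, IsPolynomialOn k F (convexHull ℝ (s : Set Plane))}
  zero_mem' := ⟨fun _ => 0, fun _ => rfl, contDiffOn_const,
    fun _ _ => ⟨0, by simp, fun _ _ => by simp⟩⟩
  add_mem' := by
    rintro f g ⟨F, hF, hFr, hFk⟩ ⟨G, hG, hGr, hGk⟩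
    refine ⟨fun x => F x + G x, fun x => by simp [hF, hG], hFr.add hGr, fun s hs => ?_⟩
    obtain ⟨p, hp, hpF⟩ := hFk s hs
    obtain ⟨q, hq, hqG⟩ := hGk s hs
    exact ⟨p + q, (MvPolynomial.totalDegree_add p q).trans (max_le hp hq),
      fun x hx => by simp [hpF x hx, hqG x hx]⟩
  smul_mem' := by
    rintro c f ⟨F, hF, hFr, hFk⟩
    refine ⟨fun x => c * F x, fun x => by simp [hF], contDiffOn_const.mul hFr, fun s hs => ?_⟩
    obtain ⟨p, hp, hpF⟩ := hFk s hs
    exact ⟨c • p, (MvPolynomial.totalDegree_smul_le c p).trans hp,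
      fun x hx => by simp [hpF x hx]⟩

end BivariateSpline

end

/-! A spline is a family of polynomials of degree at most `k`, one for each triangle, and it is of
class `C^r` exactly when its jump across each interior edge is divisible by the `(r + 1)`-st power
of the equation of that edge (`splineEquiv`). The dimension is found by studying the map from a
family to its jumps.

The jumps form an antisymmetric function on oriented interior edges, a "flow", with values in the
space of admissible jumps of each edge. The kernel of the jump map consists of single global
polynomials, since the triangles are connected through edges. Its image consists of the flows with
zero sum around every interior vertex (`range_jumps`); that nothing else obstructs is the topology
of the disk. Around one vertex the equation is solved by a dimension count, and the local solutions
are made compatible because a simplicial 1-cocycle on a contractible complex is a coboundary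
(`exists_coboundary`, by covering spaces). Hence the dimension is `binom k 0` plus the dimension of
all flows minus the rank of the map sending a flow to its outflows at the interior vertices.

The outflow at `v` lies in the space `J(v)` spanned by the admissible jumps of the edges at `v`. If
`J(γ i)` is already spanned by the edges to earlier or boundary vertices, outflows can be prescribed
by descending through the numbering, so the rank is the sum of the `dim J(γ i)` (`range_outflow`).

It remains to compute `dim J(v)`. Decomposed by degree about `v`, it becomes a univariate question:
the span, in degree at most `d`, of the multiples of `(X - a)^(r+1)` for `t` values of `a`. By
apolarity its annihilator is the space of multiples of `∏ (X - a)^(d-r)`, so its dimension is `min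
(d + 1) (t * (d - r))` (`finrank_iSup_multiples`). Summed over `d` this is `vertexTerm`. For `t > r
+ 1` the minimum no longer depends on `t`. The hypothesis therefore makes the earlier edges span all
of `J(γ i)`, and the same equality of dimensions gives `U = L`. -/

noncomputable section

namespace BivariateSpline

open Set Filter Topology
open scoped Classical

/-! ### Local connectedness of the disk -/

/-- The determinant of two vectors of the plane. -/
def det2 (a b : Plane) : ℝ := a 0 * b 1 - a 1 * b 0

theorem det2_self (a : Plane) : det2 a a = 0 := by simp only [det2]; ring

theorem det2_rotate_ne_zero {a : Plane} (ha : a ≠ 0) : det2 a !₂[-(a 1), a 0] ≠ 0 := by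
  intro h
  apply ha
  simp only [det2, Matrix.cons_val_one, Matrix.cons_val_zero] at h
  have h' : a 0 * a 0 + a 1 * a 1 = 0 := by linarith
  ext i
  fin_cases i
  · exact (mul_self_add_mul_self_eq_zero.1 h').1
  · exact (mul_self_add_mul_self_eq_zero.1 h').2

/-- A set with interior points lies on no line: a small move of an interior point perpendicular to
`a` changes the determinant. -/
theorem exists_mem_det2_ne_zero {C : Set Plane} (hC : (interior C).Nonempty) {a : Plane}
    (ha : a ≠ 0) (y : Plane) : ∃ p ∈ C, det2 a (p - y) ≠ 0 := by
  obtain ⟨q, hq⟩ := hC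
  by_contra! h
  have hcont : Continuous fun t : ℝ => q + t • (!₂[-(a 1), a 0] : Plane) := by fun_prop
  have hmem : ∀ᶠ t : ℝ in 𝓝 0, q + t • (!₂[-(a 1), a 0] : Plane) ∈ C :=
    hcont.tendsto' 0 q (by simp) (mem_interior_iff_mem_nhds.1 hq)
  obtain ⟨t, ht, ht0⟩ := ((hmem.filter_mono nhdsWithin_le_nhds).and
    (self_mem_nhdsWithin : ({0}ᶜ : Set ℝ) ∈ 𝓝[≠] 0)).exists
  have h1 := h _ (interior_subset hq)
  have h2 := h _ ht
  have h3 := det2_rotate_ne_zero ha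
  apply h3
  have ht0' : t ≠ 0 := ht0
  have : t * det2 a !₂[-(a 1), a 0] = 0 := by
    simp only [det2, PiLp.sub_apply, PiLp.add_apply, PiLp.smul_apply, smul_eq_mul] at h1 h2 ⊢
    linarith
  exact (mul_eq_zero.1 this).resolve_left ht0'

/-- If `x` lies between `y` and `z`, go from `y` to `z` through a point `p` of `C` off their line.
Both legs meet that line only at their starting points, hence avoid `x`. -/
theorem isPreconnected_convex_diff_singleton {C : Set Plane} (hC : Convex ℝ C)
    (hi : (interior C).Nonempty) (x : Plane) : IsPreconnected (C \ {x}) := by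
  refine isPreconnected_of_forall_pair fun y hy z hz => ?_
  by_cases hx : x ∈ segment ℝ y z
  · have hyz : z - y ≠ 0 := by
      intro h
      rw [sub_eq_zero.1 h, segment_same] at hx
      exact hy.2 hx.symm
    obtain ⟨p, hp, hpd⟩ := exists_mem_det2_ne_zero hi hyz y
    obtain ⟨s, -, rfl⟩ := (segment_eq_image' ℝ y z ▸ hx :)
    have key : ∀ u ∈ C \ {y + s • (z - y)}, det2 (z - y) (u - y) = 0 →
        segment ℝ u p ⊆ C \ {y + s • (z - y)} := by
      intro u hu hu0 q hq
      refine ⟨hC.segment_subset hu.1 hp hq, ?_⟩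
      rintro rfl
      rw [segment_eq_image'] at hq
      obtain ⟨t, -, ht⟩ := hq
      have e0 := congrArg (fun w : Plane => w 0) ht
      have e1 := congrArg (fun w : Plane => w 1) ht
      simp only [PiLp.sub_apply, PiLp.add_apply, PiLp.smul_apply, smul_eq_mul] at e0 e1
      have ht' : t * det2 (z - y) (p - y) = 0 := by
        simp only [det2, PiLp.sub_apply] at hu0 ⊢
        linear_combination (z 0 - y 0) * e1 - (z 1 - y 1) * e0 - (1 - t) * hu0
      rw [(mul_eq_zero.1 ht').resolve_right hpd] at ht
      apply hu.2
      simpa using ht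
    refine ⟨segment ℝ y p ∪ segment ℝ z p, union_subset (key y hy (by simp [det2]))
      (key z hz (det2_self _)), Or.inl (left_mem_segment ℝ y p), Or.inr (left_mem_segment ℝ z p),
      IsPreconnected.union p (right_mem_segment ℝ y p) (right_mem_segment ℝ z p)
        (convex_segment y p).isPreconnected (convex_segment z p).isPreconnected⟩
  · exact ⟨segment ℝ y z, fun w hw => ⟨hC.segment_subset hy.1 hz.1 hw, fun h => hx (h ▸ hw)⟩,
      left_mem_segment ℝ y z, right_mem_segment ℝ y z, (convex_segment y z).isPreconnected⟩

/-- A disk has no local cut points. -/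
theorem no_local_cut {X : Set Plane} (e : X ≃ₜ Metric.closedBall (0 : Plane) 1) {x : Plane}
    (hx : x ∈ X) {A B : Set Plane} (hA : IsClosed A) (hB : IsClosed B)
    (hcover : ∀ᶠ y in 𝓝 x, y ∈ X → y ∈ A ∪ B) (hAB : A ∩ B ⊆ {x})
    (hxA : x ∈ closure ((A ∩ X) \ {x})) (hxB : x ∈ closure ((B ∩ X) \ {x})) : False := by
  obtain ⟨c, hc⟩ : ∃ c, c = e ⟨x, hx⟩ := ⟨_, rfl⟩
  have hec : e.symm c = ⟨x, hx⟩ := by simp [hc]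
  have h1 : ∀ᶠ d in 𝓝 c, (e.symm d : Plane) ∈ A ∪ B := by
    have : Tendsto (fun d => (e.symm d : Plane)) (𝓝 c) (𝓝 x) :=
      (continuous_subtype_val.comp e.symm.continuous).tendsto' _ _ (by simp [hec])
    filter_upwards [this.eventually hcover] with d hd using hd (e.symm d).2
  obtain ⟨ε, hε, hball⟩ := Metric.eventually_nhds_iff_ball.1 h1
  -- A punctured convex neighbourhood of the image `c` of `x` in the closed disk. It is connected
  -- even when `c` lies on the boundary circle, because it comes from a convex set with interior
  -- points.
  set W : Set Plane := (Metric.ball (c : Plane) ε ∩ Metric.closedBall 0 1) \ {(c : Plane)} with hW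
  have hWconn : IsPreconnected W := by
    refine isPreconnected_convex_diff_singleton
      ((convex_ball _ _).inter (convex_closedBall _ _)) ?_ _
    have hcl : (c : Plane) ∈ closure (Metric.ball (0 : Plane) 1) := by
      rw [closure_ball _ one_ne_zero]; exact c.2
    obtain ⟨z, hz, hz'⟩ := Metric.mem_closure_iff.1 hcl ε hε
    refine ⟨z, mem_interior.2 ⟨Metric.ball (c : Plane) ε ∩ Metric.ball 0 1,
      inter_subset_inter_right _ Metric.ball_subset_closedBall,
      Metric.isOpen_ball.inter Metric.isOpen_ball, ?_, hz⟩⟩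
    rwa [Metric.mem_ball, dist_comm]
  set W' : Set (Metric.closedBall (0 : Plane) 1) := Metric.ball c ε \ {c} with hW'
  have hWW' : Subtype.val '' W' = W := by
    ext z
    simp only [hW, hW', mem_image, Subtype.exists, Set.mem_sdiff, mem_inter_iff, Metric.mem_ball,
      mem_singleton_iff, Subtype.ext_iff, Subtype.dist_eq]
    constructor
    · rintro ⟨a, ha, ⟨h1, h2⟩, rfl⟩
      exact ⟨⟨h1, ha⟩, h2⟩
    · rintro ⟨⟨h1, ha⟩, h2⟩
      exact ⟨z, ha, ⟨h1, h2⟩, rfl⟩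
  have hW'conn : IsPreconnected W' := by
    rw [← IsInducing.subtypeVal.isPreconnected_image, hWW']
    exact hWconn
  have hS := hW'conn.image (fun d => (e.symm d : Plane))
    (continuous_subtype_val.comp e.symm.continuous).continuousOn
  have hne : ∀ K : Set Plane, x ∈ closure ((K ∩ X) \ {x}) →
      ((fun d => (e.symm d : Plane)) '' W' ∩ K).Nonempty := by
    intro K hK
    have hopen : IsOpen (e ⁻¹' Metric.ball c ε) := Metric.isOpen_ball.preimage e.continuous
    obtain ⟨O, hO, hOe⟩ := isOpen_induced_iff.1 hopen
    have hxO : x ∈ O := by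
      have : (⟨x, hx⟩ : X) ∈ e ⁻¹' Metric.ball c ε := by
        rw [mem_preimage, ← hc]; exact Metric.mem_ball_self hε
      exact hOe.symm.subset this
    obtain ⟨y, hyO, ⟨hyK, hyX⟩, hyx⟩ := mem_closure_iff.1 hK O hO hxO
    have hye : (⟨y, hyX⟩ : X) ∈ e ⁻¹' Metric.ball c ε := by
      exact hOe.subset hyO
    refine ⟨y, ⟨e ⟨y, hyX⟩, ⟨hye, fun h => hyx ?_⟩, by simp⟩, hyK⟩
    have := e.injective (h.trans hc)
    exact congrArg Subtype.val this
  -- Pulled back to `X`, the punctured neighbourhood is connected, covered by the closed sets `A`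
  -- and `B`, and meets both. So it meets `A ∩ B ⊆ {x}`, although it omits `x`.
  obtain ⟨y, ⟨d, hd, rfl⟩, hyAB⟩ := isPreconnected_closed_iff.1 hS A B hA hB
    (by rintro _ ⟨d, hd, rfl⟩; exact hball d hd.1) (hne A hxA) (hne B hxB)
  have h2 := hAB hyAB
  apply hd.2
  rw [mem_singleton_iff] at h2 ⊢
  apply e.symm.injective
  rw [hec]
  exact Subtype.ext h2

theorem mem_closure_diff_singleton_of_segment {v w : Plane} (h : v ≠ w) {S : Set Plane}
    (hS : segment ℝ v w ⊆ S) : v ∈ closure (S \ {v}) := by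
  have h1 : v ∈ closure (openSegment ℝ v w) := by
    rw [closure_openSegment]; exact left_mem_segment ℝ v w
  have h2 : openSegment ℝ v w ⊆ S \ {v} := by
    intro y hy
    refine ⟨hS (openSegment_subset_segment ℝ v w hy), ?_⟩
    rintro rfl
    exact h (left_mem_openSegment_iff.1 hy)
  exact closure_mono h2 h1

/-! ### Connectedness of the complex and of the links of its vertices -/

section Complex

variable {Δ : Geometry.SimplicialComplex ℝ Plane}

theorem isClosed_convexHull_finset (s : Finset Plane) : IsClosed (convexHull ℝ (s : Set Plane)) :=
  (s.finite_toSet.isCompact_convexHull ℝ).isClosed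

theorem isClosed_biUnion_faces (hΔ : IsTriangulatedDisk Δ) (Q : Finset Plane → Prop) :
    IsClosed (⋃ s ∈ {s | s ∈ Δ.faces ∧ Q s}, convexHull ℝ (s : Set Plane)) :=
  (hΔ.finite_faces.subset fun _ h => h.1).isClosed_biUnion fun s _ => isClosed_convexHull_finset s

/-- The finitely many simplices that miss `x` are closed, so some neighbourhood of `x` avoids them
all. -/
theorem eventually_mem_convexHull (hΔ : IsTriangulatedDisk Δ) (x : Plane) :
    ∀ᶠ y in 𝓝 x, ∀ s ∈ Δ.faces, y ∈ convexHull ℝ (s : Set Plane) →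
      x ∈ convexHull ℝ (s : Set Plane) := by
  rw [hΔ.finite_faces.eventually_all]
  intro s _
  by_cases hx : x ∈ convexHull ℝ (s : Set Plane)
  · exact Eventually.of_forall fun _ _ => hx
  · filter_upwards [(isClosed_convexHull_finset s).isOpen_compl.mem_nhds hx] with y hy hy'
    exact absurd hy' hy

theorem isPreconnected_space (hΔ : IsTriangulatedDisk Δ) : IsPreconnected Δ.space := by
  obtain ⟨e⟩ := hΔ.homeomorphic_disk
  have : PreconnectedSpace (Metric.closedBall (0 : Plane) 1) :=
    Subtype.preconnectedSpace (convex_closedBall _ _).isPreconnected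
  have h : PreconnectedSpace Δ.space :=
    ⟨by
      have := (isPreconnected_univ (α := Metric.closedBall (0 : Plane) 1)).image e.symm
        e.symm.continuous.continuousOn
      rwa [image_univ, e.symm.surjective.range_eq] at this⟩
  exact isPreconnected_iff_preconnectedSpace.2 h

theorem inter_mem_faces {s t : Finset Plane} [DecidableEq Plane] (hs : s ∈ Δ.faces)
    (ht : t ∈ Δ.faces)
    {x : Plane} (hxs : x ∈ convexHull ℝ (s : Set Plane)) (hxt : x ∈ convexHull ℝ (t : Set Plane)) :
    s ∩ t ∈ Δ.faces ∧ x ∈ convexHull ℝ ((s ∩ t : Finset Plane) : Set Plane) := by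
  have hx := Δ.inter_subset_convexHull hs ht ⟨hxs, hxt⟩
  rw [← Finset.coe_inter] at hx
  refine ⟨Δ.down_closed hs Finset.inter_subset_left ?_, hx⟩
  exact Finset.coe_nonempty.1 (convexHull_nonempty_iff.1 ⟨x, hx⟩)

/-- A property of faces which is invariant under passing to faces holds for all faces or none. -/
theorem faces_connected (hΔ : IsTriangulatedDisk Δ) (Q : Finset Plane → Prop)
    (hQ : ∀ s ∈ Δ.faces, ∀ t ∈ Δ.faces, s ⊆ t → (Q s ↔ Q t)) {s t : Finset Plane}
    (hs : s ∈ Δ.faces) (ht : t ∈ Δ.faces) (h : Q s) : Q t := by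
  classical
  by_contra hn
  -- The faces with `Q` and those without cover the connected `|Δ|` by two closed sets, which must
  -- share a point. It lies on two faces `a`, `b` of different kind, and their common face `a ∩ b`
  -- transfers `Q` from one to the other.
  have hcov : Δ.space ⊆ (⋃ s ∈ {s | s ∈ Δ.faces ∧ Q s}, convexHull ℝ (s : Set Plane)) ∪
      ⋃ s ∈ {s | s ∈ Δ.faces ∧ ¬ Q s}, convexHull ℝ (s : Set Plane) := by
    intro x hx
    obtain ⟨u, hu, hxu⟩ := Δ.mem_space_iff.1 hx
    by_cases hQu : Q u
    · exact Or.inl (mem_biUnion (show u ∈ {s | s ∈ Δ.faces ∧ Q s} from ⟨hu, hQu⟩) hxu)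
    · exact Or.inr (mem_biUnion (show u ∈ {s | s ∈ Δ.faces ∧ ¬ Q s} from ⟨hu, hQu⟩) hxu)
  have hne : ∀ (R : Finset Plane → Prop) (u : Finset Plane), u ∈ Δ.faces → R u →
      (Δ.space ∩ ⋃ s ∈ {s | s ∈ Δ.faces ∧ R s}, convexHull ℝ (s : Set Plane)).Nonempty := by
    intro R u hu hR
    obtain ⟨x, hx⟩ := Δ.nonempty_of_mem_faces hu
    exact ⟨x, Δ.subset_space hu hx, mem_biUnion (show u ∈ {s | s ∈ Δ.faces ∧ R s} from ⟨hu, hR⟩)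
      (subset_convexHull ℝ _ hx)⟩
  obtain ⟨x, -, hx1, hx2⟩ := isPreconnected_closed_iff.1 (isPreconnected_space hΔ) _ _
    (isClosed_biUnion_faces hΔ Q) (isClosed_biUnion_faces hΔ fun s => ¬ Q s) hcov
    (hne Q s hs h) (hne (fun s => ¬ Q s) t ht hn)
  simp only [mem_iUnion, mem_ofPred_eq] at hx1 hx2
  obtain ⟨a, ⟨ha, hQa⟩, hxa⟩ := hx1
  obtain ⟨b, ⟨hb, hQb⟩, hxb⟩ := hx2
  have hab := (inter_mem_faces ha hb hxa hxb).1
  exact hQb ((hQ _ hab _ hb Finset.inter_subset_right).1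
    ((hQ _ hab _ ha Finset.inter_subset_left).2 hQa))

theorem card_face_le (s : Finset Plane) (hs : s ∈ Δ.faces) : s.card ≤ 3 := by
  have h := (Δ.indep hs).card_le_finrank_succ
  have h2 : Module.finrank ℝ (vectorSpan ℝ (range ((↑) : s → Plane))) ≤ 2 := by
    simpa using Submodule.finrank_le (vectorSpan ℝ (range ((↑) : s → Plane)))
  simp only [Fintype.card_coe] at h
  omega

/-- The link of a vertex is connected. -/
theorem link_connected (hΔ : IsTriangulatedDisk Δ) {v : Plane} (hv : {v} ∈ Δ.faces)
    (Q : Finset Plane → Prop)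
    (hQ : ∀ s ∈ Δ.faces, ∀ t ∈ Δ.faces, v ∈ s → s ≠ {v} → s ⊆ t → (Q s ↔ Q t))
    {s t : Finset Plane} (hs : s ∈ Δ.faces) (ht : t ∈ Δ.faces) (hvs : v ∈ s) (hvt : v ∈ t)
    (hs1 : s ≠ {v}) (ht1 : t ≠ {v}) (h : Q s) : Q t := by
  classical
  by_contra hn
  obtain ⟨e⟩ := hΔ.homeomorphic_disk
  have hvX : v ∈ Δ.space := Δ.subset_space hv (by simp)
  have hmem : ∀ (R : Finset Plane → Prop) (u : Finset Plane), u ∈ Δ.faces → v ∈ u → u ≠ {v} →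
      R u → convexHull ℝ (u : Set Plane) ⊆
        ⋃ s ∈ {s | s ∈ Δ.faces ∧ v ∈ s ∧ s ≠ {v} ∧ R s}, convexHull ℝ (s : Set Plane) :=
    fun R u hu hvu hu1 hR => subset_biUnion_of_mem (u := fun s : Finset Plane =>
      convexHull ℝ (s : Set Plane)) (show u ∈ {s | s ∈ Δ.faces ∧ v ∈ s ∧ s ≠ {v} ∧ R s} from
        ⟨hu, hvu, hu1, hR⟩)
  have hacc : ∀ (R : Finset Plane → Prop) (u : Finset Plane), u ∈ Δ.faces → v ∈ u → u ≠ {v} →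
      R u → v ∈ closure (((⋃ s ∈ {s | s ∈ Δ.faces ∧ v ∈ s ∧ s ≠ {v} ∧ R s},
        convexHull ℝ (s : Set Plane)) ∩ Δ.space) \ {v}) := by
    intro R u hu hvu hu1 hR
    obtain ⟨w, hw, hwv⟩ : ∃ w ∈ u, w ≠ v := by
      by_contra! hc
      exact hu1 (Finset.eq_singleton_iff_unique_mem.2 ⟨hvu, hc⟩)
    refine mem_closure_diff_singleton_of_segment hwv.symm ?_
    have : segment ℝ v w ⊆ convexHull ℝ (u : Set Plane) :=
      segment_subset_convexHull (by simpa using hvu) (by simpa using hw)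
    exact subset_inter (this.trans (hmem R u hu hvu hu1 hR))
      (this.trans (Δ.convexHull_subset_space hu))
  -- The faces at `v` with `Q` and those without can meet only in `v`, since a larger common face
  -- would transfer `Q`. Then `v` would be a local cut point of the disk.
  refine no_local_cut e hvX (isClosed_biUnion_faces hΔ fun s => v ∈ s ∧ s ≠ {v} ∧ Q s)
    (isClosed_biUnion_faces hΔ fun s => v ∈ s ∧ s ≠ {v} ∧ ¬ Q s) ?_ ?_
    (hacc Q s hs hvs hs1 h) (hacc (fun s => ¬ Q s) t ht hvt ht1 hn)
  · filter_upwards [eventually_mem_convexHull hΔ v] with y hy hyX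
    obtain ⟨u, hu, hyu⟩ := Δ.mem_space_iff.1 hyX
    have hvu := (Δ.vertex_mem_convexHull_iff hv hu).1 (hy u hu hyu)
    by_cases hu1 : u = {v}
    · left
      rw [hu1] at hyu
      simp only [Finset.coe_singleton, convexHull_singleton, mem_singleton_iff] at hyu
      exact hmem Q s hs hvs hs1 h (subset_convexHull ℝ _ (by simpa [hyu] using hvs))
    · by_cases hQu : Q u
      · exact Or.inl (hmem Q u hu hvu hu1 hQu hyu)
      · exact Or.inr (hmem (fun s => ¬ Q s) u hu hvu hu1 hQu hyu)
  · rintro x ⟨hx1, hx2⟩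
    simp only [mem_iUnion, mem_ofPred_eq] at hx1 hx2
    obtain ⟨a, ⟨ha, hva, ha1, hQa⟩, hxa⟩ := hx1
    obtain ⟨b, ⟨hb, hvb, hb1, hQb⟩, hxb⟩ := hx2
    obtain ⟨hab, hxab⟩ := inter_mem_faces ha hb hxa hxb
    have hvab : v ∈ a ∩ b := Finset.mem_inter.2 ⟨hva, hvb⟩
    by_cases hab1 : a ∩ b = {v}
    · rw [hab1] at hxab
      simpa using hxab
    · exact absurd ((hQ _ hab _ hb hvab hab1 Finset.inter_subset_right).1
        ((hQ _ hab _ ha hvab hab1 Finset.inter_subset_left).2 hQa)) hQb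

/-- No vertex is isolated. -/
theorem exists_ne_singleton (hΔ : IsTriangulatedDisk Δ) {v : Plane} (hv : {v} ∈ Δ.faces) :
    ∃ s ∈ Δ.faces, v ∈ s ∧ s ≠ {v} := by
  classical
  by_contra! h
  obtain ⟨e⟩ := hΔ.homeomorphic_disk
  have hall : ∀ t ∈ Δ.faces, t = {v} := fun t ht =>
    faces_connected hΔ (fun s => s = {v}) (by
      intro s hs t ht hst
      constructor
      · rintro rfl
        exact h t ht (hst (by simp))
      · rintro rfl
        exact (Finset.subset_singleton_iff.1 hst).resolve_left
          (Δ.nonempty_of_mem_faces hs).ne_empty) hv ht rfl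
  have hX : ∀ x ∈ Δ.space, x = v := by
    intro x hx
    obtain ⟨u, hu, hxu⟩ := Δ.mem_space_iff.1 hx
    rw [hall u hu] at hxu
    simpa using hxu
  have hsub : ∀ a b : Metric.closedBall (0 : Plane) 1, a = b := fun a b =>
    e.symm.injective (Subtype.ext ((hX _ (e.symm a).2).trans (hX _ (e.symm b).2).symm))
  have h1 : ‖(!₂[1, 0] : Plane)‖ = 1 := by simp [EuclideanSpace.norm_eq]
  have := congrArg Subtype.val (hsub ⟨0, by simp⟩ ⟨!₂[1, 0], by simp [h1]⟩)
  simp only at this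
  rw [← this] at h1
  simp at h1

/-- Near the midpoint of an edge on no triangle, `|Δ|` would be the edge itself, and the midpoint
would be a local cut point separating its two halves. -/
theorem edge_subset_triangle (hΔ : IsTriangulatedDisk Δ) {v w : Plane} (hvw : v ≠ w)
    [DecidableEq Plane] (he : ({v, w} : Finset Plane) ∈ Δ.faces) :
    ∃ σ ∈ triangles Δ, ({v, w} : Finset Plane) ⊆ σ := by
  by_contra! hno
  obtain ⟨e⟩ := hΔ.homeomorphic_disk
  set m := midpoint ℝ v w with hm
  have hmseg : m ∈ segment ℝ v w := midpoint_mem_segment v w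
  have hhull : convexHull ℝ (({v, w} : Finset Plane) : Set Plane) = segment ℝ v w := by
    rw [Finset.coe_pair, convexHull_pair]
  have hmX : m ∈ Δ.space := Δ.convexHull_subset_space he (hhull ▸ hmseg)
  have hmv : v ≠ m := fun h => hvw ((left_eq_midpoint_iff ℝ).1 h)
  have hmw : w ≠ m := fun h => hvw ((right_eq_midpoint_iff ℝ).1 h)
  have hclosed : ∀ a b : Plane, IsClosed (segment ℝ a b) := fun a b => by
    rw [← convexHull_pair]; simpa using isClosed_convexHull_finset {a, b}
  have hvm : segment ℝ m v ⊆ segment ℝ v w :=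
    (convex_segment v w).segment_subset hmseg (left_mem_segment ℝ v w)
  have hwm : segment ℝ m w ⊆ segment ℝ v w :=
    (convex_segment v w).segment_subset hmseg (right_mem_segment ℝ v w)
  have hsegX : segment ℝ v w ⊆ Δ.space := hhull ▸ Δ.convexHull_subset_space he
  refine no_local_cut e hmX (hclosed m v) (hclosed m w) ?_ ?_
    (mem_closure_diff_singleton_of_segment hmv.symm (subset_inter le_rfl (hvm.trans hsegX)))
    (mem_closure_diff_singleton_of_segment hmw.symm (subset_inter le_rfl (hwm.trans hsegX)))
  · filter_upwards [eventually_mem_convexHull hΔ m] with y hy hyX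
    obtain ⟨u, hu, hyu⟩ := Δ.mem_space_iff.1 hyX
    have hmu := (inter_mem_faces hu he (hy u hu hyu) (hhull ▸ hmseg)).2
    -- The midpoint lies in the hull of `u ∩ {v, w}`. If an end were missing from `u`, the midpoint
    -- would equal the other end.
    have hsub : ({v, w} : Finset Plane) ⊆ u := by
      have key : ∀ a, a ∈ u ∩ {v, w} → a = v ∨ a = w := by simp
      intro a ha
      by_contra hau
      obtain ⟨b, hb, hbm⟩ : ∃ b, u ∩ {v, w} ⊆ {b} ∧ b ≠ m := by
        rcases Finset.mem_insert.1 ha with rfl | ha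
        · exact ⟨w, fun x hx => by
            rcases key x hx with rfl | rfl
            · exact absurd (Finset.mem_inter.1 hx).1 hau
            · simp, hmw⟩
        · rw [Finset.mem_singleton] at ha
          subst ha
          exact ⟨v, fun x hx => by
            rcases key x hx with rfl | rfl
            · simp
            · exact absurd (Finset.mem_inter.1 hx).1 hau, hmv⟩
      have := convexHull_mono (Finset.coe_subset.2 hb) hmu
      simp only [Finset.coe_singleton, convexHull_singleton, mem_singleton_iff] at this
      exact hbm this.symm
    have hu2 : u = {v, w} := by
      have h3 := card_face_le u hu
      have hu3 : u.card ≠ 3 := fun h => hno u ⟨hu, h⟩ hsub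
      exact (Finset.eq_of_subset_of_card_le hsub (by rw [Finset.card_pair hvw]; omega)).symm
    rw [hu2, hhull] at hyu
    rw [segment_eq_image'] at hyu
    obtain ⟨θ, ⟨h0, h1⟩, rfl⟩ := hyu
    rcases le_total θ (1 / 2) with hθ | hθ
    · left
      rw [segment_eq_image']
      refine ⟨1 - 2 * θ, ⟨by linarith, by linarith⟩, ?_⟩
      simp only [hm, midpoint_eq_smul_add, invOf_eq_inv]
      module
    · right
      rw [segment_eq_image']
      refine ⟨2 * θ - 1, ⟨by linarith, by linarith⟩, ?_⟩
      simp only [hm, midpoint_eq_smul_add, invOf_eq_inv]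
      module
  · rintro y ⟨hy1, hy2⟩
    rw [segment_eq_image'] at hy1 hy2
    obtain ⟨s, hs, rfl⟩ := hy1
    obtain ⟨t, ht, hst⟩ := hy2
    have h1 : (s + t) • (w - m) = 0 := by
      have hvm' : v - m = -(w - m) := by
        simp only [hm, midpoint_eq_smul_add, invOf_eq_inv]
        module
      simp only [hvm'] at hst
      have h2 := sub_eq_zero.2 hst
      rw [← h2]
      module
    have h3 := (smul_eq_zero.1 h1).resolve_right (sub_ne_zero.2 hmw)
    have hs0 : s = 0 := by linarith [hs.1, ht.1]
    simp [hs0]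

end Complex

/-! ### Orientation and plane coordinates -/

section Orientation

/-- Twice the signed area of the triangle `v`, `w`, `x`. -/
def orient (v w x : Plane) : ℝ := det2 (w - v) (x - v)

theorem orient_cyclic (v w x : Plane) : orient w x v = orient v w x := by
  simp only [orient, det2, PiLp.sub_apply]; ring

theorem orient_swap (v w x : Plane) : orient w v x = -orient v w x := by
  simp only [orient, det2, PiLp.sub_apply]; ring

theorem eq_smul_of_det2_eq_zero {a b : Plane} (ha : a ≠ 0) (h : det2 a b = 0) :
    ∃ t : ℝ, b = t • a := by
  have hn : a 0 * a 0 + a 1 * a 1 ≠ 0 := by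
    intro h0
    apply ha
    obtain ⟨h1, h2⟩ := mul_self_add_mul_self_eq_zero.1 h0
    ext i
    fin_cases i
    · exact h1
    · exact h2
  simp only [det2] at h
  obtain ⟨D, hD⟩ : ∃ D, D = a 0 * a 0 + a 1 * a 1 := ⟨_, rfl⟩
  rw [← hD] at hn
  refine ⟨(a 0 * b 0 + a 1 * b 1) / D, ?_⟩
  ext i
  fin_cases i
  · simp only [Fin.zero_eta, PiLp.smul_apply, smul_eq_mul]
    field_simp
    rw [hD]
    linear_combination -a 1 * h
  · simp only [Fin.mk_one, PiLp.smul_apply, smul_eq_mul]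
    field_simp
    rw [hD]
    linear_combination a 0 * h

theorem cramer {a b c : Plane} (h : det2 a b ≠ 0) :
    c = (det2 c b / det2 a b) • a + (det2 a c / det2 a b) • b := by
  obtain ⟨D, hD⟩ : ∃ D, D = det2 a b := ⟨_, rfl⟩
  rw [← hD] at h ⊢
  ext i
  fin_cases i
  · simp only [Fin.zero_eta, PiLp.smul_apply, PiLp.add_apply, smul_eq_mul]
    field_simp
    rw [hD]
    simp only [det2]
    ring
  · simp only [Fin.mk_one, PiLp.smul_apply, PiLp.add_apply, smul_eq_mul]
    field_simp
    rw [hD]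
    simp only [det2]
    ring

theorem mem_convexHull_triple {v w y : Plane} {c d : ℝ} (hc : 0 ≤ c) (hd : 0 ≤ d)
    (hcd : c + d ≤ 1) :
    v + c • (w - v) + d • (y - v) ∈ convexHull ℝ (({v, w, y} : Finset Plane) : Set Plane) := by
  have hsub := subset_convexHull ℝ (({v, w, y} : Finset Plane) : Set Plane)
  have := (convex_convexHull ℝ (({v, w, y} : Finset Plane) : Set Plane)).sum_mem
    (t := Finset.univ) (w := ![1 - c - d, c, d]) (z := ![v, w, y])
    (by intro i _; fin_cases i <;> simp <;> linarith)
    (by simp [Fin.sum_univ_three]; ring)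
    (by intro i _; fin_cases i <;> apply hsub <;> simp)
  convert this using 1
  simp only [Fin.sum_univ_three, Matrix.cons_val_zero, Matrix.cons_val_one, Matrix.cons_val]
  module

theorem orient_ne_zero_of_affineIndependent {v w x : Plane} (hvw : v ≠ w) (hvx : v ≠ x)
    (hwx : w ≠ x)
    (h : AffineIndependent ℝ ((↑) : ({v, w, x} : Finset Plane) → Plane)) : orient v w x ≠ 0 := by
  intro h0
  have hemb : Function.Injective
      (![⟨v, by simp⟩, ⟨w, by simp⟩, ⟨x, by simp⟩] : Fin 3 → ({v, w, x} : Finset Plane)) := by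
    intro i j hij
    fin_cases i <;> fin_cases j <;> simp_all
  have h3 := h.comp_embedding ⟨_, hemb⟩
  have h4 : ¬ Collinear ℝ (Set.range ![v, w, x]) := by
    rw [← affineIndependent_iff_not_collinear]
    have he : ((↑) : ({v, w, x} : Finset Plane) → Plane) ∘
        ![⟨v, by simp⟩, ⟨w, by simp⟩, ⟨x, by simp⟩] = ![v, w, x] := by
      funext i
      fin_cases i <;> rfl
    rw [← he]
    exact h3
  apply h4
  obtain ⟨t, ht⟩ := eq_smul_of_det2_eq_zero (sub_ne_zero.2 hvw.symm) h0
  rw [collinear_iff_of_mem (p₀ := v) (Set.mem_range.2 ⟨0, rfl⟩)]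
  refine ⟨w - v, ?_⟩
  rintro _ ⟨i, rfl⟩
  fin_cases i
  · exact ⟨0, by simp⟩
  · exact ⟨1, by simp⟩
  · exact ⟨t, by simp [← ht]⟩

end Orientation

/-! ### Oriented triangles, the two sides of an edge, and boundary edges -/

section Triangles

variable {Δ : Geometry.SimplicialComplex ℝ Plane}

/-- `v`, `w`, `x` are the vertices of a triangle of `Δ` in counterclockwise order. -/
def Tri (Δ : Geometry.SimplicialComplex ℝ Plane) (v w x : Plane) : Prop :=
  {v, w, x} ∈ Δ.faces ∧ 0 < orient v w x

theorem Tri.rotate {v w x : Plane} (h : Tri Δ v w x) : Tri Δ w x v := by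
  refine ⟨?_, by rw [orient_cyclic]; exact h.2⟩
  have : ({w, x, v} : Finset Plane) = {v, w, x} := by ext; simp; tauto
  rw [this]; exact h.1

theorem Tri.ne {v w x : Plane} (h : Tri Δ v w x) : v ≠ w := by
  rintro rfl
  have := h.2
  simp [orient, det2] at this

theorem Tri.mem_triangles {v w x : Plane} (h : Tri Δ v w x) : {v, w, x} ∈ triangles Δ :=
  ⟨h.1, Finset.card_eq_three.2 ⟨v, w, x, h.ne, h.rotate.rotate.ne.symm, h.rotate.ne, rfl⟩⟩

theorem Tri.not_swap {v w x : Plane} (h : Tri Δ v w x) : ¬ Tri Δ w v x := by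
  intro h'
  have h1 := h.2
  have h2 := h'.2
  rw [orient_swap] at h2
  linarith

theorem exists_tri_of_mem {σ : Finset Plane} (hσ : σ ∈ triangles Δ) {v w : Plane} (hv : v ∈ σ)
    (hw : w ∈ σ) (hvw : v ≠ w) : ∃ x, σ = {v, w, x} ∧ (Tri Δ v w x ∨ Tri Δ w v x) := by
  have hsub : ({v, w} : Finset Plane) ⊆ σ := by
    intro y hy
    rcases Finset.mem_insert.1 hy with rfl | hy
    · exact hv
    · rw [Finset.mem_singleton.1 hy]; exact hw
  have hcard : (σ \ {v, w}).card = 1 := by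
    rw [Finset.card_sdiff_of_subset hsub, hσ.2, Finset.card_pair hvw]
  obtain ⟨x, hx⟩ := Finset.card_eq_one.1 hcard
  have hxm : x ∈ σ \ {v, w} := by rw [hx]; simp
  simp only [Finset.mem_sdiff, Finset.mem_insert, Finset.mem_singleton, not_or] at hxm
  have hσe : σ = {v, w, x} := by
    refine (Finset.eq_of_subset_of_card_le ?_ ?_).symm
    · intro y hy
      simp only [Finset.mem_insert, Finset.mem_singleton] at hy
      rcases hy with rfl | rfl | rfl
      exacts [hv, hw, hxm.1]
    · rw [hσ.2, Finset.card_eq_three.2 ⟨v, w, x, hvw, Ne.symm hxm.2.1, Ne.symm hxm.2.2, rfl⟩]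
  have hne := orient_ne_zero_of_affineIndependent hvw (Ne.symm hxm.2.1) (Ne.symm hxm.2.2)
    (hσe ▸ Δ.indep hσ.1)
  refine ⟨x, hσe, ?_⟩
  rcases lt_or_gt_of_ne hne with h | h
  · right
    refine ⟨?_, by rw [orient_swap]; linarith⟩
    rw [Finset.insert_comm, ← hσe]
    exact hσ.1
  · exact Or.inl ⟨hσe ▸ hσ.1, h⟩

theorem exists_tri {σ : Finset Plane} (hσ : σ ∈ triangles Δ) {v : Plane} (hv : v ∈ σ) :
    ∃ w x, σ = {v, w, x} ∧ Tri Δ v w x := by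
  obtain ⟨w, hw, hwv⟩ : ∃ w ∈ σ, w ≠ v := by
    by_contra! hc
    have := hσ.2
    rw [Finset.eq_singleton_iff_unique_mem.2 ⟨hv, hc⟩] at this
    simp at this
  obtain ⟨x, hx, h | h⟩ := exists_tri_of_mem hσ hv hw hwv.symm
  · exact ⟨w, x, hx, h⟩
  · refine ⟨x, w, ?_, h.rotate⟩
    rw [hx]; congr 1; exact Finset.pair_comm w x

/-- There is at most one triangle on each side of an edge. -/
theorem Tri.unique {v w x y : Plane} (hx : Tri Δ v w x) (hy : Tri Δ v w y) : x = y := by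
  by_contra hxy
  set a := det2 (x - v) (y - v) / det2 (w - v) (y - v) with ha
  set d := det2 (w - v) (x - v) / det2 (w - v) (y - v) with hd
  have hxe : x - v = a • (w - v) + d • (y - v) := cramer (ne_of_gt hy.2)
  have hdpos : 0 < d := div_pos hx.2 hy.2
  -- Both triangles contain the point at distance of order `ε` from the midpoint of `v w`, moved
  -- towards `x`. In the coordinates of the second triangle its coefficients are `(1 - ε) / 2 + ε *
  -- a` and `ε * d`; this `ε` makes them nonnegative with sum at most `1`. For `x ≠ y` the triangles
  -- share only vertices of the edge, but the point is off its line.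
  set ε := 1 / (2 * (1 + |a| + d)) with hε
  have hden : 0 < 1 + |a| + d := by positivity
  have hεpos : 0 < ε := by positivity
  have hεeq : ε * (1 + |a| + d) = 1 / 2 := by rw [hε]; field_simp
  have h1 := mul_le_mul_of_nonneg_left (le_abs_self a) hεpos.le
  have h2 := mul_le_mul_of_nonneg_left (neg_abs_le a) hεpos.le
  have h3 := mul_nonneg hεpos.le (abs_nonneg a)
  have h4 := mul_pos hεpos hdpos
  have hq1 := mem_convexHull_triple (v := v) (w := w) (y := x) (c := (1 - ε) / 2) (d := ε)
    (by linarith) hεpos.le (by linarith)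
  have hq2 := mem_convexHull_triple (v := v) (w := w) (y := y) (c := (1 - ε) / 2 + ε * a)
    (d := ε * d) (by linarith) h4.le (by linarith)
  have heq : v + ((1 - ε) / 2 + ε * a) • (w - v) + (ε * d) • (y - v) =
      v + ((1 - ε) / 2) • (w - v) + ε • (x - v) := by
    rw [hxe]; module
  rw [heq] at hq2
  have hq := (inter_mem_faces hx.1 hy.1 hq1 hq2).2
  have hsub : ({v, w, x} ∩ {v, w, y} : Finset Plane) ⊆ {v, w} := by
    intro z
    simp only [Finset.mem_inter, Finset.mem_insert, Finset.mem_singleton]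
    rintro ⟨rfl | rfl | rfl, h⟩
    · simp
    · simp
    · rcases h with h | h | h
      · exact absurd h hx.rotate.rotate.ne
      · exact absurd h.symm hx.rotate.ne
      · exact absurd h hxy
  have hq' := convexHull_mono (Finset.coe_subset.2 hsub) hq
  rw [Finset.coe_pair, convexHull_pair, segment_eq_image'] at hq'
  obtain ⟨t, -, ht⟩ := hq'
  have e0 := congrArg (fun w : Plane => w 0) ht
  have e1 := congrArg (fun w : Plane => w 1) ht
  have h5 := mul_pos hεpos hx.2
  simp only [PiLp.sub_apply, PiLp.add_apply, PiLp.smul_apply, smul_eq_mul, orient, det2] at e0 e1 h5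
  have h6 : ε * ((w 0 - v 0) * (x 1 - v 1) - (w 1 - v 1) * (x 0 - v 0)) = 0 := by
    linear_combination (w 1 - v 1) * e0 - (w 0 - v 0) * e1
  linarith

/-- Once the first vertex is fixed, only one of the two orders of the others is counterclockwise. -/
theorem Tri.eq_of_eq {v w x w' x' : Plane} (h : Tri Δ v w x) (h' : Tri Δ v w' x')
    (he : ({v, w, x} : Finset Plane) = {v, w', x'}) : w = w' ∧ x = x' := by
  have hw' : w' ∈ ({v, w, x} : Finset Plane) := by rw [he]; simp
  have hx' : x' ∈ ({v, w, x} : Finset Plane) := by rw [he]; simp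
  simp only [Finset.mem_insert, Finset.mem_singleton] at hw' hx'
  rcases hw' with rfl | rfl | rfl
  · exact absurd rfl h'.ne
  · rcases hx' with rfl | rfl | rfl
    · exact absurd rfl h'.rotate.rotate.ne
    · exact absurd rfl h'.rotate.ne
    · exact ⟨rfl, rfl⟩
  · rcases hx' with rfl | rfl | rfl
    · exact absurd rfl h'.rotate.rotate.ne
    · exact absurd h'.rotate.rotate h.not_swap.elim
    · exact absurd rfl h'.rotate.ne

/-- Purity of the complex: no vertex is isolated, and no edge is bare by `edge_subset_triangle`. -/
theorem face_subset_triangle (hΔ : IsTriangulatedDisk Δ) {s : Finset Plane} (hs : s ∈ Δ.faces) :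
    ∃ σ ∈ triangles Δ, s ⊆ σ := by
  have hedge : ∀ t ∈ Δ.faces, 2 ≤ t.card → ∃ σ ∈ triangles Δ, t ⊆ σ := by
    intro t ht h2
    have h3 := card_face_le t ht
    obtain h | h : t.card = 2 ∨ t.card = 3 := by omega
    · obtain ⟨v, w, hvw, rfl⟩ := Finset.card_eq_two.1 h
      exact edge_subset_triangle hΔ hvw ht
    · exact ⟨t, ⟨ht, h⟩, le_rfl⟩
  by_cases h2 : 2 ≤ s.card
  · exact hedge s hs h2
  · have hpos := (Δ.nonempty_of_mem_faces hs).card_pos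
    obtain ⟨v, rfl⟩ := Finset.card_eq_one.1 (show s.card = 1 by omega)
    obtain ⟨t, ht, hvt, htv⟩ := exists_ne_singleton hΔ hs
    obtain ⟨σ, hσ, htσ⟩ := hedge t ht (by
      by_contra hlt
      have := Finset.card_pos.2 ⟨v, hvt⟩
      obtain ⟨u, rfl⟩ := Finset.card_eq_one.1 (show t.card = 1 by omega)
      rw [Finset.mem_singleton.1 hvt] at htv
      exact htv rfl)
    exact ⟨σ, hσ, fun y hy => htσ (by rwa [Finset.mem_singleton.1 hy])⟩

/-- The triangles at a vertex are connected to one another through edges at that vertex. -/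
theorem star_connected (hΔ : IsTriangulatedDisk Δ) {v : Plane} (Q : Finset Plane → Prop)
    (hQ : ∀ σ ∈ triangles Δ, ∀ τ ∈ triangles Δ, ∀ w, v ≠ w → v ∈ σ → v ∈ τ → w ∈ σ → w ∈ τ →
      Q σ → Q τ)
    {σ τ : Finset Plane} (hσ : σ ∈ triangles Δ) (hτ : τ ∈ triangles Δ) (hvσ : v ∈ σ)
    (hvτ : v ∈ τ) (h : Q σ) : Q τ := by
  have hv : {v} ∈ Δ.faces := Δ.down_closed hσ.1 (by simpa using hvσ) (by simp)
  have hne : ∀ ρ ∈ triangles Δ, ρ ≠ {v} := by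
    rintro ρ hρ rfl
    simpa using hρ.2
  have key : ∀ ρ ∈ triangles Δ, v ∈ ρ → ∀ ρ' ∈ triangles Δ, Q ρ' → ∀ s ⊆ ρ, s ⊆ ρ' → v ∈ s →
      s ≠ {v} → Q ρ := by
    intro ρ hρ hvρ ρ' hρ' hQρ' s hs hs' hvs hsv
    obtain ⟨w, hw, hwv⟩ : ∃ w ∈ s, w ≠ v := by
      by_contra! hc
      exact hsv (Finset.eq_singleton_iff_unique_mem.2 ⟨hvs, hc⟩)
    exact hQ ρ' hρ' ρ hρ w hwv.symm (hs' hvs) hvρ (hs' hw) (hs hw) hQρ'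
  -- `Q` is extended to faces as "lies on a triangle with `Q`". Triangles sharing a face at `v`
  -- other than `{v}` share an edge at `v`, so the choice of triangle is immaterial.
  obtain ⟨ρ, hρ, hτρ, hQρ⟩ := link_connected hΔ hv (fun s => ∃ ρ ∈ triangles Δ, s ⊆ ρ ∧ Q ρ) (by
    intro s hs t ht hvs hsv hst
    constructor
    · rintro ⟨ρ, hρ, hsρ, hQρ⟩
      obtain ⟨ρ', hρ', htρ'⟩ := face_subset_triangle hΔ ht
      exact ⟨ρ', hρ', htρ', key ρ' hρ' (htρ' (hst hvs)) ρ hρ hQρ s (hst.trans htρ') hsρ hvs hsv⟩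
    · rintro ⟨ρ, hρ, htρ, hQρ⟩
      exact ⟨ρ, hρ, hst.trans htρ, hQρ⟩) hσ.1 hτ.1 hvσ hvτ (hne σ hσ) (hne τ hτ)
      ⟨σ, hσ, le_rfl, h⟩
  exact key τ hτ hvτ ρ hρ hQρ τ le_rfl hτρ hvτ (hne τ hτ)

/-- Any two triangles are connected through triangles with a common edge. -/
theorem triangles_connected (hΔ : IsTriangulatedDisk Δ) (Q : Finset Plane → Prop)
    (hQ : ∀ σ ∈ triangles Δ, ∀ τ ∈ triangles Δ, ∀ v w, v ≠ w → v ∈ σ → v ∈ τ → w ∈ σ → w ∈ τ →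
      Q σ → Q τ)
    {σ τ : Finset Plane} (hσ : σ ∈ triangles Δ) (hτ : τ ∈ triangles Δ) (h : Q σ) : Q τ := by
  have key : ∀ ρ ∈ triangles Δ, ∀ ρ' ∈ triangles Δ, Q ρ' → ∀ s ∈ Δ.faces, s ⊆ ρ → s ⊆ ρ' →
      Q ρ := by
    intro ρ hρ ρ' hρ' hQρ' s hs hsρ hsρ'
    obtain ⟨v, hv⟩ := Δ.nonempty_of_mem_faces hs
    exact star_connected hΔ Q (fun σ hσ τ hτ w => hQ σ hσ τ hτ v w) hρ' hρ (hsρ' hv) (hsρ hv) hQρ'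
  obtain ⟨ρ, hρ, hτρ, hQρ⟩ := faces_connected hΔ (fun s => ∃ ρ ∈ triangles Δ, s ⊆ ρ ∧ Q ρ) (by
    intro s hs t ht hst
    constructor
    · rintro ⟨ρ, hρ, hsρ, hQρ⟩
      obtain ⟨ρ', hρ', htρ'⟩ := face_subset_triangle hΔ ht
      exact ⟨ρ', hρ', htρ', key ρ' hρ' ρ hρ hQρ s hs (hst.trans htρ') hsρ⟩
    · rintro ⟨ρ, hρ, htρ, hQρ⟩
      exact ⟨ρ, hρ, hst.trans htρ, hQρ⟩) hσ.1 hτ.1 ⟨σ, hσ, le_rfl, h⟩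
  exact key τ hτ ρ hρ hQρ τ hτ.1 le_rfl hτρ

/-- The triangle to the left of the edge from `v` to `w` (if there is one). -/
def leftTri (Δ : Geometry.SimplicialComplex ℝ Plane) (v w : Plane) : Finset Plane :=
  if h : ∃ x, Tri Δ v w x then {v, w, h.choose} else ∅

theorem Tri.leftTri_eq {v w x : Plane} (h : Tri Δ v w x) : leftTri Δ v w = {v, w, x} := by
  have h' : ∃ x, Tri Δ v w x := ⟨x, h⟩
  rw [leftTri, dif_pos h', h'.choose_spec.unique h]

/-- The edge from `v` to `w` is an interior edge: it has a triangle on each side. -/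
def IsInteriorEdge (Δ : Geometry.SimplicialComplex ℝ Plane) (v w : Plane) : Prop :=
  (∃ x, Tri Δ v w x) ∧ ∃ x, Tri Δ w v x

theorem IsInteriorEdge.symm {v w : Plane} (h : IsInteriorEdge Δ v w) : IsInteriorEdge Δ w v :=
  ⟨h.2, h.1⟩

theorem IsInteriorEdge.ne {v w : Plane} (h : IsInteriorEdge Δ v w) : v ≠ w := h.1.choose_spec.ne

theorem IsInteriorEdge.left_mem {v w : Plane} (h : IsInteriorEdge Δ v w) :
    leftTri Δ v w ∈ triangles Δ ∧ v ∈ leftTri Δ v w ∧ w ∈ leftTri Δ v w := by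
  obtain ⟨x, hx⟩ := h.1
  rw [hx.leftTri_eq]
  exact ⟨hx.mem_triangles, by simp, by simp⟩

theorem eq_leftTri {σ : Finset Plane} (hσ : σ ∈ triangles Δ) {v w : Plane} (hv : v ∈ σ)
    (hw : w ∈ σ) (hvw : v ≠ w) :
    ((∃ x, Tri Δ v w x) ∧ σ = leftTri Δ v w) ∨ ((∃ x, Tri Δ w v x) ∧ σ = leftTri Δ w v) := by
  obtain ⟨x, hx, h | h⟩ := exists_tri_of_mem hσ hv hw hvw
  · exact Or.inl ⟨⟨x, h⟩, by rw [h.leftTri_eq, hx]⟩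
  · exact Or.inr ⟨⟨x, h⟩, by rw [h.leftTri_eq, hx, Finset.insert_comm]⟩

theorem leftTri_ne {v w : Plane} (h : IsInteriorEdge Δ v w) : leftTri Δ v w ≠ leftTri Δ w v := by
  obtain ⟨⟨x, hx⟩, y, hy⟩ := h
  rw [hx.leftTri_eq, hy.leftTri_eq]
  intro he
  have : y ∈ ({v, w, x} : Finset Plane) := by rw [he]; simp
  simp only [Finset.mem_insert, Finset.mem_singleton] at this
  rcases this with rfl | rfl | rfl
  · exact hy.rotate.ne rfl
  · exact hy.rotate.rotate.ne rfl
  · exact hx.not_swap hy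

/-- Two different triangles with two common vertices are the two sides of an interior edge. -/
theorem isInteriorEdge_of_mem {σ τ : Finset Plane} (hσ : σ ∈ triangles Δ) (hτ : τ ∈ triangles Δ)
    (hστ : σ ≠ τ) {v w : Plane} (hvw : v ≠ w) (hvσ : v ∈ σ) (hwσ : w ∈ σ) (hvτ : v ∈ τ)
    (hwτ : w ∈ τ) : IsInteriorEdge Δ v w ∧ ((σ = leftTri Δ v w ∧ τ = leftTri Δ w v) ∨
      (σ = leftTri Δ w v ∧ τ = leftTri Δ v w)) := by
  rcases eq_leftTri hσ hvσ hwσ hvw with ⟨h1, h2⟩ | ⟨h1, h2⟩ <;>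
  rcases eq_leftTri hτ hvτ hwτ hvw with ⟨h3, h4⟩ | ⟨h3, h4⟩
  · exact absurd (h2.trans h4.symm) hστ
  · exact ⟨⟨h1, h3⟩, Or.inl ⟨h2, h4⟩⟩
  · exact ⟨⟨h3, h1⟩, Or.inr ⟨h2, h4⟩⟩
  · exact absurd (h2.trans h4.symm) hστ

theorem mem_boundaryFaces_of_card_eq_two {e : Finset Plane} (he : e ∈ edges Δ) :
    e ∈ boundaryFaces Δ ↔ ∃! σ, σ ∈ triangles Δ ∧ e ⊆ σ := by
  constructor
  · rintro ⟨-, e', he', hee', h⟩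
    rwa [Finset.eq_of_subset_of_card_le hee' (by rw [he.2, he'.2])]
  · exact fun h => ⟨he.1, e, he, le_rfl, h⟩

/-- By purity an edge lies on some triangle; if it is not on exactly one, it lies on two, which must
be on opposite sides. -/
theorem mem_interiorEdges_iff (hΔ : IsTriangulatedDisk Δ) {v w : Plane} (hvw : v ≠ w) :
    {v, w} ∈ interiorEdges Δ ↔ IsInteriorEdge Δ v w := by
  constructor
  · rintro ⟨he, hb⟩
    rw [mem_boundaryFaces_of_card_eq_two he] at hb
    obtain ⟨σ, hσ, heσ⟩ := face_subset_triangle hΔ he.1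
    have : ∃ τ, τ ∈ triangles Δ ∧ ({v, w} : Finset Plane) ⊆ τ ∧ τ ≠ σ := by
      by_contra! hc
      exact hb ⟨σ, ⟨hσ, heσ⟩, fun τ hτ => hc τ hτ.1 hτ.2⟩
    obtain ⟨τ, hτ, heτ, hne⟩ := this
    exact (isInteriorEdge_of_mem hσ hτ hne.symm hvw (heσ (by simp)) (heσ (by simp))
      (heτ (by simp)) (heτ (by simp))).1
  · intro h
    obtain ⟨h1, h1v, h1w⟩ := h.left_mem
    obtain ⟨h2, h2w, h2v⟩ := h.symm.left_mem
    have hs1 : ({v, w} : Finset Plane) ⊆ leftTri Δ v w := by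
      simp [Finset.insert_subset_iff, h1v, h1w]
    have hs2 : ({v, w} : Finset Plane) ⊆ leftTri Δ w v := by
      simp [Finset.insert_subset_iff, h2v, h2w]
    have he : ({v, w} : Finset Plane) ∈ edges Δ :=
      ⟨Δ.down_closed h1.1 hs1 (by simp), Finset.card_pair hvw⟩
    refine ⟨he, ?_⟩
    rw [mem_boundaryFaces_of_card_eq_two he]
    rintro ⟨σ, -, hσ⟩
    exact leftTri_ne h ((hσ _ ⟨h1, hs1⟩).trans (hσ _ ⟨h2, hs2⟩).symm)

/-- A boundary edge at `v` would make `v` a boundary vertex. -/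
theorem Tri.isInteriorEdge_of_notMem (hΔ : IsTriangulatedDisk Δ) {v w x : Plane}
    (h : Tri Δ v w x) (hv : {v} ∉ boundaryFaces Δ) :
    IsInteriorEdge Δ v w ∧ IsInteriorEdge Δ v x := by
  have key : ∀ y ∈ ({v, w, x} : Finset Plane), v ≠ y → IsInteriorEdge Δ v y := by
    intro y hy hvy
    have hsub : ({v, y} : Finset Plane) ⊆ {v, w, x} := by
      rw [Finset.insert_subset_iff, Finset.singleton_subset_iff]
      exact ⟨by simp, hy⟩
    have he : ({v, y} : Finset Plane) ∈ edges Δ :=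
      ⟨Δ.down_closed h.1 hsub (by simp), Finset.card_pair hvy⟩
    rw [← mem_interiorEdges_iff hΔ hvy]
    refine ⟨he, fun hb => hv ?_⟩
    rw [mem_boundaryFaces_of_card_eq_two he] at hb
    exact ⟨Δ.down_closed h.1 (by simp) (by simp), _, he, by simp, hb⟩
  exact ⟨key w (by simp) h.ne, key x (by simp) h.rotate.rotate.ne.symm⟩

theorem exists_boundary_edge (hΔ : IsTriangulatedDisk Δ) {v : Plane}
    (hv : {v} ∈ boundaryFaces Δ) :
    ∃ w, ¬ IsInteriorEdge Δ v w ∧ ((∃ x, Tri Δ v w x) ∨ ∃ x, Tri Δ w v x) := by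
  obtain ⟨-, e, he, hve, hb⟩ := hv
  obtain ⟨a, b, hab, rfl⟩ := Finset.card_eq_two.1 he.2
  have hmain : ∀ w, v ≠ w → ({v, w} : Finset Plane) ∈ edges Δ →
      (∃! σ, σ ∈ triangles Δ ∧ ({v, w} : Finset Plane) ⊆ σ) →
      ¬ IsInteriorEdge Δ v w ∧ ((∃ x, Tri Δ v w x) ∨ ∃ x, Tri Δ w v x) := by
    intro w hvw he hb
    refine ⟨fun h => ?_, ?_⟩
    · exact ((mem_interiorEdges_iff hΔ hvw).2 h).2 ((mem_boundaryFaces_of_card_eq_two he).2 hb)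
    · obtain ⟨σ, ⟨hσ, heσ⟩, -⟩ := hb
      rcases eq_leftTri hσ (heσ (by simp)) (heσ (by simp)) hvw with h | h
      exacts [Or.inl h.1, Or.inr h.1]
  have : v = a ∨ v = b := by simpa using hve
  rcases this with rfl | rfl
  · exact ⟨b, hmain b hab he hb⟩
  · rw [Finset.pair_comm] at he hb
    exact ⟨a, hmain a hab.symm he hb⟩

end Triangles

/-! ### Vanishing of the first simplicial cohomology of the disk -/

section Cohomology

variable {Δ : Geometry.SimplicialComplex ℝ Plane}

/-- The open star of a vertex, as a subset of `|Δ|`. -/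
def openStar (Δ : Geometry.SimplicialComplex ℝ Plane) (v : Plane) : Set Δ.space :=
  {x | ∀ s ∈ Δ.faces, (x : Plane) ∈ convexHull ℝ (s : Set Plane) → v ∈ s}

theorem isOpen_openStar (hΔ : IsTriangulatedDisk Δ) (v : Plane) : IsOpen (openStar Δ v) := by
  have h := (isClosed_biUnion_faces hΔ fun s => v ∉ s).preimage
    (continuous_subtype_val : Continuous ((↑) : Δ.space → Plane))
  rw [← isOpen_compl_iff] at h
  convert h using 1
  ext x
  simp only [openStar, mem_ofPred_eq, mem_compl_iff, mem_preimage, mem_iUnion, exists_prop,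
    not_exists, not_and]
  constructor
  · intro hx s hs hxs
    exact hs.2 (hx s hs.1 hxs)
  · intro hx s hs hxs
    by_contra hv
    exact hx s ⟨hs, hv⟩ hxs

/-- A face `s` of least size containing `x` lies in every face `t` containing `x`, because `s ∩ t`
is again such a face. Any vertex of `s` serves. -/
theorem exists_mem_openStar (x : Δ.space) : ∃ v, x ∈ openStar Δ v := by
  have h : ∃ n, ∃ s ∈ Δ.faces, (x : Plane) ∈ convexHull ℝ (s : Set Plane) ∧ s.card = n := by
    obtain ⟨s, hs, hx⟩ := Δ.mem_space_iff.1 x.2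
    exact ⟨_, s, hs, hx, rfl⟩
  obtain ⟨s, hs, hx, hcard⟩ := Nat.find_spec h
  obtain ⟨v, hv⟩ := Δ.nonempty_of_mem_faces hs
  refine ⟨v, fun t ht hxt => ?_⟩
  obtain ⟨hst, hxst⟩ := inter_mem_faces hs ht hx hxt
  have hmin : s.card ≤ (s ∩ t).card := by
    rw [hcard]; exact Nat.find_min' h ⟨_, hst, hxst, rfl⟩
  have := Finset.eq_of_subset_of_card_le Finset.inter_subset_left hmin
  rw [← this] at hv
  exact Finset.mem_of_mem_inter_right hv

theorem exists_triangle_mem (hΔ : IsTriangulatedDisk Δ) {x : Plane} (hx : x ∈ Δ.space) :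
    ∃ σ ∈ triangles Δ, x ∈ convexHull ℝ (σ : Set Plane) := by
  obtain ⟨s, hs, hx⟩ := Δ.mem_space_iff.1 hx
  obtain ⟨σ, hσ, hsσ⟩ := face_subset_triangle hΔ hs
  exact ⟨σ, hσ, convexHull_mono (Finset.coe_subset.2 hsσ) hx⟩

/-- The fiber bundle over `|Δ|` with discrete fiber `V` given by a simplicial `1`-cocycle. -/
def cocycleBundle (hΔ : IsTriangulatedDisk Δ) {V : Type*} [AddCommGroup V] [TopologicalSpace V]
    [DiscreteTopology V] (c : Plane → Plane → V)
    (hc : ∀ σ ∈ triangles Δ, ∀ u ∈ σ, ∀ v ∈ σ, ∀ w ∈ σ, c u v + c v w = c u w) :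
    FiberBundleCore Plane Δ.space V where
  baseSet := openStar Δ
  isOpen_baseSet := isOpen_openStar hΔ
  indexAt x := (exists_mem_openStar x).choose
  mem_baseSet_at x := (exists_mem_openStar x).choose_spec
  -- The charts are the open stars. A point common to several open stars lies in a triangle having
  -- all their centres as vertices, so the cocycle identity on triangles is the compatibility of
  -- these translations.
  coordChange i j _ a := a + c i j
  coordChange_self i x hx a := by
    obtain ⟨σ, hσ, hxσ⟩ := exists_triangle_mem hΔ x.2
    have hi := hx σ hσ.1 hxσ
    have := hc σ hσ i hi i hi i hi
    simpa using this
  continuousOn_coordChange i j :=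
    ((continuous_of_discreteTopology (f := fun a : V => a + c i j)).comp
      continuous_snd).continuousOn
  coordChange_comp i j k x hx a := by
    obtain ⟨σ, hσ, hxσ⟩ := exists_triangle_mem hΔ x.2
    rw [add_assoc, hc σ hσ i (hx.1.1 σ hσ.1 hxσ) j (hx.1.2 σ hσ.1 hxσ) k (hx.2 σ hσ.1 hxσ)]

theorem contractibleSpace_space (hΔ : IsTriangulatedDisk Δ) : ContractibleSpace Δ.space := by
  obtain ⟨e⟩ := hΔ.homeomorphic_disk
  have := (convex_closedBall (0 : Plane) 1).contractibleSpace
    (Metric.nonempty_closedBall.2 zero_le_one)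
  exact e.contractibleSpace

/-- Simplicial `1`-cocycles on a triangulated disk are coboundaries. -/
theorem exists_coboundary (hΔ : IsTriangulatedDisk Δ) {V : Type*} [AddCommGroup V]
    (c : Plane → Plane → V)
    (hc : ∀ σ ∈ triangles Δ, ∀ u ∈ σ, ∀ v ∈ σ, ∀ w ∈ σ, c u v + c v w = c u w) :
    ∃ b : Plane → V, ∀ σ ∈ triangles Δ, ∀ v ∈ σ, ∀ w ∈ σ, c v w = b v - b w := by
  let _ : TopologicalSpace V := ⊥
  have _ : DiscreteTopology V := ⟨rfl⟩
  have _ := contractibleSpace_space hΔ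
  set Z := cocycleBundle hΔ c hc with hZ
  have hcov : IsCoveringMap (Bundle.TotalSpace.proj : Bundle.TotalSpace V Z.Fiber → Δ.space) :=
    FiberBundle.isCoveringMap
  obtain ⟨y, ⟨H⟩⟩ := id_nullhomotopic Δ.space
  -- The homotopy from the constant map `y` to the identity is lifted to the covering space,
  -- starting from one point above `y`. At time `1` the lift is a global section `s`.
  set H' : C(unitInterval × Δ.space, Δ.space) := H.symm.toContinuousMap with hH'
  set L := hcov.liftHomotopy H' (ContinuousMap.const _ ⟨y, (0 : V)⟩) (fun a => H.symm.map_zero_left a)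
    with hL
  set s : Δ.space → Bundle.TotalSpace V Z.Fiber := fun x => L (1, x) with hs
  have hscont : Continuous s := L.continuous.comp (by fun_prop)
  have hsproj : ∀ x, (s x).proj = x := fun x =>
    (congrFun (hcov.liftHomotopy_lifts H' _ _) (1, x)).trans (H.symm.map_one_left x)
  set a : Plane → Δ.space → V := fun v x => (Z.localTriv v (s x)).2 with ha
  have hcont : ∀ v, ContinuousOn (a v) (openStar Δ v) := by
    intro v
    refine continuous_snd.comp_continuousOn
      ((Z.localTriv v).continuousOn.comp hscont.continuousOn ?_)
    intro x hx
    rw [Z.mem_localTriv_source, hsproj]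
    exact hx
  have hchange : ∀ v w x, x ∈ openStar Δ v → x ∈ openStar Δ w → a w x = a v x + c v w := by
    intro v w x hv hw
    have h1 := Z.coordChange_comp (Z.indexAt x) v w x ⟨⟨Z.mem_baseSet_at x, hv⟩, hw⟩ (s x).2
    simp only [ha, Z.localTriv_apply, hsproj]
    exact h1.symm
  -- The section read in the chart of `v` is continuous with discrete values, hence constant on the
  -- half edge from `v` to the midpoint, which stays in the open star of `v`. Comparing the charts
  -- of `v` and `w` at the midpoint then expresses `c v w` through the values at `v` and at `w`.
  have hseg : ∀ σ ∈ triangles Δ, ∀ (v : σ) (w : σ), (v : Plane) ≠ w →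
      ∀ (m : Δ.space) (_ : (m : Plane) = midpoint ℝ (v : Plane) w) (hv : (v : Plane) ∈ Δ.space),
      m ∈ openStar Δ v ∧ a v m = a v ⟨v, hv⟩ := by
    rintro σ hσ ⟨v, hvσ⟩ ⟨w, hwσ⟩ hvw ⟨_, hm⟩ rfl hv
    simp only at hvw hm hv ⊢
    have hwseg : w ∉ segment ℝ v (midpoint ℝ v w) := by
      rw [segment_eq_image']
      rintro ⟨t, ⟨ht0, ht1⟩, ht⟩
      have h1 : (1 - t / 2) • (w - v) = 0 := by
        have h2 := sub_eq_zero.2 ht.symm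
        rw [← h2]
        simp only [midpoint_eq_smul_add, invOf_eq_inv]
        module
      rcases smul_eq_zero.1 h1 with h | h
      · linarith
      · exact hvw (sub_eq_zero.1 h).symm
    have hsub : segment ℝ v (midpoint ℝ v w) ⊆ segment ℝ v w :=
      (convex_segment v w).segment_subset (left_mem_segment ℝ v w) (midpoint_mem_segment v w)
    have he : ({v, w} : Finset Plane) ∈ Δ.faces := Δ.down_closed hσ.1
      (by simp [Finset.insert_subset_iff, hvσ, hwσ]) (by simp)
    have hhull : convexHull ℝ (({v, w} : Finset Plane) : Set Plane) = segment ℝ v w := by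
      rw [Finset.coe_pair, convexHull_pair]
    have hstar : ∀ x : Δ.space, (x : Plane) ∈ segment ℝ v (midpoint ℝ v w) → x ∈ openStar Δ v := by
      intro x hx s hs' hxs
      have hxe := (inter_mem_faces hs' he hxs (hhull ▸ hsub hx)).2
      by_contra hvs
      have h1 : s ∩ {v, w} ⊆ {w} := by
        intro z hz
        rw [Finset.mem_inter, Finset.mem_insert] at hz
        rcases hz with ⟨h1, rfl | h2⟩
        · exact absurd h1 hvs
        · exact h2
      have h2 := convexHull_mono (Finset.coe_subset.2 h1) hxe
      simp only [Finset.coe_singleton, convexHull_singleton, mem_singleton_iff] at h2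
      exact hwseg (h2 ▸ hx)
    have hK : IsPreconnected
        ((↑) ⁻¹' segment ℝ v (midpoint ℝ v w) : Set Δ.space) := by
      rw [← IsInducing.subtypeVal.isPreconnected_image, Subtype.image_preimage_coe,
        inter_eq_right.2 (hsub.trans (hhull ▸ Δ.convexHull_subset_space he))]
      exact (convex_segment _ _).isPreconnected
    refine ⟨hstar _ (right_mem_segment _ _ _), ?_⟩
    exact hK.constant ((hcont v).mono fun x hx => hstar x hx)
      (right_mem_segment _ _ _) (left_mem_segment _ _ _)
  refine ⟨fun v => if hv : v ∈ Δ.space then -a v ⟨v, hv⟩ else 0, fun σ hσ v hvσ w hwσ => ?_⟩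
  have hv : v ∈ Δ.space := Δ.subset_space hσ.1 hvσ
  have hw : w ∈ Δ.space := Δ.subset_space hσ.1 hwσ
  simp only [dif_pos hv, dif_pos hw]
  by_cases hvw : v = w
  · subst hvw
    simpa using hc σ hσ v hvσ v hvσ v hvσ
  · have hm : midpoint ℝ v w ∈ Δ.space := Δ.convexHull_subset_space hσ.1
      (segment_subset_convexHull (by exact_mod_cast hvσ) (by exact_mod_cast hwσ)
        (midpoint_mem_segment v w))
    obtain ⟨h1, h2⟩ := hseg σ hσ ⟨v, hvσ⟩ ⟨w, hwσ⟩ hvw ⟨_, hm⟩ rfl hv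
    obtain ⟨h3, h4⟩ := hseg σ hσ ⟨w, hwσ⟩ ⟨v, hvσ⟩ (Ne.symm hvw) ⟨_, hm⟩
      (midpoint_comm _ _) hw
    have h5 := hchange v w _ h1 h3
    rw [h2, h4] at h5
    rw [h5]
    abel

end Cohomology

/-! ### Difference equations on paths and cycles -/

section LinearAlgebra

/-- Difference equations on a finite connected graph which is a path or a cycle. -/
theorem exists_difference_solution {T N V : Type*} [Fintype T] [Fintype N] [AddCommGroup V]
    [Module ℝ V] [FiniteDimensional ℝ V] [Nonempty T] (l r : N → T)
    (hconn : ∀ s : T → V, (∀ n, s (l n) = s (r n)) → ∀ t t', s t = s t') (D : N → V)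
    (h : Fintype.card N < Fintype.card T ∨
      (Function.Bijective l ∧ Function.Bijective r ∧ ∑ n, D n = 0)) :
    ∃ s : T → V, ∀ n, s (l n) - s (r n) = D n := by
  let A : (T → V) →ₗ[ℝ] (N → V) := LinearMap.funLeft ℝ V l - LinearMap.funLeft ℝ V r
  have hA : ∀ s n, A s n = s (l n) - s (r n) := fun s n => rfl
  let cst : V →ₗ[ℝ] (T → V) := LinearMap.pi fun _ => LinearMap.id
  have hker : LinearMap.ker A = LinearMap.range cst := by
    ext s
    rw [LinearMap.mem_ker, LinearMap.mem_range]
    constructor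
    · intro hs
      have hs' : ∀ n, s (l n) = s (r n) := fun n => sub_eq_zero.1 (congrFun hs n)
      exact ⟨s (Classical.arbitrary T), funext fun t => hconn s hs' _ _⟩
    · rintro ⟨v, rfl⟩
      funext n
      exact sub_self v
  have hcst : Function.Injective cst := fun v w hvw => congrFun hvw (Classical.arbitrary T)
  -- The kernel of the difference map is the constants, so its range has dimension `(|T| - 1) * dim
  -- V`. With fewer edges than nodes this fills the target. When both end maps are bijections, it is
  -- the dimension of the sum-zero functions, which contain the range.
  have hdim := LinearMap.finrank_range_add_finrank_ker A
  rw [hker, LinearMap.finrank_range_of_inj hcst, Module.finrank_pi_fintype] at hdim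
  simp only [Finset.sum_const, Finset.card_univ, smul_eq_mul] at hdim
  have hT : 0 < Fintype.card T := Fintype.card_pos
  rcases h with h | ⟨hl, hr, hD⟩
  · have hsurj : LinearMap.range A = ⊤ := by
      apply Submodule.eq_top_of_finrank_eq
      refine le_antisymm (Submodule.finrank_le _) ?_
      rw [Module.finrank_pi_fintype]
      simp only [Finset.sum_const, Finset.card_univ, smul_eq_mul]
      have : (Fintype.card N + 1) * Module.finrank ℝ V ≤ Fintype.card T * Module.finrank ℝ V :=
        Nat.mul_le_mul_right _ h
      rw [add_mul, one_mul] at this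
      omega
    obtain ⟨s, hs⟩ := LinearMap.range_eq_top.1 hsurj D
    exact ⟨s, fun n => congrFun hs n⟩
  · have hcard : Fintype.card N = Fintype.card T := Fintype.card_of_bijective hl
    have hN : Nonempty N := Fintype.card_pos_iff.1 (hcard ▸ hT)
    let sm : (N → V) →ₗ[ℝ] V := ∑ n, LinearMap.proj n
    have hsm : ∀ D, sm D = ∑ n, D n := fun D => by simp [sm]
    have hsmr : LinearMap.range sm = ⊤ := by
      rw [LinearMap.range_eq_top]
      intro v
      refine ⟨Pi.single (Classical.arbitrary N) v, ?_⟩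
      rw [hsm]
      simp
    have hdim2 := LinearMap.finrank_range_add_finrank_ker sm
    rw [hsmr, finrank_top, Module.finrank_pi_fintype] at hdim2
    simp only [Finset.sum_const, Finset.card_univ, smul_eq_mul] at hdim2
    have hle : LinearMap.range A ≤ LinearMap.ker sm := by
      rintro _ ⟨s, rfl⟩
      rw [LinearMap.mem_ker, hsm]
      simp only [hA, Finset.sum_sub_distrib]
      rw [hl.sum_comp s, hr.sum_comp s, sub_self]
    have heq := Submodule.eq_of_le_of_finrank_eq hle (by rw [hcard] at hdim2; omega)
    have hDm : D ∈ LinearMap.range A := by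
      rw [heq, LinearMap.mem_ker, hsm, hD]
    obtain ⟨s, hs⟩ := hDm
    exact ⟨s, fun n => congrFun hs n⟩

end LinearAlgebra

/-! ### Recovering a function on triangles from its jumps -/

section Potential

variable {Δ : Geometry.SimplicialComplex ℝ Plane}

theorem finite_triangles (hΔ : IsTriangulatedDisk Δ) : (triangles Δ).Finite :=
  hΔ.finite_faces.subset fun _ h => h.1

theorem finite_nbrs (hΔ : IsTriangulatedDisk Δ) (v : Plane) : {w | IsInteriorEdge Δ v w}.Finite := by
  refine ((finite_triangles hΔ).biUnion fun σ _ => σ.finite_toSet).subset ?_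
  intro w hw
  have h := IsInteriorEdge.left_mem hw
  exact mem_biUnion h.1 h.2.2

/-- The ends of the interior edges at `v`. -/
def nbrs (hΔ : IsTriangulatedDisk Δ) (v : Plane) : Finset Plane := (finite_nbrs hΔ v).toFinset

theorem mem_nbrs {hΔ : IsTriangulatedDisk Δ} {v w : Plane} :
    w ∈ nbrs hΔ v ↔ IsInteriorEdge Δ v w := by
  simp [nbrs]

/-- The triangle to the left of an interior edge at `v`. -/
def leftAt (hΔ : IsTriangulatedDisk Δ) (v : Plane) (w : nbrs hΔ v) :
    {σ // σ ∈ triangles Δ ∧ v ∈ σ} :=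
  ⟨leftTri Δ v w, (mem_nbrs.1 w.2).left_mem.1, (mem_nbrs.1 w.2).left_mem.2.1⟩

/-- The triangle to the right of an interior edge at `v`. -/
def rightAt (hΔ : IsTriangulatedDisk Δ) (v : Plane) (w : nbrs hΔ v) :
    {σ // σ ∈ triangles Δ ∧ v ∈ σ} :=
  ⟨leftTri Δ w v, (mem_nbrs.1 w.2).symm.left_mem.1, (mem_nbrs.1 w.2).symm.left_mem.2.2⟩

theorem Tri.leftTri_eq' {v w x : Plane} (h : Tri Δ w v x) : leftTri Δ w v = {v, x, w} := by
  rw [h.leftTri_eq, Finset.insert_comm, Finset.pair_comm]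

theorem leftAt_injective (hΔ : IsTriangulatedDisk Δ) (v : Plane) :
    Function.Injective (leftAt hΔ v) := by
  intro w w' h
  obtain ⟨x, hx⟩ := (mem_nbrs.1 w.2).1
  obtain ⟨x', hx'⟩ := (mem_nbrs.1 w'.2).1
  have h' : leftTri Δ v w = leftTri Δ v w' := congrArg Subtype.val h
  rw [hx.leftTri_eq, hx'.leftTri_eq] at h'
  exact Subtype.ext (hx.eq_of_eq hx' h').1

theorem rightAt_injective (hΔ : IsTriangulatedDisk Δ) (v : Plane) :
    Function.Injective (rightAt hΔ v) := by
  intro w w' h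
  obtain ⟨x, hx⟩ := (mem_nbrs.1 w.2).2
  obtain ⟨x', hx'⟩ := (mem_nbrs.1 w'.2).2
  have h' : leftTri Δ w v = leftTri Δ w' v := congrArg Subtype.val h
  rw [hx.leftTri_eq', hx'.leftTri_eq'] at h'
  exact Subtype.ext (hx.rotate.eq_of_eq hx'.rotate h').2

/-- A triangle with counterclockwise vertices `v`, `w`, `x` lies to the left of `v w`, and this edge
is interior because `v` is. `rightAt_bijective` uses `v x` in the same way. -/
theorem leftAt_bijective (hΔ : IsTriangulatedDisk Δ) {v : Plane} (hv : {v} ∉ boundaryFaces Δ) :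
    Function.Bijective (leftAt hΔ v) := by
  refine ⟨leftAt_injective hΔ v, ?_⟩
  rintro ⟨σ, hσ, hvσ⟩
  obtain ⟨w, x, rfl, h⟩ := exists_tri hσ hvσ
  refine ⟨⟨w, mem_nbrs.2 (h.isInteriorEdge_of_notMem hΔ hv).1⟩, Subtype.ext ?_⟩
  exact h.leftTri_eq

theorem rightAt_bijective (hΔ : IsTriangulatedDisk Δ) {v : Plane} (hv : {v} ∉ boundaryFaces Δ) :
    Function.Bijective (rightAt hΔ v) := by
  refine ⟨rightAt_injective hΔ v, ?_⟩
  rintro ⟨σ, hσ, hvσ⟩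
  obtain ⟨w, x, rfl, h⟩ := exists_tri hσ hvσ
  refine ⟨⟨x, mem_nbrs.2 (h.isInteriorEdge_of_notMem hΔ hv).2⟩, Subtype.ext ?_⟩
  exact h.rotate.rotate.leftTri_eq'

/-- A boundary edge at `v` has a triangle on one side only, and the injection `leftAt` or `rightAt`
for that side misses this triangle. -/
theorem card_nbrs_lt (hΔ : IsTriangulatedDisk Δ) {v : Plane} (hv : {v} ∈ boundaryFaces Δ)
    [Fintype {σ // σ ∈ triangles Δ ∧ v ∈ σ}] :
    Fintype.card (nbrs hΔ v) < Fintype.card {σ // σ ∈ triangles Δ ∧ v ∈ σ} := by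
  obtain ⟨w, hw, ⟨x, hx⟩ | ⟨x, hx⟩⟩ := exists_boundary_edge hΔ hv
  · refine Fintype.card_lt_of_injective_of_notMem _ (leftAt_injective hΔ v)
      (b := ⟨{v, w, x}, hx.mem_triangles, by simp⟩) ?_
    rintro ⟨w', hw'⟩
    obtain ⟨x', hx'⟩ := (mem_nbrs.1 w'.2).1
    have h' : leftTri Δ v w' = {v, w, x} := congrArg Subtype.val hw'
    rw [hx'.leftTri_eq] at h'
    exact hw ((hx'.eq_of_eq hx h').1 ▸ mem_nbrs.1 w'.2)
  · refine Fintype.card_lt_of_injective_of_notMem _ (rightAt_injective hΔ v)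
      (b := ⟨{v, x, w}, hx.rotate.mem_triangles, by simp⟩) ?_
    rintro ⟨w', hw'⟩
    obtain ⟨x', hx'⟩ := (mem_nbrs.1 w'.2).2
    have h' : leftTri Δ w' v = {v, x, w} := congrArg Subtype.val hw'
    rw [hx'.leftTri_eq'] at h'
    exact hw ((hx'.rotate.eq_of_eq hx.rotate h').2 ▸ mem_nbrs.1 w'.2)

/-- A function on triangles which agrees across all interior edges at `v` is constant on the star
of `v`. -/
theorem eq_of_star {α : Type*} (hΔ : IsTriangulatedDisk Δ) {v : Plane} (s : Finset Plane → α)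
    (hs : ∀ w, IsInteriorEdge Δ v w → s (leftTri Δ v w) = s (leftTri Δ w v))
    {σ τ : Finset Plane} (hσ : σ ∈ triangles Δ) (hτ : τ ∈ triangles Δ) (hvσ : v ∈ σ)
    (hvτ : v ∈ τ) : s σ = s τ := by
  refine star_connected hΔ (fun ρ => s σ = s ρ) ?_ hσ hτ hvσ hvτ rfl
  intro ρ hρ ρ' hρ' w hvw hvρ hvρ' hwρ hwρ' h
  by_cases he : ρ = ρ'
  · rw [← he, h]
  · obtain ⟨hint, ⟨h1, h2⟩ | ⟨h1, h2⟩⟩ := isInteriorEdge_of_mem hρ hρ' he hvw hvρ hwρ hvρ' hwρ'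
    · rw [h, h1, h2, hs w hint]
    · rw [h, h1, h2, hs w hint]

theorem eq_of_triangles {α : Type*} (hΔ : IsTriangulatedDisk Δ) (s : Finset Plane → α)
    (hs : ∀ v w, IsInteriorEdge Δ v w → s (leftTri Δ v w) = s (leftTri Δ w v))
    {σ τ : Finset Plane} (hσ : σ ∈ triangles Δ) (hτ : τ ∈ triangles Δ) : s σ = s τ := by
  refine triangles_connected hΔ (fun ρ => s σ = s ρ) ?_ hσ hτ rfl
  intro ρ hρ ρ' hρ' v w hvw hvρ hvρ' hwρ hwρ' h
  exact h.trans (eq_of_star hΔ s (hs v) hρ hρ' hvρ hvρ')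

variable {V : Type*} [AddCommGroup V] [Module ℝ V] [FiniteDimensional ℝ V]

/-- The triangles at `v`, joined by the interior edges at `v`, form a connected graph: a path for a
boundary vertex, a cycle for an interior one. Only the cycle imposes a condition on the jumps. -/
theorem exists_local_potential (hΔ : IsTriangulatedDisk Δ) (D : Plane → Plane → V) (v : Plane)
    (hD : {v} ∉ boundaryFaces Δ → ∑ w ∈ nbrs hΔ v, D v w = 0) :
    ∃ s : Finset Plane → V, ∀ w, IsInteriorEdge Δ v w →
      s (leftTri Δ v w) - s (leftTri Δ w v) = D v w := by
  by_cases hT : Nonempty {σ // σ ∈ triangles Δ ∧ v ∈ σ}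
  · have : Finite {σ // σ ∈ triangles Δ ∧ v ∈ σ} :=
      ((finite_triangles hΔ).subset fun σ (h : σ ∈ triangles Δ ∧ v ∈ σ) => h.1).to_subtype
    have := Fintype.ofFinite {σ // σ ∈ triangles Δ ∧ v ∈ σ}
    obtain ⟨s, hs⟩ := exists_difference_solution (leftAt hΔ v) (rightAt hΔ v) (V := V) (by
      intro s hs t t'
      have := eq_of_star hΔ (fun σ => if h : σ ∈ triangles Δ ∧ v ∈ σ then s ⟨σ, h⟩ else 0) (by
        intro w hw
        have h1 := (leftAt hΔ v ⟨w, mem_nbrs.2 hw⟩).2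
        have h2 := (rightAt hΔ v ⟨w, mem_nbrs.2 hw⟩).2
        have h3 := hs ⟨w, mem_nbrs.2 hw⟩
        simp only [leftAt, rightAt] at h1 h2 h3
        simp only [dif_pos h1, dif_pos h2, h3]) t.2.1 t'.2.1 t.2.2 t'.2.2
      simpa only [dif_pos t.2, dif_pos t'.2] using this) (fun w => D v w) (by
      by_cases hv : {v} ∈ boundaryFaces Δ
      · exact Or.inl (card_nbrs_lt hΔ hv)
      · refine Or.inr ⟨leftAt_bijective hΔ hv, rightAt_bijective hΔ hv, ?_⟩
        rw [← hD hv]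
        exact Finset.sum_coe_sort (nbrs hΔ v) (fun w => D v w))
    refine ⟨fun σ => if h : σ ∈ triangles Δ ∧ v ∈ σ then s ⟨σ, h⟩ else 0, fun w hw => ?_⟩
    have h1 := (leftAt hΔ v ⟨w, mem_nbrs.2 hw⟩).2
    have h2 := (rightAt hΔ v ⟨w, mem_nbrs.2 hw⟩).2
    have h3 := hs ⟨w, mem_nbrs.2 hw⟩
    simp only [leftAt, rightAt] at h1 h2 h3
    simp only [dif_pos h1, dif_pos h2, h3]
  · refine ⟨0, fun w hw => absurd ⟨⟨leftTri Δ v w, hw.left_mem.1, hw.left_mem.2.1⟩⟩ hT⟩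

/-- Jumps across the interior edges which add up to zero around every interior vertex are the
jumps of a function on the triangles. -/
theorem exists_potential (hΔ : IsTriangulatedDisk Δ) (D : Plane → Plane → V)
    (hanti : ∀ v w, D w v = -D v w)
    (hD : ∀ v, {v} ∈ Δ.faces → {v} ∉ boundaryFaces Δ → ∑ w ∈ nbrs hΔ v, D v w = 0) :
    ∃ p : Finset Plane → V, ∀ v w, IsInteriorEdge Δ v w →
      p (leftTri Δ v w) - p (leftTri Δ w v) = D v w := by
  have hD' : ∀ v, {v} ∉ boundaryFaces Δ → ∑ w ∈ nbrs hΔ v, D v w = 0 := by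
    intro v hv
    by_cases hvf : {v} ∈ Δ.faces
    · exact hD v hvf hv
    · refine Finset.sum_eq_zero fun w hw => absurd ?_ hvf
      have h := (mem_nbrs.1 hw).left_mem
      exact Δ.down_closed h.1.1 (by simpa using h.2.1) (by simp)
  choose s hs using fun v => exists_local_potential hΔ D v (hD' v)
  -- The local potentials of `v` and of `w` have the same jump across the edge `v w`, so their
  -- difference takes one value on the triangles containing both. These values are a 1-cocycle.
  let c : Plane → Plane → V := fun v w =>
    if h : ∃ σ ∈ triangles Δ, v ∈ σ ∧ w ∈ σ then s v h.choose - s w h.choose else 0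
  have hc : ∀ σ ∈ triangles Δ, ∀ v ∈ σ, ∀ w ∈ σ, c v w = s v σ - s w σ := by
    intro σ hσ v hv w hw
    have h : ∃ σ ∈ triangles Δ, v ∈ σ ∧ w ∈ σ := ⟨σ, hσ, hv, hw⟩
    obtain ⟨hτ, hvτ, hwτ⟩ := h.choose_spec
    simp only [c, dif_pos h]
    by_cases hvw : v = w
    · subst hvw; simp
    by_cases he : σ = h.choose
    · rw [← he]
    · obtain ⟨hint, h1⟩ := isInteriorEdge_of_mem hσ hτ he hvw hv hw hvτ hwτ
      have h2 := hs v w hint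
      have h3 := hs w v hint.symm
      rw [hanti, ← h2] at h3
      rcases h1 with ⟨h4, h5⟩ | ⟨h4, h5⟩
      · rw [h5, h4, ← sub_eq_zero, ← sub_eq_zero.2 h3.symm]; abel
      · rw [h5, h4, ← sub_eq_zero, ← sub_eq_zero.2 h3]; abel
  obtain ⟨b, hb⟩ := exists_coboundary hΔ c (by
    intro σ hσ u hu v hv w hw
    rw [hc σ hσ u hu v hv, hc σ hσ v hv w hw, hc σ hσ u hu w hw]
    abel)
  -- Corrected by the coboundary `b`, the local potentials at the vertices of a triangle agree, so
  -- any vertex may be chosen.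
  let p : Finset Plane → V := fun σ =>
    if h : σ.Nonempty then s h.choose σ - b h.choose else 0
  have hp : ∀ σ ∈ triangles Δ, ∀ v ∈ σ, p σ = s v σ - b v := by
    intro σ hσ v hv
    have h : σ.Nonempty := ⟨v, hv⟩
    simp only [p, dif_pos h]
    have h1 := hb σ hσ _ h.choose_spec v hv
    rw [hc σ hσ _ h.choose_spec v hv] at h1
    rw [sub_eq_sub_iff_sub_eq_sub]
    exact h1
  refine ⟨p, fun v w h => ?_⟩
  rw [hp _ h.left_mem.1 v h.left_mem.2.1, hp _ h.symm.left_mem.1 v h.symm.left_mem.2.2,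
    ← hs v w h]
  abel

/-- Each triangle at an interior vertex is on the left of exactly one edge and on the right of
exactly one, so the sum telescopes. -/
theorem sum_nbrs_eq_zero {W : Type*} [AddCommGroup W] (hΔ : IsTriangulatedDisk Δ)
    (p : Finset Plane → W) {v : Plane}
    (hv : {v} ∉ boundaryFaces Δ) :
    ∑ w ∈ nbrs hΔ v, (p (leftTri Δ v w) - p (leftTri Δ w v)) = 0 := by
  have : Finite {σ // σ ∈ triangles Δ ∧ v ∈ σ} :=
    ((finite_triangles hΔ).subset fun σ (h : σ ∈ triangles Δ ∧ v ∈ σ) => h.1).to_subtype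
  have := Fintype.ofFinite {σ // σ ∈ triangles Δ ∧ v ∈ σ}
  have h1 := (leftAt_bijective hΔ hv).sum_comp fun σ => p σ.1
  have h2 := (rightAt_bijective hΔ hv).sum_comp fun σ => p σ.1
  rw [Finset.sum_sub_distrib, sub_eq_zero,
    ← Finset.sum_coe_sort (nbrs hΔ v) (fun w => p (leftTri Δ v w)),
    ← Finset.sum_coe_sort (nbrs hΔ v) (fun w => p (leftTri Δ w v))]
  exact h1.trans h2.symm

end Potential

/-! ### Dimension count by jumps and outflows -/

section Dimension

variable {Δ : Geometry.SimplicialComplex ℝ Plane}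
variable {V : Type*} [AddCommGroup V] [Module ℝ V]

/-- Functions on triangles whose jump across each interior edge lies in a given subspace. -/
def jumpSpace (Δ : Geometry.SimplicialComplex ℝ Plane) (M : Plane → Plane → Submodule ℝ V) :
    Submodule ℝ (triangles Δ → V) where
  carrier := {p | ∀ v w (h : IsInteriorEdge Δ v w),
    p ⟨leftTri Δ v w, h.left_mem.1⟩ - p ⟨leftTri Δ w v, h.symm.left_mem.1⟩ ∈ M v w}
  zero_mem' := fun v w h => by simp
  add_mem' := fun {p q} hp hq v w h => by
    simpa only [Pi.add_apply, add_sub_add_comm] using (M v w).add_mem (hp v w h) (hq v w h)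
  smul_mem' := fun c p hp v w h => by
    simpa only [Pi.smul_apply, ← smul_sub] using (M v w).smul_mem c (hp v w h)

/-- Antisymmetric functions on the oriented interior edges with values in given subspaces. -/
def flowSpace (Δ : Geometry.SimplicialComplex ℝ Plane) (M : Plane → Plane → Submodule ℝ V) :
    Submodule ℝ (Plane → Plane → V) where
  carrier := {D | (∀ v w, D v w ∈ M v w) ∧ (∀ v w, D w v = -D v w) ∧
    ∀ v w, ¬ IsInteriorEdge Δ v w → D v w = 0}
  zero_mem' := ⟨fun v w => by simp, fun v w => by simp, fun v w _ => rfl⟩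
  add_mem' := fun {D E} hD hE => ⟨fun v w => (M v w).add_mem (hD.1 v w) (hE.1 v w),
    fun v w => by simp only [Pi.add_apply, hD.2.1 v w, hE.2.1 v w]; abel,
    fun v w h => by simp only [Pi.add_apply, hD.2.2 v w h, hE.2.2 v w h, add_zero]⟩
  smul_mem' := fun c D hD => ⟨fun v w => (M v w).smul_mem c (hD.1 v w),
    fun v w => by simp only [Pi.smul_apply, hD.2.1 v w, smul_neg],
    fun v w h => by simp only [Pi.smul_apply, hD.2.2 v w h, smul_zero]⟩

theorem finite_interiorEdges (hΔ : IsTriangulatedDisk Δ) : (interiorEdges Δ).Finite :=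
  hΔ.finite_faces.subset fun _ h => h.1.1

theorem exists_ends (hΔ : IsTriangulatedDisk Δ) (e : interiorEdges Δ) :
    ∃ v w, IsInteriorEdge Δ v w ∧ e.1 = {v, w} := by
  obtain ⟨v, w, hvw, he⟩ := Finset.card_eq_two.1 e.2.1.2
  exact ⟨v, w, (mem_interiorEdges_iff hΔ hvw).1 (he ▸ e.2), he⟩

theorem pair_eq_pair {a b c d : Plane} (h : ({a, b} : Finset Plane) = {c, d}) :
    (a = c ∧ b = d) ∨ (a = d ∧ b = c) := by
  have h' := congrArg (fun s : Finset Plane => (s : Set Plane)) h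
  simp only [Finset.coe_pair] at h'
  exact Set.pair_eq_pair_iff.1 h'

/-- The dimension of the space of flows. -/
theorem finrank_flowSpace [FiniteDimensional ℝ V] (hΔ : IsTriangulatedDisk Δ)
    (M : Plane → Plane → Submodule ℝ V) (hM : ∀ v w, M w v = M v w) {d : ℕ}
    (hd : ∀ v w, IsInteriorEdge Δ v w → Module.finrank ℝ (M v w) = d) :
    Module.Finite ℝ (flowSpace Δ M) ∧
      Module.finrank ℝ (flowSpace Δ M) = (interiorEdges Δ).ncard * d := by
  have := (finite_interiorEdges hΔ).to_subtype
  have := Fintype.ofFinite (interiorEdges Δ)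
  choose a b hab he using exists_ends hΔ
  -- With an orientation chosen for every interior edge, an antisymmetric function is determined by
  -- its arbitrary values on the chosen orientations.
  let f : flowSpace Δ M →ₗ[ℝ] ((e : interiorEdges Δ) → M (a e) (b e)) :=
    { toFun := fun D e => ⟨D.1 (a e) (b e), D.2.1 _ _⟩
      map_add' := fun _ _ => rfl
      map_smul' := fun _ _ => rfl }
  have hinj : Function.Injective f := by
    rw [injective_iff_map_eq_zero]
    intro D hD
    have hD' : ∀ e, D.1 (a e) (b e) = 0 := fun e => congrArg Subtype.val (congrFun hD e)
    refine Subtype.ext (funext fun v => funext fun w => ?_)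
    by_cases h : IsInteriorEdge Δ v w
    · have h1 := he ⟨_, (mem_interiorEdges_iff hΔ h.ne).2 h⟩
      rcases pair_eq_pair h1 with ⟨h2, h3⟩ | ⟨h2, h3⟩
      · have := hD' ⟨_, (mem_interiorEdges_iff hΔ h.ne).2 h⟩
        rwa [← h2, ← h3] at this
      · have := hD' ⟨_, (mem_interiorEdges_iff hΔ h.ne).2 h⟩
        rw [← h2, ← h3, D.2.2.1 v w] at this
        exact neg_eq_zero.1 this
    · exact D.2.2.2 v w h
  have hsurj : Function.Surjective f := by
    intro q
    let D : Plane → Plane → V := fun v w =>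
      if h : ({v, w} : Finset Plane) ∈ interiorEdges Δ then
        if v = a ⟨_, h⟩ then (q ⟨_, h⟩ : V) else -(q ⟨_, h⟩ : V)
      else 0
    have hDab : ∀ e, D (a e) (b e) = q e := by
      intro e
      obtain ⟨e, hemem⟩ := e
      have h1 : e = {a ⟨e, hemem⟩, b ⟨e, hemem⟩} := he ⟨e, hemem⟩
      have h : ({a ⟨e, hemem⟩, b ⟨e, hemem⟩} : Finset Plane) ∈ interiorEdges Δ := h1 ▸ hemem
      have h2 : (⟨_, h⟩ : interiorEdges Δ) = ⟨e, hemem⟩ := Subtype.ext h1.symm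
      simp only [D, dif_pos h]
      rw [h2, if_pos rfl]
    have hDba : ∀ e, D (b e) (a e) = -(q e : V) := by
      intro e
      obtain ⟨e, hemem⟩ := e
      have h1 : e = {b ⟨e, hemem⟩, a ⟨e, hemem⟩} := (he ⟨e, hemem⟩).trans (Finset.pair_comm _ _)
      have h : ({b ⟨e, hemem⟩, a ⟨e, hemem⟩} : Finset Plane) ∈ interiorEdges Δ := h1 ▸ hemem
      have h2 : (⟨_, h⟩ : interiorEdges Δ) = ⟨e, hemem⟩ := Subtype.ext h1.symm
      simp only [D, dif_pos h]
      rw [h2, if_neg (hab ⟨e, hemem⟩).ne.symm]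
    have hnot : ∀ v w, ¬ IsInteriorEdge Δ v w → D v w = 0 := by
      intro v w h
      have hn : ({v, w} : Finset Plane) ∉ interiorEdges Δ := by
        intro hmem
        by_cases hvw : v = w
        · subst hvw
          have := hmem.1.2
          simp at this
        · exact h ((mem_interiorEdges_iff hΔ hvw).1 hmem)
      simp only [D, dif_neg hn]
    have hcases : ∀ v w, IsInteriorEdge Δ v w → ∃ e, (v = a e ∧ w = b e) ∨ (v = b e ∧ w = a e) :=
      fun v w h => ⟨⟨_, (mem_interiorEdges_iff hΔ h.ne).2 h⟩,
        pair_eq_pair (he ⟨_, (mem_interiorEdges_iff hΔ h.ne).2 h⟩)⟩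
    refine ⟨⟨D, ?_, ?_, hnot⟩, ?_⟩
    · intro v w
      by_cases h : IsInteriorEdge Δ v w
      · obtain ⟨e, ⟨rfl, rfl⟩ | ⟨rfl, rfl⟩⟩ := hcases v w h
        · rw [hDab]; exact (q e).2
        · rw [hDba, hM]; exact neg_mem (q e).2
      · rw [hnot v w h]; exact zero_mem _
    · intro v w
      by_cases h : IsInteriorEdge Δ v w
      · obtain ⟨e, ⟨rfl, rfl⟩ | ⟨rfl, rfl⟩⟩ := hcases v w h
        · rw [hDab, hDba]
        · rw [hDab, hDba, neg_neg]
      · rw [hnot v w h, hnot w v fun h' => h h'.symm, neg_zero]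
    · funext e
      exact Subtype.ext (hDab e)
  let F := LinearEquiv.ofBijective f ⟨hinj, hsurj⟩
  refine ⟨Module.Finite.equiv F.symm, ?_⟩
  rw [F.finrank_eq, Module.finrank_pi_fintype, Finset.sum_congr rfl fun e _ => hd _ _ (hab e)]
  rw [Finset.sum_const, smul_eq_mul, Finset.card_univ, ← Nat.card_eq_fintype_card,
    Nat.card_coe_set_eq]

variable {n : ℕ}

/-- The total outflow at a vertex. -/
def outflow (hΔ : IsTriangulatedDisk Δ) (M : Plane → Plane → Submodule ℝ V)
    (γ : Fin n → Plane) : flowSpace Δ M →ₗ[ℝ] (Fin n → V) where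
  toFun D i := ∑ w ∈ nbrs hΔ (γ i), D.1 (γ i) w
  map_add' D E := funext fun i => Finset.sum_add_distrib
  map_smul' c D := funext fun i => by
    simp only [RingHom.id_apply, Pi.smul_apply, Finset.smul_sum]
    rfl

/-- The space spanned by the subspaces belonging to the interior edges from `v` to `S`. -/
def vertexSpace (Δ : Geometry.SimplicialComplex ℝ Plane) (M : Plane → Plane → Submodule ℝ V)
    (v : Plane) (S : Set Plane) : Submodule ℝ V :=
  ⨆ w ∈ {w | IsInteriorEdge Δ v w ∧ w ∈ S}, M v w

theorem range_outflow_le (hΔ : IsTriangulatedDisk Δ) (M : Plane → Plane → Submodule ℝ V)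
    (γ : Fin n → Plane) (D : flowSpace Δ M) (i : Fin n) :
    outflow hΔ M γ D i ∈ vertexSpace Δ M (γ i) univ := by
  refine Submodule.sum_mem _ fun w hw => ?_
  exact Submodule.mem_iSup_of_mem w (Submodule.mem_iSup_of_mem ⟨mem_nbrs.1 hw, mem_univ w⟩
    (D.2.1 _ _))

/-- A flow along the interior edges from `v` to `S` with prescribed outflow at `v`. -/
theorem exists_flow_at (hΔ : IsTriangulatedDisk Δ) (M : Plane → Plane → Submodule ℝ V)
    (hM : ∀ v w, M w v = M v w) (v : Plane) (S : Set Plane) (x : V)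
    (hx : x ∈ vertexSpace Δ M v S) :
    ∃ D : flowSpace Δ M, ∑ w ∈ nbrs hΔ v, D.1 v w = x ∧
      ∀ u w, u ≠ v → u ∉ S → D.1 u w = 0 := by
  -- By linearity it suffices to produce the generators: `y ∈ M v w` is the outflow at `v` of the
  -- flow `y` along the single edge `v w`, which leaves every vertex except `v` and `w ∈ S`
  -- untouched.
  have hind : vertexSpace Δ M v S ≤
      Submodule.map (∑ w ∈ nbrs hΔ v, (LinearMap.proj (R := ℝ) (φ := fun _ : Plane => V) w).comp
        (LinearMap.proj (φ := fun _ : Plane => Plane → V) v))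
      { carrier := {D | D ∈ flowSpace Δ M ∧ ∀ u w, u ≠ v → u ∉ S → D u w = 0}
        zero_mem' := ⟨zero_mem _, fun u w _ _ => rfl⟩
        add_mem' := fun {D E} hD hE => ⟨add_mem hD.1 hE.1, fun u w h1 h2 => by
          simp only [Pi.add_apply, hD.2 u w h1 h2, hE.2 u w h1 h2, add_zero]⟩
        smul_mem' := fun c D hD => ⟨Submodule.smul_mem _ c hD.1, fun u w h1 h2 => by
          simp only [Pi.smul_apply, hD.2 u w h1 h2, smul_zero]⟩ } := by
    refine iSup₂_le fun w hw y hy => ?_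
    have hvw := hw.1.ne
    let D : Plane → Plane → V := fun a b =>
      if a = v ∧ b = w then y else if a = w ∧ b = v then -y else 0
    have h1 : D v w = y := by simp [D]
    have h2 : ∀ b, b ≠ w → D v b = 0 := by
      intro b hb
      simp [D, hb, hvw]
    refine ⟨D, ⟨⟨?_, ?_, ?_⟩, ?_⟩, ?_⟩
    · intro a b
      simp only [D]
      split_ifs with h h'
      · rw [h.1, h.2]; exact hy
      · rw [h'.1, h'.2, hM]; exact neg_mem hy
      · exact zero_mem _
    · intro a b
      simp only [D]
      by_cases h : a = v ∧ b = w
      · rw [if_pos h, if_neg (fun h' => hvw (h'.1.symm.trans h.2) : ¬(b = v ∧ a = w)),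
          if_pos ⟨h.2, h.1⟩]
      · by_cases h' : a = w ∧ b = v
        · rw [if_pos ⟨h'.2, h'.1⟩, if_neg h, if_pos h', neg_neg]
        · rw [if_neg fun h'' => h' ⟨h''.2, h''.1⟩, if_neg fun h'' => h ⟨h''.2, h''.1⟩, if_neg h,
            if_neg h', neg_zero]
    · intro a b hab
      simp only [D]
      rw [if_neg, if_neg]
      · rintro ⟨rfl, rfl⟩; exact hab hw.1.symm
      · rintro ⟨rfl, rfl⟩; exact hab hw.1
    · intro a b ha haS
      simp only [D]
      rw [if_neg fun h => ha h.1, if_neg]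
      rintro ⟨rfl, -⟩; exact haS hw.2
    · simp only [LinearMap.coe_sum, Finset.sum_apply, LinearMap.comp_apply, LinearMap.proj_apply]
      rw [Finset.sum_eq_single w (fun b _ hb => h2 b hb)
        (fun hn => absurd (mem_nbrs.2 hw.1) hn), h1]
  obtain ⟨D, hD, hDx⟩ := hind hx
  refine ⟨⟨D, hD.1⟩, ?_, hD.2⟩
  rw [← hDx]
  simp only [LinearMap.coe_sum, Finset.sum_apply, LinearMap.comp_apply, LinearMap.proj_apply]

/-- If each vertex space is spanned using only edges to earlier vertices and to vertices that are
not numbered, then all outflows are possible. -/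
theorem range_outflow (hΔ : IsTriangulatedDisk Δ) (M : Plane → Plane → Submodule ℝ V)
    (hM : ∀ v w, M w v = M v w) (γ : Fin n → Plane) (hγ : Function.Injective γ)
    (S : Fin n → Set Plane) (hS : ∀ i j, i ≤ j → γ j ∉ S i)
    (hJ : ∀ i, vertexSpace Δ M (γ i) (S i) = vertexSpace Δ M (γ i) univ) :
    LinearMap.range (outflow hΔ M γ) =
      Submodule.pi univ fun i => vertexSpace Δ M (γ i) univ := by
  refine le_antisymm ?_ ?_
  · rintro _ ⟨D, rfl⟩ i -
    exact range_outflow_le hΔ M γ D i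
  -- Triangular elimination, from the last vertex down: the outflow at vertex `m` is realized along
  -- edges to `S m`, which contains no later vertex, so the zeros already reached persist. Outflows
  -- at earlier vertices change, but stay in their vertex spaces.
  · have key : ∀ m ≤ n, ∀ x : Fin n → V, (∀ i, x i ∈ vertexSpace Δ M (γ i) univ) →
        (∀ i : Fin n, m ≤ i → x i = 0) → x ∈ LinearMap.range (outflow hΔ M γ) := by
      intro m
      induction m with
      | zero =>
        intro _ x _ hx
        rw [show x = 0 from funext fun i => hx i (Nat.zero_le _)]
        exact zero_mem _
      | succ m ih =>
        intro hm x hxJ hx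
        let i₀ : Fin n := ⟨m, hm⟩
        obtain ⟨D, hD, hD0⟩ := exists_flow_at hΔ M hM (γ i₀) (S i₀) (x i₀)
          (by rw [hJ]; exact hxJ i₀)
        have h1 : x - outflow hΔ M γ D ∈ LinearMap.range (outflow hΔ M γ) := by
          refine ih (by omega) _ (fun i => sub_mem (hxJ i) (range_outflow_le hΔ M γ D i)) ?_
          intro i hi
          rcases eq_or_lt_of_le hi with h | h
          · have : i = i₀ := Fin.ext h.symm
            subst this
            exact sub_eq_zero.2 hD.symm
          · have hout : outflow hΔ M γ D i = 0 := Finset.sum_eq_zero fun w _ =>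
              hD0 _ _ (fun he => by
                have := congrArg Fin.val (hγ he)
                simp only [i₀] at this
                omega) (hS _ _ (by rw [Fin.le_def]; exact hi))
            rw [Pi.sub_apply, hout, hx i (by omega), sub_zero]
        have h2 := add_mem h1 (LinearMap.mem_range_self (outflow hΔ M γ) D)
        rwa [sub_add_cancel] at h2
    intro x hx
    exact key n le_rfl x (fun i => hx i (mem_univ i)) (fun i hi => absurd i.2 (by omega))

theorem finrank_pi_submodule {ι : Type*} [Fintype ι] {E : ι → Type*} [∀ i, AddCommGroup (E i)]
    [∀ i, Module ℝ (E i)] [∀ i, FiniteDimensional ℝ (E i)] (J : ∀ i, Submodule ℝ (E i)) :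
    Module.finrank ℝ (Submodule.pi univ J) = ∑ i, Module.finrank ℝ (J i) := by
  rw [← Module.finrank_pi_fintype]
  exact LinearEquiv.finrank_eq
    { toFun := fun x i => ⟨x.1 i, x.2 i (mem_univ i)⟩
      map_add' := fun _ _ => rfl
      map_smul' := fun _ _ => rfl
      invFun := fun x => ⟨fun i => x i, fun i _ => (x i).2⟩
      left_inv := fun _ => rfl
      right_inv := fun _ => rfl }

/-- The jumps of a function on the triangles. -/
def jumps (Δ : Geometry.SimplicialComplex ℝ Plane) (M : Plane → Plane → Submodule ℝ V) :
    jumpSpace Δ M →ₗ[ℝ] flowSpace Δ M where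
  toFun p := ⟨fun v w => if h : IsInteriorEdge Δ v w then
      p.1 ⟨leftTri Δ v w, h.left_mem.1⟩ - p.1 ⟨leftTri Δ w v, h.symm.left_mem.1⟩ else 0, by
    refine ⟨fun v w => ?_, fun v w => ?_, fun v w h => ?_⟩
    · dsimp only
      split_ifs with h
      · exact p.2 v w h
      · exact zero_mem _
    · dsimp only
      by_cases h : IsInteriorEdge Δ v w
      · rw [dif_pos h, dif_pos h.symm, neg_sub]
      · rw [dif_neg h, dif_neg fun h' => h h'.symm, neg_zero]
    · exact dif_neg h⟩
  map_add' p q := by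
    refine Subtype.ext (funext fun v => funext fun w => ?_)
    simp only [Submodule.coe_add, Pi.add_apply]
    split_ifs with h
    · abel
    · simp
  map_smul' c p := by
    refine Subtype.ext (funext fun v => funext fun w => ?_)
    simp only [Submodule.coe_smul, Pi.smul_apply, RingHom.id_apply]
    split_ifs with h
    · rw [smul_sub]
    · simp

theorem exists_triangle (hΔ : IsTriangulatedDisk Δ) : Nonempty (triangles Δ) := by
  obtain ⟨e⟩ := hΔ.homeomorphic_disk
  obtain ⟨σ, hσ, -⟩ := exists_triangle_mem hΔ (e.symm ⟨0, by simp⟩).2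
  exact ⟨⟨σ, hσ⟩⟩

/-- A family without jumps is constant, since interior edges connect all triangles. -/
theorem finrank_ker_jumps (hΔ : IsTriangulatedDisk Δ) (M : Plane → Plane → Submodule ℝ V) :
    Module.finrank ℝ (LinearMap.ker (jumps Δ M)) = Module.finrank ℝ V := by
  obtain ⟨σ₀⟩ := exists_triangle hΔ
  have hconst : ∀ p ∈ LinearMap.ker (jumps Δ M), ∀ σ τ, p.1 σ = p.1 τ := by
    intro p hp σ τ
    have h1 : ∀ v w (h : IsInteriorEdge Δ v w),
        p.1 ⟨leftTri Δ v w, h.left_mem.1⟩ = p.1 ⟨leftTri Δ w v, h.symm.left_mem.1⟩ := by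
      intro v w h
      have := congrFun (congrFun (congrArg Subtype.val (LinearMap.mem_ker.1 hp)) v) w
      simp only [jumps, LinearMap.coe_mk, AddHom.coe_mk, dif_pos h] at this
      exact sub_eq_zero.1 this
    have := eq_of_triangles hΔ (fun σ => if h : σ ∈ triangles Δ then p.1 ⟨σ, h⟩ else 0)
      (fun v w h => by
        simp only [dif_pos h.left_mem.1, dif_pos h.symm.left_mem.1]
        exact h1 v w h) σ.2 τ.2
    simpa only [dif_pos σ.2, dif_pos τ.2] using this
  let f : V →ₗ[ℝ] LinearMap.ker (jumps Δ M) :=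
    { toFun := fun x => ⟨⟨fun _ => x, fun v w h => by simp⟩, by
        rw [LinearMap.mem_ker]
        refine Subtype.ext (funext fun v => funext fun w => ?_)
        simp [jumps]⟩
      map_add' := fun _ _ => rfl
      map_smul' := fun _ _ => rfl }
  refine (LinearEquiv.ofBijective f ⟨fun x y hxy => ?_, fun p => ?_⟩).finrank_eq.symm
  · exact congrArg (fun p : LinearMap.ker (jumps Δ M) => p.1.1 σ₀) hxy
  · exact ⟨p.1.1 σ₀, Subtype.ext (Subtype.ext (funext fun σ => hconst p.1 p.2 _ _))⟩

/-- Jumps telescope around an interior vertex; conversely, `exists_potential` integrates a flow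
without outflow at the interior vertices. -/
theorem range_jumps [FiniteDimensional ℝ V] (hΔ : IsTriangulatedDisk Δ)
    (M : Plane → Plane → Submodule ℝ V)
    (γ : Fin n ≃ interiorVertices Δ) :
    LinearMap.range (jumps Δ M) = LinearMap.ker (outflow hΔ M fun i => (γ i : Plane)) := by
  ext D
  constructor
  · rintro ⟨p, rfl⟩
    rw [LinearMap.mem_ker]
    funext i
    rw [Pi.zero_apply, ← sum_nbrs_eq_zero hΔ
      (fun σ => if h : σ ∈ triangles Δ then p.1 ⟨σ, h⟩ else 0) (γ i).2.2]
    refine Finset.sum_congr rfl fun w hw => ?_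
    have h := mem_nbrs.1 hw
    simp only [jumps, LinearMap.coe_mk, AddHom.coe_mk, dif_pos h, dif_pos h.left_mem.1,
      dif_pos h.symm.left_mem.1]
  · intro hD
    obtain ⟨p, hp⟩ := exists_potential hΔ D.1 D.2.2.1 (by
      intro v hv hvb
      have := congrFun (LinearMap.mem_ker.1 hD) (γ.symm ⟨v, hv, hvb⟩)
      simpa [outflow] using this)
    refine ⟨⟨fun σ => p σ, fun v w h => ?_⟩, ?_⟩
    · simp only [hp v w h]
      exact D.2.1 v w
    · refine Subtype.ext (funext fun v => funext fun w => ?_)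
      simp only [jumps, LinearMap.coe_mk, AddHom.coe_mk]
      by_cases h : IsInteriorEdge Δ v w
      · rw [dif_pos h, hp v w h]
      · rw [dif_neg h, D.2.2.2 v w h]

/-- The dimension of the space of functions on triangles with jumps in given subspaces. -/
theorem finrank_jumpSpace [FiniteDimensional ℝ V] (hΔ : IsTriangulatedDisk Δ)
    (M : Plane → Plane → Submodule ℝ V)
    (hM : ∀ v w, M w v = M v w) (γ : Fin n ≃ interiorVertices Δ) {d : ℕ}
    (hd : ∀ v w, IsInteriorEdge Δ v w → Module.finrank ℝ (M v w) = d)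
    (S : Fin n → Set Plane) (hS : ∀ i j, i ≤ j → (γ j : Plane) ∉ S i)
    (hJ : ∀ i, vertexSpace Δ M (γ i) (S i) = vertexSpace Δ M (γ i) univ) :
    (Module.finrank ℝ (jumpSpace Δ M) : ℤ) = Module.finrank ℝ V + (interiorEdges Δ).ncard * d -
      ∑ i, (Module.finrank ℝ (vertexSpace Δ M (γ i) univ) : ℤ) := by
  have := (finite_triangles hΔ).to_subtype
  obtain ⟨hfin, hflow⟩ := finrank_flowSpace hΔ M hM hd
  have h1 := LinearMap.finrank_range_add_finrank_ker (jumps Δ M)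
  have h2 := LinearMap.finrank_range_add_finrank_ker (outflow hΔ M fun i => (γ i : Plane))
  rw [range_jumps hΔ M γ, finrank_ker_jumps hΔ] at h1
  rw [range_outflow hΔ M hM (fun i => (γ i : Plane))
      (Subtype.val_injective.comp γ.injective) S hS hJ,
    finrank_pi_submodule, hflow] at h2
  push_cast [← h1]
  zify at h2
  linarith

end Dimension

/-! ### Univariate apolarity: spans of multiples of powers of linear factors -/

section Univariate

open Polynomial

theorem finrank_degreeLT (n : ℕ) : Module.finrank ℝ (degreeLT ℝ n) = n := by
  rw [(degreeLTEquiv ℝ n).finrank_eq, Module.finrank_fin_fun]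

instance finite_degreeLT (n : ℕ) : Module.Finite ℝ (degreeLT ℝ n) :=
  Module.Finite.equiv (degreeLTEquiv ℝ n).symm

/-- The multiples of a polynomial among the polynomials of degree less than `n`. -/
def multiples (n : ℕ) (Q : ℝ[X]) : Submodule ℝ (degreeLT ℝ n) where
  carrier := {f | Q ∣ (f : ℝ[X])}
  zero_mem' := dvd_zero _
  add_mem' := fun {_ _} hf hg => dvd_add hf hg
  smul_mem' := fun c f (hf : Q ∣ (f : ℝ[X])) => by
    change Q ∣ c • (f : ℝ[X])
    exact hf.trans (dvd_smul_of_dvd c dvd_rfl)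

theorem mem_multiples {n : ℕ} {Q : ℝ[X]} {f : degreeLT ℝ n} :
    f ∈ multiples n Q ↔ Q ∣ (f : ℝ[X]) := Iff.rfl

theorem finrank_multiples (n : ℕ) {Q : ℝ[X]} (hQ : Q.Monic) :
    Module.finrank ℝ (multiples n Q) = n - Q.natDegree := by
  rw [← finrank_degreeLT (n - Q.natDegree)]
  have hmem : ∀ g ∈ degreeLT ℝ (n - Q.natDegree), Q * g ∈ degreeLT ℝ n := by
    intro g hg
    by_cases hg0 : g = 0
    · rw [hg0, mul_zero]; exact zero_mem _
    · rw [mem_degreeLT, degree_mul, degree_eq_natDegree hQ.ne_zero, degree_eq_natDegree hg0]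
      rw [mem_degreeLT, degree_eq_natDegree hg0] at hg
      norm_cast at hg ⊢
      omega
  let f : degreeLT ℝ (n - Q.natDegree) →ₗ[ℝ] multiples n Q :=
    { toFun := fun g => ⟨⟨Q * g, hmem g g.2⟩, dvd_mul_right _ _⟩
      map_add' := fun _ _ => Subtype.ext (Subtype.ext (mul_add _ _ _))
      map_smul' := fun c g => Subtype.ext (Subtype.ext (mul_smul_comm c Q (g : ℝ[X]))) }
  refine (LinearEquiv.ofBijective f ⟨fun g h hgh => ?_, ?_⟩).finrank_eq.symm
  · have h1 : Q * (g : ℝ[X]) = Q * h :=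
      congrArg (fun x : multiples n Q => ((x : degreeLT ℝ n) : ℝ[X])) hgh
    exact Subtype.ext (mul_left_cancel₀ hQ.ne_zero h1)
  · rintro ⟨⟨p, hp⟩, hd⟩
    obtain ⟨g, rfl⟩ : ∃ g, p = Q * g := hd
    refine ⟨⟨g, ?_⟩, rfl⟩
    by_cases hg0 : g = 0
    · rw [hg0]; exact zero_mem _
    · rw [mem_degreeLT, degree_mul, degree_eq_natDegree hQ.ne_zero,
        degree_eq_natDegree hg0] at hp
      rw [mem_degreeLT, degree_eq_natDegree hg0]
      norm_cast at hp ⊢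
      omega

/-- The monomial `X ^ s` as an element of the space of polynomials of degree less than `n`. -/
def monomialLT {n : ℕ} (s : Fin n) : degreeLT ℝ n :=
  ⟨X ^ (s : ℕ), by
    rw [mem_degreeLT, degree_X_pow]
    exact_mod_cast s.2⟩

theorem eq_sum_monomialLT {n : ℕ} (f : degreeLT ℝ n) :
    f = ∑ s : Fin n, (f : ℝ[X]).coeff s • monomialLT s := by
  apply Subtype.ext
  ext i
  simp only [Submodule.coe_sum, Submodule.coe_smul, monomialLT, finsetSum_coeff, coeff_smul,
    coeff_X_pow, smul_eq_mul, mul_ite, mul_one, mul_zero]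
  by_cases hi : i < n
  · rw [Finset.sum_eq_single ⟨i, hi⟩] <;> simp
    intro b hb h
    exact absurd (Fin.ext h.symm) hb
  · rw [Finset.sum_eq_zero]
    · exact (mem_degreeLT.1 f.2).le |> fun h => coeff_eq_zero_of_degree_lt
        ((mem_degreeLT.1 f.2).trans_le (by exact_mod_cast not_lt.1 hi))
    · intro b _
      rw [if_neg]
      have := b.2
      omega

/-- The polynomial `a ↦ φ ((X - a) ^ d)` belonging to a linear form `φ`. -/
def dualPoly (d : ℕ) : Module.Dual ℝ (degreeLT ℝ (d + 1)) →ₗ[ℝ] degreeLT ℝ (d + 1) where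
  toFun φ := ∑ s : Fin (d + 1),
    ((d.choose s : ℝ) * (-1) ^ (d - s : ℕ) * φ (monomialLT s)) • monomialLT s.rev
  map_add' φ ψ := by
    rw [← Finset.sum_add_distrib]
    refine Finset.sum_congr rfl fun s _ => ?_
    rw [LinearMap.add_apply, mul_add, add_smul]
  map_smul' c φ := by
    rw [RingHom.id_apply, Finset.smul_sum]
    refine Finset.sum_congr rfl fun s _ => ?_
    rw [LinearMap.smul_apply, smul_smul, smul_eq_mul]
    congr 1
    ring

theorem choose_mul_choose_comm {d s j : ℕ} :
    d.choose s * (d - s).choose j = d.choose j * (d - j).choose s := by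
  have h1 := Nat.choose_mul (n := d) (k := s + j) (s := s) (by omega)
  have h2 := Nat.choose_mul (n := d) (k := s + j) (s := j) (by omega)
  rw [show s + j - s = j by omega] at h1
  rw [show s + j - j = s by omega] at h2
  rw [← h1, ← h2, Nat.choose_symm_add]

theorem X_sub_C_pow_mem_degreeLT (a : ℝ) {i n : ℕ} (hi : i < n) :
    (X - C a) ^ i ∈ degreeLT ℝ n := by
  rw [mem_degreeLT, degree_pow, degree_X_sub_C, nsmul_one]
  exact_mod_cast hi

/-- Differentiating `a ↦ φ ((X - a) ^ d)` under the form `φ`, `j` times and divided by `j!`. The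
proof compares the contributions of each `φ (X ^ s)`. -/
theorem taylor_dualPoly_coeff (d : ℕ) (φ : Module.Dual ℝ (degreeLT ℝ (d + 1))) (a : ℝ) (j : ℕ) :
    (taylor a (dualPoly d φ : ℝ[X])).coeff j = (d.choose j : ℝ) * (-1) ^ j *
      φ ⟨(X - C a) ^ (d - j), X_sub_C_pow_mem_degreeLT a (by omega)⟩ := by
  rw [eq_sum_monomialLT ⟨(X - C a) ^ (d - j), X_sub_C_pow_mem_degreeLT a (by omega)⟩, map_sum,
    Finset.mul_sum]
  simp only [dualPoly, LinearMap.coe_mk, AddHom.coe_mk, Submodule.coe_sum, Submodule.coe_smul,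
    map_sum, map_smul, finsetSum_coeff, coeff_smul, smul_eq_mul]
  refine Finset.sum_congr rfl fun s _ => ?_
  have hs : (s.rev : ℕ) = d - s := by rw [Fin.val_rev]; omega
  have hs' := s.2
  simp only [monomialLT, hs]
  have hm : eval a (hasseDeriv j ((X : ℝ[X]) ^ (d - (s : ℕ)))) =
      ((d - s).choose j : ℕ) * a ^ (d - s - j) := by
    rw [X_pow_eq_monomial, hasseDeriv_monomial, eval_monomial, mul_one]
  rw [taylor_coeff, hm, sub_eq_add_neg X, ← C_neg, coeff_X_add_C_pow]
  have hc := congrArg (Nat.cast (R := ℝ)) (choose_mul_choose_comm (d := d) (s := s) (j := j))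
  push_cast at hc
  by_cases hsj : s + j ≤ d
  · obtain ⟨e, he⟩ := Nat.exists_eq_add_of_le hsj
    rw [show d - (s : ℕ) - j = e by omega, show d - j - (s : ℕ) = e by omega,
      show (-1 : ℝ) ^ (d - (s : ℕ)) = (-1) ^ e * (-1) ^ j by rw [← pow_add]; congr 1; omega,
      neg_pow a e]
    linear_combination (-1) ^ e * (-1) ^ j * φ ⟨X ^ (s : ℕ), _⟩ * a ^ e * hc
  · rw [Nat.choose_eq_zero_of_lt (show d - s < j by omega)] at hc ⊢
    push_cast at hc ⊢
    linear_combination (-1) ^ j * (-a) ^ (d - j - (s : ℕ)) * φ ⟨X ^ (s : ℕ), _⟩ * hc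

/-- The Taylor coefficients at `0` are nonzero multiples of the values of `φ` on the monomials. -/
theorem dualPoly_injective (d : ℕ) : Function.Injective (dualPoly d) := by
  rw [injective_iff_map_eq_zero]
  intro φ hφ
  have h : ∀ s : Fin (d + 1), φ (monomialLT s) = 0 := by
    intro s
    have hs := s.2
    have h1 := taylor_dualPoly_coeff d φ 0 (d - s)
    rw [hφ] at h1
    simp only [ZeroMemClass.coe_zero, map_zero, coeff_zero] at h1
    have h2 : (⟨(X - C 0) ^ (d - (d - (s : ℕ))), X_sub_C_pow_mem_degreeLT 0 (by omega)⟩ :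
        degreeLT ℝ (d + 1)) = monomialLT s := by
      apply Subtype.ext
      simp only [monomialLT, C_0, sub_zero]
      congr 1
      omega
    simp only [C_0] at h1 h2
    rw [h2] at h1
    have h3 : (d.choose (d - s) : ℝ) ≠ 0 := by
      exact_mod_cast (Nat.choose_pos (by omega)).ne'
    simpa [h3] using h1
  ext f
  rw [eq_sum_monomialLT f]
  simp [h]

/-- The multiples are spanned by the `(X - a) ^ i` with `r < i ≤ d`. By `taylor_dualPoly_coeff`, `φ`
kills these exactly when the Taylor coefficients of orders `j = d - i < d - r` vanish at `a`. For `d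
≤ r` both sides hold trivially. -/
theorem mem_dualAnnihilator_multiples (d r : ℕ) (a : ℝ) (φ : Module.Dual ℝ (degreeLT ℝ (d + 1))) :
    φ ∈ (multiples (d + 1) ((X - C a) ^ (r + 1))).dualAnnihilator ↔
      (X - C a) ^ (d - r) ∣ (dualPoly d φ : ℝ[X]) := by
  rw [X_sub_C_pow_dvd_iff, ← taylor_apply, X_pow_dvd_iff, Submodule.mem_dualAnnihilator]
  constructor
  · intro h j hj
    rw [taylor_dualPoly_coeff, h ⟨_, _⟩, mul_zero]
    exact pow_dvd_pow _ (by omega)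
  · intro h f hf
    rw [mem_multiples, X_sub_C_pow_dvd_iff, ← taylor_apply, X_pow_dvd_iff] at hf
    have hf' : f = ∑ i : Fin (d + 1), (taylor a (f : ℝ[X])).coeff i •
        (⟨(X - C a) ^ (i : ℕ), X_sub_C_pow_mem_degreeLT a i.2⟩ : degreeLT ℝ (d + 1)) := by
      apply Subtype.ext
      conv_lhs => rw [← sum_taylor_eq (f : ℝ[X]) a]
      rw [sum_over_range' _ (by simp) (d + 1), Finset.sum_range]
      · simp only [Submodule.coe_sum, Submodule.coe_smul, smul_eq_C_mul]
      · rw [natDegree_taylor]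
        by_cases hf0 : (f : ℝ[X]) = 0
        · simp [hf0]
        · exact (natDegree_lt_iff_degree_lt hf0).2 (mem_degreeLT.1 f.2)
    rw [hf', map_sum]
    refine Finset.sum_eq_zero fun i _ => ?_
    rw [map_smul]
    by_cases hi : (i : ℕ) < r + 1
    · rw [hf i hi, zero_smul]
    · have hi' := i.2
      have h1 := h (d - i) (by omega)
      rw [taylor_dualPoly_coeff] at h1
      have h2 : (⟨(X - C a) ^ (d - (d - (i : ℕ))), X_sub_C_pow_mem_degreeLT a (by omega)⟩ :
          degreeLT ℝ (d + 1)) = ⟨(X - C a) ^ (i : ℕ), X_sub_C_pow_mem_degreeLT a i.2⟩ := by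
        apply Subtype.ext
        simp only
        congr 1
        omega
      rw [h2] at h1
      have h3 : (d.choose (d - i) : ℝ) ≠ 0 := by
        exact_mod_cast (Nat.choose_pos (by omega)).ne'
      have h4 : φ ⟨(X - C a) ^ (i : ℕ), X_sub_C_pow_mem_degreeLT a i.2⟩ = 0 := by
        simpa [h3] using h1
      rw [h4, smul_zero]

theorem finrank_comap_equiv {V W : Type*} [AddCommGroup V] [Module ℝ V] [AddCommGroup W]
    [Module ℝ W] (e : V ≃ₗ[ℝ] W) (U : Submodule ℝ W) :
    Module.finrank ℝ (U.comap e.toLinearMap) = Module.finrank ℝ U :=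
  (e.ofSubmodule' U).finrank_eq

/-- The dimension of the space of polynomials of degree at most `d` spanned by the multiples of
the `(r + 1)`-st powers of different linear factors. -/
theorem finrank_iSup_multiples (d r : ℕ) (A : Finset ℝ) :
    Module.finrank ℝ (⨆ a ∈ A, multiples (d + 1) ((X - C a) ^ (r + 1)) :
      Submodule ℝ (degreeLT ℝ (d + 1))) = min (d + 1) (A.card * (d - r)) := by
  set W : Submodule ℝ (degreeLT ℝ (d + 1)) := ⨆ a ∈ A, multiples (d + 1) ((X - C a) ^ (r + 1))
    with hW
  have h1 := Subspace.finrank_add_finrank_dualAnnihilator_eq W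
  obtain ⟨e, he⟩ : ∃ e : Module.Dual ℝ (degreeLT ℝ (d + 1)) ≃ₗ[ℝ] degreeLT ℝ (d + 1),
      ∀ φ, e φ = dualPoly d φ :=
    ⟨LinearMap.linearEquivOfInjective (dualPoly d) (dualPoly_injective d)
      Subspace.dual_finrank_eq, fun _ => rfl⟩
  -- The annihilator of a sum is the intersection of the annihilators. Here that means common
  -- multiples of pairwise coprime powers, i.e. multiples of their product.
  set Q : ℝ[X] := ∏ a ∈ A, (X - C a) ^ (d - r) with hQ
  have hQm : Q.Monic := monic_prod_of_monic _ _ fun a _ => (monic_X_sub_C a).pow _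
  have hQd : Q.natDegree = A.card * (d - r) := by
    rw [hQ, natDegree_prod_of_monic _ _ fun a _ => (monic_X_sub_C a).pow _]
    simp
  have h2 : W.dualAnnihilator = (multiples (d + 1) Q).comap e.toLinearMap := by
    ext φ
    rw [hW]
    rw [Submodule.mem_comap, mem_multiples, LinearEquiv.coe_coe, he]
    simp only [Submodule.dualAnnihilator_iSup_eq, Submodule.mem_iInf,
      mem_dualAnnihilator_multiples]
    constructor
    · intro h
      refine Finset.prod_dvd_of_coprime ?_ h
      intro a _ b _ hab
      exact (pairwise_coprime_X_sub_C Function.injective_id hab).pow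
    · intro h a ha
      exact (Finset.dvd_prod_of_mem (fun a => (X - C a) ^ (d - r)) ha).trans h
  have h3 : Module.finrank ℝ W.dualAnnihilator = d + 1 - A.card * (d - r) := by
    rw [← hQd, ← finrank_multiples (d + 1) hQm, h2]
    exact finrank_comap_equiv e _
  rw [h3, finrank_degreeLT] at h1
  omega

end Univariate

/-! ### Bivariate polynomials decomposed by degree about a point -/

section Bivariate

open Polynomial

/-- The space of polynomials in two variables of total degree at most `k`. -/
abbrev Poly (k : ℕ) : Submodule ℝ (MvPolynomial (Fin 2) ℝ) :=
  MvPolynomial.restrictTotalDegree (Fin 2) ℝ k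

/-- The linear polynomial vanishing on the line through `v` and `w`. -/
def edgePoly (v w : Plane) : MvPolynomial (Fin 2) ℝ :=
  MvPolynomial.C (w 0 - v 0) * (MvPolynomial.X 1 - MvPolynomial.C (v 1)) -
    MvPolynomial.C (w 1 - v 1) * (MvPolynomial.X 0 - MvPolynomial.C (v 0))

theorem eval_edgePoly (v w : Plane) (x : Fin 2 → ℝ) :
    MvPolynomial.eval x (edgePoly v w) =
      (w 0 - v 0) * (x 1 - v 1) - (w 1 - v 1) * (x 0 - v 0) := by
  simp [edgePoly]

theorem edgePoly_swap (v w : Plane) : edgePoly w v = -edgePoly v w := by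
  simp only [edgePoly, MvPolynomial.C_sub]
  ring

/-- The polynomials of degree at most `k` which vanish to order `r + 1` on the line through `v`
and `w`. -/
def edgeSpace (r k : ℕ) (v w : Plane) : Submodule ℝ (Poly k) where
  carrier := {h | edgePoly v w ^ (r + 1) ∣ (h : MvPolynomial (Fin 2) ℝ)}
  zero_mem' := dvd_zero _
  add_mem' := fun {_ _} hf hg => dvd_add hf hg
  smul_mem' := fun c f (hf : edgePoly v w ^ (r + 1) ∣ (f : MvPolynomial (Fin 2) ℝ)) => by
    change edgePoly v w ^ (r + 1) ∣ c • (f : MvPolynomial (Fin 2) ℝ)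
    exact hf.trans (dvd_smul_of_dvd c dvd_rfl)

theorem mem_edgeSpace {r k : ℕ} {v w : Plane} {h : Poly k} :
    h ∈ edgeSpace r k v w ↔ edgePoly v w ^ (r + 1) ∣ (h : MvPolynomial (Fin 2) ℝ) := Iff.rfl

theorem edgeSpace_swap (r k : ℕ) (v w : Plane) : edgeSpace r k w v = edgeSpace r k v w := by
  ext h
  rw [mem_edgeSpace, mem_edgeSpace, edgePoly_swap, neg_pow]
  exact ((isUnit_one.neg).pow (r + 1)).mul_left_dvd

/-- The substitution `(x, y) ↦ v + y (x, s x + 1)`. -/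
def blowUp (v : Plane) (s : ℝ) : MvPolynomial (Fin 2) ℝ →ₐ[ℝ] ℝ[X][X] :=
  MvPolynomial.aeval ![C (C (v 0)) + C X * X, C (C (v 1)) + C (C s * X + 1) * X]

theorem blowUp_C (v : Plane) (s c : ℝ) : blowUp v s (MvPolynomial.C c) = C (C c) := by
  rw [blowUp, MvPolynomial.aeval_C]
  rfl

theorem blowUp_X_zero (v : Plane) (s : ℝ) :
    blowUp v s (MvPolynomial.X 0) = C (C (v 0)) + C X * X := by
  simp [blowUp]

theorem blowUp_X_one (v : Plane) (s : ℝ) :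
    blowUp v s (MvPolynomial.X 1) = C (C (v 1)) + C (C s * X + 1) * X := by
  simp [blowUp]

/-- The coefficient of the `d`-th power of the outer variable is the homogeneous part of degree `d`
of `h` about `v`, evaluated at the direction `(x, s x + 1)`. -/
theorem natDegree_coeff_blowUp_le (v : Plane) (s : ℝ) (h : MvPolynomial (Fin 2) ℝ) :
    ∀ d, ((blowUp v s h).coeff d).natDegree ≤ d := by
  induction h using MvPolynomial.induction_on with
  | C c =>
    intro d
    rw [blowUp_C, coeff_C]
    split_ifs <;> simp
  | add p q hp hq =>
    intro d
    rw [map_add, coeff_add]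
    exact (natDegree_add_le _ _).trans (max_le (hp d) (hq d))
  | mul_X p i hp =>
    intro d
    have hX : ∀ e, ((blowUp v s (MvPolynomial.X i)).coeff e).natDegree ≤ e := by
      intro e
      have hlin : (C s * X + 1 : ℝ[X]).natDegree ≤ 1 := by
        refine (natDegree_add_le _ _).trans (max_le ?_ (by simp))
        exact (natDegree_C_mul_le _ _).trans natDegree_X_le
      fin_cases i
      · simp only [Fin.zero_eta, blowUp_X_zero, coeff_add, coeff_C, coeff_C_mul, coeff_X]
        rcases e with _ | _ | e <;> simp
      · simp only [Fin.mk_one, blowUp_X_one, coeff_add, coeff_C, coeff_C_mul, coeff_X]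
        rcases e with _ | _ | e
        · simp
        · simpa using hlin
        · simp
    rw [map_mul, coeff_mul]
    refine natDegree_sum_le_of_forall_le _ _ fun x hx => ?_
    rw [Finset.HasAntidiagonal.mem_antidiagonal] at hx
    exact natDegree_mul_le.trans (hx ▸ add_le_add (hp x.1) (hX x.2))

theorem natDegree_blowUp_le (v : Plane) (s : ℝ) (h : MvPolynomial (Fin 2) ℝ) :
    (blowUp v s h).natDegree ≤ h.totalDegree := by
  have hX : ∀ i, (blowUp v s (MvPolynomial.X i)).natDegree ≤ 1 := by
    have haux : ∀ a b : ℝ[X], (C a + C b * X : ℝ[X][X]).natDegree ≤ 1 := by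
      intro a b
      refine (natDegree_add_le _ _).trans (max_le (by simp) ?_)
      exact (natDegree_C_mul_le _ _).trans natDegree_X_le
    intro i
    fin_cases i
    · simp only [Fin.zero_eta, blowUp_X_zero]; exact haux _ _
    · simp only [Fin.mk_one, blowUp_X_one]; exact haux _ _
  rw [h.as_sum, map_sum]
  refine natDegree_sum_le_of_forall_le _ _ fun m hm => ?_
  rw [← h.as_sum]
  refine le_trans ?_ (MvPolynomial.le_totalDegree hm)
  rw [MvPolynomial.monomial_eq, map_mul, blowUp_C]
  refine (natDegree_C_mul_le _ _).trans ?_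
  rw [Finsupp.prod, map_prod, Finsupp.sum]
  refine (natDegree_prod_le _ _).trans (Finset.sum_le_sum fun i _ => ?_)
  rw [map_pow]
  exact natDegree_pow_le.trans (by simpa using Nat.mul_le_mul_left (m i) (hX i))

/-- The first coordinate of the substitution `blowUp`. -/
def blowUpXi (v : Plane) : MvPolynomial (Fin 2) ℝ := MvPolynomial.X 0 - MvPolynomial.C (v 0)

/-- The second coordinate of the substitution `blowUp`. -/
def blowUpEta (v : Plane) (s : ℝ) : MvPolynomial (Fin 2) ℝ :=
  MvPolynomial.X 1 - MvPolynomial.C (v 1) -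
    MvPolynomial.C s * (MvPolynomial.X 0 - MvPolynomial.C (v 0))

theorem blowUp_xi (v : Plane) (s : ℝ) : blowUp v s (blowUpXi v) = C X * X := by
  simp only [blowUpXi, map_sub, blowUp_C, blowUp_X_zero]
  ring

theorem blowUp_eta (v : Plane) (s : ℝ) : blowUp v s (blowUpEta v s) = X := by
  simp only [blowUpEta, map_sub, map_mul, blowUp_C, blowUp_X_zero, blowUp_X_one, C_add, C_1]
  ring

theorem totalDegree_sub_C_le (i : Fin 2) (c : ℝ) :
    (MvPolynomial.X i - MvPolynomial.C c : MvPolynomial (Fin 2) ℝ).totalDegree ≤ 1 :=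
  (MvPolynomial.totalDegree_sub _ _).trans (by simp)

theorem totalDegree_xi_le (v : Plane) : (blowUpXi v).totalDegree ≤ 1 := totalDegree_sub_C_le _ _

theorem totalDegree_eta_le (v : Plane) (s : ℝ) : (blowUpEta v s).totalDegree ≤ 1 := by
  refine (MvPolynomial.totalDegree_sub _ _).trans (max_le (totalDegree_sub_C_le _ _) ?_)
  refine (MvPolynomial.totalDegree_mul _ _).trans ?_
  simpa using totalDegree_sub_C_le 0 (v 0)

/-- With inner variable `x` and outer variable `y`, `blowUpXi` becomes `x y` and `blowUpEta` becomes
`y`. Hence `x ^ i y ^ d` comes from `ξ ^ i η ^ (d - i)`; homogenizing `f` needs `i ≤ d`. -/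
theorem exists_blowUp_eq (v : Plane) (s : ℝ) {d : ℕ} {f : ℝ[X]} (hf : f.natDegree ≤ d) :
    ∃ h : MvPolynomial (Fin 2) ℝ, h.totalDegree ≤ d ∧ blowUp v s h = C f * X ^ d := by
  refine ⟨∑ i ∈ Finset.range (d + 1),
    MvPolynomial.C (f.coeff i) * (blowUpXi v ^ i * blowUpEta v s ^ (d - i)), ?_, ?_⟩
  · refine MvPolynomial.totalDegree_finsetSum_le fun i hi => ?_
    rw [Finset.mem_range] at hi
    refine (MvPolynomial.totalDegree_mul _ _).trans ?_
    rw [MvPolynomial.totalDegree_C, zero_add]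
    refine (MvPolynomial.totalDegree_mul _ _).trans ?_
    have h1 := (MvPolynomial.totalDegree_pow (blowUpXi v) i).trans
      (Nat.mul_le_mul_left i (totalDegree_xi_le v))
    have h2 := (MvPolynomial.totalDegree_pow (blowUpEta v s) (d - i)).trans
      (Nat.mul_le_mul_left (d - i) (totalDegree_eta_le v s))
    omega
  · conv_rhs => rw [f.as_sum_range' (d + 1) (by omega)]
    rw [map_sum, map_sum, Finset.sum_mul]
    refine Finset.sum_congr rfl fun i hi => ?_
    rw [Finset.mem_range] at hi
    rw [map_mul, map_mul, map_pow, map_pow, blowUp_C, blowUp_xi, blowUp_eta, mul_pow,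
      mul_assoc (C X ^ i), ← pow_add, show i + (d - i) = d by omega, ← C_mul_X_pow_eq_monomial,
      C_mul, C_pow, mul_assoc]

theorem evalEval_blowUp (v : Plane) (s x y : ℝ) (h : MvPolynomial (Fin 2) ℝ) :
    evalEval x y (blowUp v s h) =
      MvPolynomial.eval ![v 0 + x * y, v 1 + (s * x + 1) * y] h := by
  induction h using MvPolynomial.induction_on with
  | C c => simp
  | add p q hp hq => rw [map_add, evalEval_add, hp, hq, map_add]
  | mul_X p i hp =>
    rw [map_mul, evalEval_mul, hp, map_mul]
    congr 1
    fin_cases i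
    · simp [blowUp_X_zero, evalEval]
      ring
    · simp [blowUp_X_one, evalEval]

/-- Off the line `η = 0` the substitution is inverted by `y = η`, `x = ξ / η`. -/
theorem blowUp_injective (v : Plane) (s : ℝ) : Function.Injective (blowUp v s) := by
  rw [injective_iff_map_eq_zero]
  intro h hh
  have hη : blowUpEta v s ≠ 0 := by
    intro h0
    have := blowUp_eta v s
    rw [h0, map_zero] at this
    exact X_ne_zero this.symm
  -- The factor `η` disposes of the points where the inversion fails.
  refine (mul_eq_zero.1 (?_ : h * blowUpEta v s = 0)).resolve_right hη
  refine MvPolynomial.funext fun z => ?_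
  rw [map_mul, map_zero]
  by_cases hz : MvPolynomial.eval z (blowUpEta v s) = 0
  · rw [hz, mul_zero]
  · have h1 := evalEval_blowUp v s ((z 0 - v 0) / MvPolynomial.eval z (blowUpEta v s))
      (MvPolynomial.eval z (blowUpEta v s)) h
    have h2 : MvPolynomial.eval z (blowUpEta v s) = z 1 - v 1 - s * (z 0 - v 0) := by
      simp [blowUpEta]
    have h3 : ![v 0 + (z 0 - v 0) / MvPolynomial.eval z (blowUpEta v s) *
        MvPolynomial.eval z (blowUpEta v s),
        v 1 + (s * ((z 0 - v 0) / MvPolynomial.eval z (blowUpEta v s)) + 1) *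
        MvPolynomial.eval z (blowUpEta v s)] = z := by
      have h4 : (z 0 - v 0) / MvPolynomial.eval z (blowUpEta v s) *
        MvPolynomial.eval z (blowUpEta v s) = z 0 - v 0 := div_mul_cancel₀ _ hz
      funext i
      fin_cases i
      · simp [h4]
      · simp only [Fin.mk_one, Matrix.cons_val_one, Matrix.cons_val_zero]
        rw [add_mul, mul_assoc, h4, one_mul, h2]
        ring
    rw [hh, h3, evalEval_zero] at h1
    rw [← h1, zero_mul]

/-- The coefficients of the substituted polynomial, as polynomials of bounded degree. -/
def blowUpCoeff (v : Plane) (s : ℝ) (k : ℕ) :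
    Poly k →ₗ[ℝ] ((d : Fin (k + 1)) → degreeLT ℝ (d + 1)) where
  toFun h d := ⟨(blowUp v s (h : MvPolynomial (Fin 2) ℝ)).coeff d, by
    rw [mem_degreeLT]
    exact degree_le_natDegree.trans_lt
      (by exact_mod_cast Nat.lt_succ_of_le (natDegree_coeff_blowUp_le v s _ d))⟩
  map_add' g h := _root_.funext fun d => Subtype.ext (by simp)
  map_smul' c h := _root_.funext fun d => Subtype.ext (by simp)

/-- The substitution identifies the polynomials of degree at most `k` in two variables with
families of polynomials of degrees at most `0, …, k`. -/
def blowUpEquiv (v : Plane) (s : ℝ) (k : ℕ) :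
    Poly k ≃ₗ[ℝ] ((d : Fin (k + 1)) → degreeLT ℝ (d + 1)) :=
  LinearEquiv.ofBijective (blowUpCoeff v s k) <| by
    constructor
    · intro g h hgh
      refine Subtype.ext (blowUp_injective v s (ext fun d => ?_))
      by_cases hd : d < k + 1
      · exact congrArg Subtype.val (congrFun hgh ⟨d, hd⟩)
      · have hz : ∀ p : Poly k, (blowUp v s p).coeff d = 0 := fun p =>
          coeff_eq_zero_of_natDegree_lt (((natDegree_blowUp_le v s p).trans
            ((MvPolynomial.mem_restrictTotalDegree _ _ _).1 p.2)).trans_lt (by omega))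
        rw [hz g, hz h]
    · intro f
      have hf : ∀ d : Fin (k + 1), ((f d : ℝ[X])).natDegree ≤ d := fun d =>
        natDegree_le_of_degree_le (Order.le_of_lt_succ (mem_degreeLT.1 (f d).2))
      choose h hdeg hh using fun d => exists_blowUp_eq v s (hf d)
      refine ⟨⟨∑ d, h d, ?_⟩, ?_⟩
      · refine Submodule.sum_mem _ fun d _ => ?_
        rw [MvPolynomial.mem_restrictTotalDegree]
        exact (hdeg d).trans (Nat.le_of_lt_succ d.2)
      · refine _root_.funext fun d => Subtype.ext ?_
        simp only [blowUpCoeff, LinearMap.coe_mk, AddHom.coe_mk, map_sum, hh, finsetSum_coeff, coeff_C_mul,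
          coeff_X_pow]
        rw [Finset.sum_eq_single d]
        · simp
        · intro b _ hb
          rw [if_neg fun h => hb (Fin.ext h.symm), mul_zero]
        · simp

end Bivariate

/-! ### Dimension of the space of jumps at a vertex -/

section EdgeSpaces

open Polynomial

/-- The parameter of the direction of the line through `v` and `w` under `blowUp`. -/
def slopeParam (s : ℝ) (v w : Plane) : ℝ :=
  -(w 0 - v 0) / ((w 0 - v 0) * s - (w 1 - v 1))

theorem blowUp_edgePoly {v w : Plane} {s : ℝ} (hκ : (w 0 - v 0) * s - (w 1 - v 1) ≠ 0) :
    blowUp v s (edgePoly v w) =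
      C (C ((w 0 - v 0) * s - (w 1 - v 1)) * (X - C (slopeParam s v w))) * X := by
  obtain ⟨κ, hκe⟩ : ∃ κ, κ = (w 0 - v 0) * s - (w 1 - v 1) := ⟨_, rfl⟩
  have h1 : w 0 - v 0 = -(κ * slopeParam s v w) := by
    rw [slopeParam, ← hκe]
    rw [← hκe] at hκ
    field_simp
  have h2 : w 1 - v 1 = (w 0 - v 0) * s - κ := by rw [hκe]; ring
  rw [← hκe]
  simp only [edgePoly, map_sub (blowUp v s), map_mul (blowUp v s), blowUp_C, blowUp_X_zero,
    blowUp_X_one]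
  rw [h2, h1]
  simp only [C_neg, C_mul, C_sub, C_add, C_1]
  ring

/-- The equation of the edge becomes `κ (x - a) y`, with `κ ≠ 0` because the edge is not parallel to
`(1, s)`. Divisibility by its power is then tested on each coefficient in `y`. -/
theorem mem_edgeSpace_iff {r k : ℕ} {v w : Plane} {s : ℝ}
    (hκ : (w 0 - v 0) * s - (w 1 - v 1) ≠ 0) (h : Poly k) :
    h ∈ edgeSpace r k v w ↔ ∀ d : Fin (k + 1),
      blowUpEquiv v s k h d ∈ multiples (d + 1) ((X - C (slopeParam s v w)) ^ (r + 1)) := by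
  set a := slopeParam s v w
  set κ := (w 0 - v 0) * s - (w 1 - v 1)
  have hcoe : ∀ d : Fin (k + 1), ((blowUpEquiv v s k h d : degreeLT ℝ (d + 1)) : ℝ[X]) =
      (blowUp v s (h : MvPolynomial (Fin 2) ℝ)).coeff d := fun d => rfl
  have hpow : blowUp v s (edgePoly v w ^ (r + 1)) =
      C (C (κ ^ (r + 1)) * (X - C a) ^ (r + 1)) * X ^ (r + 1) := by
    rw [map_pow, blowUp_edgePoly hκ, mul_pow, ← C_pow, mul_pow, ← C_pow]
  rw [mem_edgeSpace]
  simp only [mem_multiples, hcoe]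
  constructor
  · rintro ⟨g, hg⟩ d
    rw [hg, map_mul, hpow, mul_assoc, coeff_C_mul]
    exact ((dvd_mul_left _ _).mul_right _)
  · intro hd
    have hex : ∀ d : Fin (k + 1), ∃ g : MvPolynomial (Fin 2) ℝ,
        blowUp v s (edgePoly v w ^ (r + 1) * g) =
          C ((blowUp v s (h : MvPolynomial (Fin 2) ℝ)).coeff d) * X ^ (d : ℕ) := by
      intro d
      obtain ⟨g, hg⟩ := hd d
      by_cases hg0 : g = 0
      · exact ⟨0, by rw [hg, hg0]; simp⟩
      have hdeg := natDegree_coeff_blowUp_le v s (h : MvPolynomial (Fin 2) ℝ) d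
      have hmon : ((X - C a) ^ (r + 1)).Monic := (monic_X_sub_C a).pow _
      -- The coefficient of `y ^ d` has degree at most `d`, so a nonzero multiple of `(x - a) ^ (r +
      -- 1)` forces `r + 1 ≤ d`. The required power of `y` is thus present, and the quotient again
      -- comes from a polynomial in the plane.
      rw [hg, hmon.natDegree_mul' hg0, (monic_X_sub_C a).natDegree_pow, natDegree_X_sub_C] at hdeg
      obtain ⟨q, -, hq⟩ := exists_blowUp_eq v s (d := d - (r + 1)) (f := g) (by omega)
      refine ⟨MvPolynomial.C ((κ ^ (r + 1))⁻¹) * q, ?_⟩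
      rw [map_mul, map_mul, hpow, hq, hg, blowUp_C]
      have h1 : (C (C (κ ^ (r + 1))) : ℝ[X][X]) * C (C ((κ ^ (r + 1))⁻¹)) = 1 := by
        rw [← C_mul, ← C_mul, mul_inv_cancel₀ (pow_ne_zero _ hκ)]
        simp
      have h2 : (X : ℝ[X][X]) ^ (d : ℕ) = X ^ (r + 1) * X ^ (d - (r + 1) : ℕ) := by
        rw [← pow_add]; congr 1; omega
      rw [h2]
      simp only [C_mul (R := ℝ[X])]
      linear_combination (C ((X - C a) ^ (r + 1)) * X ^ (r + 1) * C g *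
        X ^ (d - (r + 1) : ℕ) : ℝ[X][X]) * h1
    choose g hg using hex
    refine ⟨∑ d, g d, blowUp_injective v s ?_⟩
    rw [Finset.mul_sum, map_sum]
    simp only [hg]
    have hle : (blowUp v s (h : MvPolynomial (Fin 2) ℝ)).natDegree < k + 1 :=
      Nat.lt_succ_of_le ((natDegree_blowUp_le v s _).trans
        ((MvPolynomial.mem_restrictTotalDegree _ _ _).1 h.2))
    conv_lhs => rw [(blowUp v s (h : MvPolynomial (Fin 2) ℝ)).as_sum_range' (k + 1) hle]
    rw [Finset.sum_range]
    refine Finset.sum_congr rfl fun d _ => ?_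
    rw [C_mul_X_pow_eq_monomial]

/-- The dimension of the space spanned by the polynomials of degree at most `k` which are
divisible by the `(r + 1)`-st power of one of `t` different lines through a point. -/
def dimSum (r k t : ℕ) : ℕ := ∑ d ∈ Finset.range (k + 1), min (d + 1) (t * (d - r))

theorem pi_iSup_eq {ι κ : Type*} [Fintype ι] {E : ι → Type*} [∀ i, AddCommGroup (E i)]
    [∀ i, Module ℝ (E i)] (Q : Finset κ) (N : κ → ∀ i, Submodule ℝ (E i)) :
    Submodule.pi univ (fun i => ⨆ q ∈ Q, N q i) = ⨆ q ∈ Q, Submodule.pi univ (N q) := by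
  refine le_antisymm ?_ ?_
  · intro x hx
    have hsingle : ∀ i, Submodule.map (LinearMap.single ℝ E i) (⨆ q ∈ Q, N q i) ≤
        ⨆ q ∈ Q, Submodule.pi univ (N q) := by
      intro i
      simp only [Submodule.map_iSup]
      refine iSup₂_mono fun q _ => ?_
      rintro _ ⟨y, hy, rfl⟩ j -
      by_cases hj : j = i
      · subst hj
        simpa using hy
      · simp [hj]
    rw [show x = ∑ i, LinearMap.single ℝ E i (x i) from (LinearMap.sum_single_apply E x).symm]
    exact Submodule.sum_mem _ fun i _ => hsingle i ⟨x i, hx i (mem_univ i), rfl⟩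
  · refine iSup₂_le fun q hq x hx i _ => ?_
    exact Submodule.mem_iSup_of_mem q (Submodule.mem_iSup_of_mem hq (hx i (mem_univ i)))

theorem finrank_iSup_edgeSpace_image (r k : ℕ) (v : Plane) (s : ℝ) (Q : Finset Plane)
    (hQ : ∀ w ∈ Q, (w 0 - v 0) * s - (w 1 - v 1) ≠ 0) :
    Module.finrank ℝ (⨆ w ∈ Q, edgeSpace r k v w : Submodule ℝ (Poly k)) =
      dimSum r k (Q.image (slopeParam s v)).card := by
  have h1 : ∀ w ∈ Q, edgeSpace r k v w = (Submodule.pi univ fun d : Fin (k + 1) =>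
      multiples (d + 1) ((X - C (slopeParam s v w)) ^ (r + 1))).comap
        (blowUpEquiv v s k).toLinearMap := by
    intro w hw
    ext h
    rw [mem_edgeSpace_iff (hQ w hw)]
    simp only [Submodule.mem_comap, Submodule.mem_pi, mem_univ, forall_true_left]
    rfl
  have h2 : (⨆ w ∈ Q, edgeSpace r k v w) = (⨆ w ∈ Q, Submodule.pi univ fun d : Fin (k + 1) =>
      multiples (d + 1) ((X - C (slopeParam s v w)) ^ (r + 1))).comap
        (blowUpEquiv v s k).toLinearMap := by
    rw [biSup_congr h1, Submodule.comap_equiv_eq_map_symm]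
    simp only [Submodule.map_iSup, Submodule.comap_equiv_eq_map_symm]
  rw [h2, finrank_comap_equiv, ← pi_iSup_eq, finrank_pi_submodule, dimSum, Finset.sum_range]
  refine Finset.sum_congr rfl fun d _ => ?_
  rw [← finrank_iSup_multiples, Finset.iSup_finset_image]

theorem finrank_poly (k : ℕ) : Module.finrank ℝ (Poly k) = ∑ d ∈ Finset.range (k + 1), (d + 1) := by
  rw [(blowUpEquiv 0 0 k).finrank_eq, Module.finrank_pi_fintype, Finset.sum_range]
  exact Finset.sum_congr rfl fun d _ => finrank_degreeLT _

/-- The direction `(1, s)` missed by the substitution must avoid the finitely many edge directions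
at `v`. -/
theorem exists_generic (v : Plane) (Q : Finset Plane) (hQ : v ∉ Q) :
    ∃ s : ℝ, ∀ w ∈ Q, (w 0 - v 0) * s - (w 1 - v 1) ≠ 0 := by
  obtain ⟨s, hs⟩ := Infinite.exists_notMem_finset
    (Q.image fun w => (w 1 - v 1) / (w 0 - v 0))
  refine ⟨s, fun w hw h => ?_⟩
  by_cases h0 : w 0 - v 0 = 0
  · apply hQ
    rw [h0] at h
    have : v = w := by
      ext i
      fin_cases i
      · simp only [Fin.zero_eta]; linarith
      · simp only [Fin.mk_one]; linarith
    rwa [this]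
  · apply hs
    rw [Finset.mem_image]
    exact ⟨w, hw, by rw [div_eq_iff h0]; linarith⟩

theorem card_image_eq_of_iff {α β γ : Type*} (Q : Finset α) (f : α → β) (g : α → γ)
    (h : ∀ x ∈ Q, ∀ y ∈ Q, f x = f y ↔ g x = g y) : (Q.image f).card = (Q.image g).card := by
  induction Q using Finset.induction_on with
  | empty => simp
  | insert x Q hx ih =>
    have ih' := ih fun a ha b hb => h a (Finset.mem_insert_of_mem ha) b (Finset.mem_insert_of_mem hb)
    have hmem : f x ∈ Q.image f ↔ g x ∈ Q.image g := by
      simp only [Finset.mem_image]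
      exact exists_congr fun a => and_congr_right fun ha =>
        h a (Finset.mem_insert_of_mem ha) x (Finset.mem_insert_self x Q)
    rw [Finset.image_insert, Finset.image_insert]
    by_cases hf : f x ∈ Q.image f
    · rw [Finset.insert_eq_of_mem hf, Finset.insert_eq_of_mem (hmem.1 hf), ih']
    · rw [Finset.card_insert_of_notMem hf, Finset.card_insert_of_notMem (fun hg => hf (hmem.2 hg)),
        ih']

theorem span_eq_iff_det2 {a b : Plane} (ha : a ≠ 0) (hb : b ≠ 0) :
    Submodule.span ℝ {a} = Submodule.span ℝ {b} ↔ det2 a b = 0 := by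
  constructor
  · intro h
    have : b ∈ Submodule.span ℝ {a} := by rw [h]; exact Submodule.mem_span_singleton_self b
    obtain ⟨t, rfl⟩ := Submodule.mem_span_singleton.1 this
    simp only [det2, PiLp.smul_apply, smul_eq_mul]
    ring
  · intro h
    obtain ⟨t, rfl⟩ := eq_smul_of_det2_eq_zero ha h
    have ht : t ≠ 0 := by
      rintro rfl
      simp at hb
    exact (Submodule.span_singleton_smul_eq (IsUnit.mk0 t ht) a).symm

theorem slopeParam_eq_iff {s : ℝ} {v w w' : Plane} (h : (w 0 - v 0) * s - (w 1 - v 1) ≠ 0)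
    (h' : (w' 0 - v 0) * s - (w' 1 - v 1) ≠ 0) :
    slopeParam s v w = slopeParam s v w' ↔ det2 (w - v) (w' - v) = 0 := by
  rw [slopeParam, slopeParam, div_eq_div_iff h h']
  simp only [det2, PiLp.sub_apply]
  constructor
  · intro h
    linear_combination h
  · intro h
    linear_combination h

/-- The dimension of the space spanned by the edge spaces belonging to the edges from `v` to the
points of a finite set. -/
theorem finrank_iSup_edgeSpace (r k : ℕ) (v : Plane) (Q : Finset Plane) (hQ : v ∉ Q) :
    Module.finrank ℝ (⨆ w ∈ Q, edgeSpace r k v w : Submodule ℝ (Poly k)) =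
      dimSum r k (Q.image fun w => Submodule.span ℝ {w - v}).card := by
  obtain ⟨s, hs⟩ := exists_generic v Q hQ
  rw [finrank_iSup_edgeSpace_image r k v s Q hs]
  congr 1
  refine card_image_eq_of_iff _ _ _ fun w hw w' hw' => ?_
  have hne : ∀ u ∈ Q, u - v ≠ 0 := fun u hu h => hQ (sub_eq_zero.1 h ▸ hu)
  rw [slopeParam_eq_iff (hs w hw) (hs w' hw'), span_eq_iff_det2 (hne w hw) (hne w' hw')]

theorem finrank_edgeSpace (r k : ℕ) {v w : Plane} (h : v ≠ w) :
    Module.finrank ℝ (edgeSpace r k v w) = dimSum r k 1 := by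
  have := finrank_iSup_edgeSpace r k v {w} (by simpa using h)
  rwa [Finset.iSup_singleton, Finset.image_singleton, Finset.card_singleton] at this

end EdgeSpaces

/-! ### Numerical identities for the bounds -/

section Arithmetic

theorem binom_zero (k : ℕ) : binom k 0 = ∑ d ∈ Finset.range (k + 1), ((d : ℤ) + 1) := by
  induction k with
  | zero => simp [binom]
  | succ k ih =>
    rw [Finset.sum_range_succ, ← ih]
    simp only [binom, Nat.sub_zero]
    rw [show k + 1 + 2 = (k + 2) + 1 by ring, Nat.choose_succ_succ' (k + 2) 1, Nat.choose_one_right]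
    push_cast
    ring

theorem binom_succ (k d : ℕ) : binom (k + 1) d = binom k d + ((k + 2 - d : ℕ) : ℤ) := by
  simp only [binom]
  by_cases h : d ≤ k + 2
  · rw [show k + 1 + 2 - d = (k + 2 - d) + 1 by omega, Nat.choose_succ_succ' _ 1,
      Nat.choose_one_right]
    push_cast
    ring
  · rw [show k + 1 + 2 - d = 0 by omega, show k + 2 - d = 0 by omega]
    simp

theorem binom_eq_dimSum (r k : ℕ) : binom k (r + 1) = dimSum r k 1 := by
  induction k with
  | zero =>
    have h : 0 + 2 - (r + 1) < 2 := by omega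
    rw [binom, Nat.choose_eq_zero_of_lt h]
    simp [dimSum]
  | succ k ih =>
    rw [binom_succ, ih, dimSum, dimSum, Finset.sum_range_succ _ (k + 1), Nat.cast_add]
    congr 2
    omega

/-- `Ω` is the least `d` with `(t - 1) d > t r`, that is, with `t (d - r) ≥ d + 1`: the degree where
the minimum in `dimSum` switches. The coefficients `a`, `b` are chosen so that the correction turns
`t (d - r)` into `d + 1` from there on. Increments in `k` are compared. -/
theorem vertexTerm_eq_dimSum (r k : ℕ) {t : ℕ} (ht : 2 ≤ t) : vertexTerm r k t = dimSum r k t := by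
  obtain ⟨u, rfl⟩ : ∃ u, t = u + 2 := ⟨t - 2, by omega⟩
  have h1 : 1 < u + 2 := by omega
  obtain ⟨Ω, hΩ⟩ : ∃ Ω, Ω = Omega r (u + 2) := ⟨_, rfl⟩
  have hΩ' : Ω = (u + 2) * r / (u + 1) + 1 := by rw [hΩ, Omega, if_pos h1]; rfl
  have hlow : (u + 1) * Ω ≤ (u + 2) * r + (u + 1) := by
    have := Nat.mul_div_le ((u + 2) * r) (u + 1)
    rw [hΩ']
    linarith
  have hhigh : (u + 2) * r < (u + 1) * Ω := by
    rw [hΩ']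
    exact Nat.lt_mul_div_succ _ (by omega)
  have hrΩ : r + 1 ≤ Ω := by
    by_contra hlt
    have : Ω ≤ r := by omega
    have h2 := Nat.mul_le_mul_left (u + 1) this
    nlinarith
  simp only [vertexTerm, coeffA, coeffB, if_pos h1]
  rw [← hΩ]
  induction k with
  | zero =>
    have ha : (0 + 2 - (r + 1)).choose 2 = 0 := Nat.choose_eq_zero_of_lt (by omega)
    have hb : (0 + 2 - Ω).choose 2 = 0 := Nat.choose_eq_zero_of_lt (by omega)
    have hc : (0 + 2 - (Ω + 1)).choose 2 = 0 := Nat.choose_eq_zero_of_lt (by omega)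
    simp only [binom, ha, hb, hc, dimSum]
    simp
  | succ k ih =>
    have hd : dimSum r (k + 1) (u + 2) =
        dimSum r k (u + 2) + min (k + 1 + 1) ((u + 2) * (k + 1 - r)) := Finset.sum_range_succ _ _
    rw [hd, Nat.cast_add (dimSum r k (u + 2)), ← ih]
    simp only [binom_succ]
    have hmain : (((u + 2 : ℕ) : ℤ)) * ((k + 2 - (r + 1) : ℕ) : ℤ) -
        (((u + 2 : ℕ) : ℤ) - 1 - (((u + 2 : ℕ) : ℤ) * (r + 1) + (1 - ((u + 2 : ℕ) : ℤ)) * Ω)) *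
          ((k + 2 - Ω : ℕ) : ℤ) -
        (((u + 2 : ℕ) : ℤ) * (r + 1) + (1 - ((u + 2 : ℕ) : ℤ)) * Ω) * ((k + 2 - (Ω + 1) : ℕ) : ℤ) =
        ((min (k + 1 + 1) ((u + 2) * (k + 1 - r)) : ℕ) : ℤ) := by
      -- The new degree is `d = k + 1`. For `d < Ω` both correction terms vanish by truncated
      -- subtraction.
      rcases le_or_gt Ω (k + 1) with hk | hk
      · have hmin : min (k + 1 + 1) ((u + 2) * (k + 1 - r)) = k + 1 + 1 := by
          apply min_eq_left
          obtain ⟨x, hx⟩ := Nat.exists_eq_add_of_le hk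
          obtain ⟨y, hy⟩ := Nat.exists_eq_add_of_le hrΩ
          rw [show k + 1 - r = x + y + 1 by omega]
          have : k + 1 = r + 1 + y + x := by omega
          subst hy
          nlinarith
        rw [hmin]
        rw [Nat.cast_sub (by omega), Nat.cast_sub (by omega), Nat.cast_sub (by omega)]
        push_cast
        ring
      · have hz1 : k + 2 - (Ω + 1) = 0 := by omega
        have hmin : min (k + 1 + 1) ((u + 2) * (k + 1 - r)) = (u + 2) * (k + 1 - r) := by
          apply min_eq_right
          rcases Nat.lt_or_ge (k + 1) r with h | h
          · rw [show k + 1 - r = 0 by omega]; omega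
          · obtain ⟨x, hx⟩ := Nat.exists_eq_add_of_le h
            rw [show k + 1 - r = x by omega]
            have h3 : (u + 1) * (k + 2) ≤ (u + 1) * Ω := Nat.mul_le_mul_left _ (by omega)
            have h4 : k + 2 = r + x + 1 := by omega
            rw [h4] at h3
            rw [hx]
            nlinarith
        rw [hmin, hz1, show k + 2 - Ω = 0 by omega, show k + 2 - (r + 1) = k + 1 - r by omega]
        push_cast
        ring
    linear_combination hmain

/-- With at least `r + 2` slopes, every degree `d > r` is already full: `(r + 2) (d - r) ≥ d + 1`.
Further slopes add nothing. -/
theorem dimSum_eq_of_lt {r k t t' : ℕ} (ht : r + 1 < t) (ht' : r + 1 < t') :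
    dimSum r k t = dimSum r k t' := by
  have key : ∀ t, r + 1 < t → ∀ d, min (d + 1) (t * (d - r)) = if r < d then d + 1 else 0 := by
    intro t ht d
    split_ifs with h
    · apply min_eq_left
      obtain ⟨x, rfl⟩ := Nat.exists_eq_add_of_lt h
      rw [show r + x + 1 - r = x + 1 by omega]
      nlinarith
    · rw [show d - r = 0 by omega]
      simp
  exact Finset.sum_congr rfl fun d _ => by rw [key t ht, key t' ht']

end Arithmetic

/-! ### Vanishing along a line and divisibility by its equation -/

section Divisibility

theorem edgePoly_ne_zero {v w : Plane} (h : v ≠ w) : edgePoly v w ≠ 0 := by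
  intro h0
  have h1 := eval_edgePoly v w ![v 0 - (w 1 - v 1), v 1 + (w 0 - v 0)]
  rw [h0] at h1
  simp only [map_zero, Matrix.cons_val_zero, Matrix.cons_val_one] at h1
  apply h
  ext i
  fin_cases i
  · show v 0 = w 0
    nlinarith [sq_nonneg (w 0 - v 0), sq_nonneg (w 1 - v 1)]
  · show v 1 = w 1
    nlinarith [sq_nonneg (w 0 - v 0), sq_nonneg (w 1 - v 1)]

/-- A polynomial vanishing on the segment from `v` to `w` is divisible by the equation of the
line through `v` and `w`. -/
theorem edgePoly_dvd_of_eval_eq_zero {v w : Plane} (hvw : v ≠ w) {h : MvPolynomial (Fin 2) ℝ}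
    (h0 : ∀ x ∈ convexHull ℝ {v, w}, MvPolynomial.eval (fun i => x i) h = 0) :
    edgePoly v w ∣ h := by
  set N : ℝ := (w 0 - v 0) ^ 2 + (w 1 - v 1) ^ 2 with hN
  have hN0 : N ≠ 0 := by
    intro hN0
    apply hvw
    ext i
    fin_cases i
    · show v 0 = w 0
      nlinarith [sq_nonneg (w 0 - v 0), sq_nonneg (w 1 - v 1)]
    · show v 1 = w 1
      nlinarith [sq_nonneg (w 0 - v 0), sq_nonneg (w 1 - v 1)]
  -- The parameter of the orthogonal projection to the line. Modulo the equation of the line each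
  -- coordinate is `v i + (w i - v i) T`, so `h` is congruent to `q(T)`, where `q` is the
  -- restriction of `h` to the line; `q` has all of `[0, 1]` as roots.
  set T : MvPolynomial (Fin 2) ℝ := MvPolynomial.C N⁻¹ *
    (MvPolynomial.C (w 0 - v 0) * (MvPolynomial.X 0 - MvPolynomial.C (v 0)) +
      MvPolynomial.C (w 1 - v 1) * (MvPolynomial.X 1 - MvPolynomial.C (v 1))) with hT
  set q : Polynomial ℝ := MvPolynomial.aeval
    (fun i => Polynomial.C (v i) + Polynomial.C (w i - v i) * Polynomial.X) h with hq
  have hq0 : q = 0 := by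
    refine Polynomial.eq_zero_of_infinite_isRoot q ((Icc_infinite (zero_lt_one' ℝ)).mono ?_)
    intro t ht
    have hx : v + t • (w - v) ∈ convexHull ℝ {v, w} := by
      rw [convexHull_pair, segment_eq_image']
      exact ⟨t, ht, rfl⟩
    have h1 := h0 _ hx
    show Polynomial.eval t q = 0
    rw [← h1, hq]
    have : ∀ g : MvPolynomial (Fin 2) ℝ, Polynomial.eval t (MvPolynomial.aeval
        (fun i => Polynomial.C (v i) + Polynomial.C (w i - v i) * Polynomial.X) g) =
        MvPolynomial.eval (fun i => (v + t • (w - v)) i) g := by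
      intro g
      induction g using MvPolynomial.induction_on with
      | C c => simp
      | add f g hf hg => simp only [map_add, Polynomial.eval_add, hf, hg]
      | mul_X f i hf =>
        simp only [map_mul, Polynomial.eval_mul, hf, MvPolynomial.aeval_X, MvPolynomial.eval_X,
          Polynomial.eval_add, Polynomial.eval_C, Polynomial.eval_X, PiLp.add_apply,
          PiLp.smul_apply, PiLp.sub_apply, smul_eq_mul]
        ring
    exact this h
  have key : ∀ g : MvPolynomial (Fin 2) ℝ, edgePoly v w ∣ g - Polynomial.aeval T
      (MvPolynomial.aeval (fun i => Polynomial.C (v i) + Polynomial.C (w i - v i) * Polynomial.X)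
        g : Polynomial ℝ) := by
    intro g
    induction g using MvPolynomial.induction_on with
    | C c => simp [MvPolynomial.algebraMap_eq]
    | add f g hf hg =>
      simp only [map_add]
      convert dvd_add hf hg using 1
      ring
    | mul_X f i hf =>
      simp only [map_mul, MvPolynomial.aeval_X, map_add, Polynomial.aeval_C, Polynomial.aeval_X,
        MvPolynomial.algebraMap_eq]
      have hX : edgePoly v w ∣
          MvPolynomial.X i - (MvPolynomial.C (v i) + MvPolynomial.C (w i - v i) * T) := by
        have hC : (MvPolynomial.C N⁻¹ * MvPolynomial.C N : MvPolynomial (Fin 2) ℝ) = 1 := by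
          rw [← MvPolynomial.C_mul, inv_mul_cancel₀ hN0, MvPolynomial.C_1]
        have hCN : (MvPolynomial.C N : MvPolynomial (Fin 2) ℝ) =
            MvPolynomial.C (w 0 - v 0) ^ 2 + MvPolynomial.C (w 1 - v 1) ^ 2 := by
          rw [hN]
          simp only [map_add, map_pow]
        rw [hCN] at hC
        fin_cases i
        · refine ⟨-(MvPolynomial.C N⁻¹ * MvPolynomial.C (w 1 - v 1)), ?_⟩
          simp only [edgePoly, hT, Fin.zero_eta]
          linear_combination (MvPolynomial.C (v 0) - MvPolynomial.X 0) * hC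
        · refine ⟨MvPolynomial.C N⁻¹ * MvPolynomial.C (w 0 - v 0), ?_⟩
          simp only [edgePoly, hT, Fin.mk_one]
          linear_combination (MvPolynomial.C (v 1) - MvPolynomial.X 1) * hC
      have := dvd_add (hf.mul_right (MvPolynomial.X i)) (hX.mul_left (Polynomial.aeval T
        (MvPolynomial.aeval (fun i => Polynomial.C (v i) + Polynomial.C (w i - v i) *
          Polynomial.X) f : Polynomial ℝ)))
      convert this using 1
      ring
  have := key h
  rwa [← hq, hq0, map_zero, sub_zero] at this

theorem eval_edgePoly_eq_zero {v w x : Plane} (hx : x ∈ convexHull ℝ {v, w}) :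
    MvPolynomial.eval (fun i => x i) (edgePoly v w) = 0 := by
  rw [convexHull_pair, segment_eq_image'] at hx
  obtain ⟨t, -, rfl⟩ := hx
  rw [eval_edgePoly]
  simp only [PiLp.add_apply, PiLp.smul_apply, PiLp.sub_apply, smul_eq_mul]
  ring

theorem pow_dvd_pderiv {L h : MvPolynomial (Fin 2) ℝ} {m : ℕ} (i : Fin 2) (hh : L ^ (m + 1) ∣ h) :
    L ^ m ∣ MvPolynomial.pderiv i h := by
  obtain ⟨g, rfl⟩ := hh
  rw [Derivation.leibniz, Derivation.leibniz_pow]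
  simp only [smul_eq_mul, nsmul_eq_mul, Nat.add_sub_cancel]
  refine dvd_add ?_ ?_
  · exact (pow_dvd_pow L (Nat.le_succ m)).mul_right _
  · exact Dvd.dvd.mul_left (Dvd.dvd.mul_left (dvd_mul_right _ _) _) _

theorem pderiv_edgePoly (v w : Plane) (i : Fin 2) :
    MvPolynomial.pderiv i (edgePoly v w) =
      MvPolynomial.C ((![-(w 1 - v 1), w 0 - v 0] : Fin 2 → ℝ) i) := by
  fin_cases i <;> simp [edgePoly, Derivation.leibniz, MvPolynomial.pderiv_X]

/-- A polynomial which vanishes on the segment from `v` to `w` and whose first partial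
derivatives vanish to order `m` along it vanishes to order `m + 1`. -/
theorem edgePoly_pow_succ_dvd {v w : Plane} (hvw : v ≠ w) {h : MvPolynomial (Fin 2) ℝ} {m : ℕ}
    (h0 : edgePoly v w ∣ h) (hd : ∀ i, edgePoly v w ^ m ∣ MvPolynomial.pderiv i h) :
    edgePoly v w ^ (m + 1) ∣ h := by
  obtain ⟨i, c, hc, hi⟩ : ∃ (i : Fin 2) (c : ℝ), c ≠ 0 ∧
      MvPolynomial.pderiv i (edgePoly v w) = MvPolynomial.C c := by
    by_cases h1 : w 0 - v 0 = 0
    · refine ⟨0, -(w 1 - v 1), ?_, ?_⟩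
      · intro h2
        apply hvw
        ext i
        fin_cases i
        · exact (sub_eq_zero.1 h1).symm
        · exact (sub_eq_zero.1 (neg_eq_zero.1 h2)).symm
      · exact pderiv_edgePoly v w 0
    · refine ⟨1, w 0 - v 0, h1, pderiv_edgePoly v w 1⟩
  suffices ∀ j ≤ m, edgePoly v w ^ (j + 1) ∣ h from this m le_rfl
  intro j
  induction j with
  | zero => intro _; simpa using h0
  | succ j ih =>
    intro hj
    obtain ⟨g, rfl⟩ := ih (by omega)
    -- For `h = ℓ ^ (j+1) g` the derivative is `ℓ ^ (j+1) ∂g + (j+1) c ℓ ^ j g` with `c ≠ 0`. Its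
    -- divisibility by `ℓ ^ (j+1)` forces `ℓ ∣ g`.
    have h1 := (pow_dvd_pow (edgePoly v w) hj).trans (hd i)
    rw [Derivation.leibniz, Derivation.leibniz_pow, hi] at h1
    simp only [smul_eq_mul, nsmul_eq_mul, Nat.add_sub_cancel] at h1
    have h2 := (dvd_add_right (dvd_mul_right _ _)).1 h1
    have h3 : g * (((j + 1 : ℕ) : MvPolynomial (Fin 2) ℝ) *
        (edgePoly v w ^ j * MvPolynomial.C c)) =
        edgePoly v w ^ j * (MvPolynomial.C (((j + 1 : ℕ) : ℝ) * c) * g) := by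
      rw [MvPolynomial.C_mul, map_natCast]
      ring
    rw [h3, pow_succ, mul_dvd_mul_iff_left (pow_ne_zero _ (edgePoly_ne_zero hvw))] at h2
    have hu : IsUnit (MvPolynomial.C (((j + 1 : ℕ) : ℝ) * c) : MvPolynomial (Fin 2) ℝ) :=
      (IsUnit.mk0 _ (mul_ne_zero (by positivity) hc)).map MvPolynomial.C
    rw [pow_succ (edgePoly v w) (j + 1)]
    exact mul_dvd_mul_left _ (hu.dvd_mul_left.1 h2)

end Divisibility

/-! ### Derivatives of polynomial functions and on finite unions -/

section Calculus

theorem hasFDerivAt_eval (p : MvPolynomial (Fin 2) ℝ) (x : Plane) :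
    HasFDerivAt (fun y : Plane => MvPolynomial.eval (fun i => y i) p)
      (∑ i, MvPolynomial.eval (fun j => x j) (MvPolynomial.pderiv i p) •
        (EuclideanSpace.proj i : Plane →L[ℝ] ℝ)) x := by
  induction p using MvPolynomial.induction_on with
  | C c => simpa using hasFDerivAt_const c x
  | add f g hf hg =>
    simp only [map_add, add_smul, Finset.sum_add_distrib]
    exact hf.add hg
  | mul_X f i hf =>
    have hX : HasFDerivAt (fun y : Plane => y i) (EuclideanSpace.proj i : Plane →L[ℝ] ℝ) x :=
      (EuclideanSpace.proj i : Plane →L[ℝ] ℝ).hasFDerivAt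
    simp only [map_mul, MvPolynomial.eval_X]
    refine (hf.mul hX).congr_fderiv ?_
    ext y
    simp only [Derivation.leibniz, smul_eq_mul, MvPolynomial.pderiv_X, map_add, map_mul,
      MvPolynomial.eval_X, Fin.sum_univ_two]
    fin_cases i <;> simp <;> ring

theorem continuous_eval (p : MvPolynomial (Fin 2) ℝ) :
    Continuous fun y : Plane => MvPolynomial.eval (fun i => y i) p :=
  continuous_iff_continuousAt.2 fun x => (hasFDerivAt_eval p x).continuousAt

theorem hasFDerivWithinAt_biUnion {ι : Type*} {T : Set ι} (hT : T.Finite) {s : ι → Set Plane}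
    {f : Plane → ℝ} {f' : Plane →L[ℝ] ℝ} {x : Plane}
    (h : ∀ i ∈ T, HasFDerivWithinAt f f' (s i) x) :
    HasFDerivWithinAt f f' (⋃ i ∈ T, s i) x := by
  induction T, hT using Set.Finite.induction_on with
  | empty => simp [HasFDerivWithinAt.empty]
  | insert _ _ ih =>
    rw [biUnion_insert]
    exact (h _ (mem_insert _ _)).union (ih fun i hi => h i (mem_insert_of_mem _ hi))

end Calculus

/-! ### Smoothness across edges as divisibility of jumps -/

section Splines

variable {Δ : Geometry.SimplicialComplex ℝ Plane}

theorem space_eq_biUnion_triangles (hΔ : IsTriangulatedDisk Δ) :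
    Δ.space = ⋃ σ ∈ triangles Δ, convexHull ℝ (σ : Set Plane) := by
  apply Subset.antisymm
  · intro x hx
    obtain ⟨σ, hσ, hx⟩ := exists_triangle_mem hΔ hx
    exact mem_biUnion hσ hx
  · exact iUnion₂_subset fun σ hσ => Δ.convexHull_subset_space hσ.1

theorem interior_triangle_nonempty {σ : Finset Plane} (hσ : σ ∈ triangles Δ) :
    (interior (convexHull ℝ (σ : Set Plane))).Nonempty := by
  rw [interior_convexHull_nonempty_iff_affineSpan_eq_top]
  have h := (Δ.indep hσ.1).affineSpan_eq_top_iff_card_eq_finrank_add_one.2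
    (by simp [hσ.2])
  simpa using h

theorem uniqueDiffOn_triangle {σ : Finset Plane} (hσ : σ ∈ triangles Δ) :
    UniqueDiffOn ℝ (convexHull ℝ (σ : Set Plane)) :=
  uniqueDiffOn_convex (convex_convexHull ℝ _) (interior_triangle_nonempty hσ)

theorem uniqueDiffOn_space (hΔ : IsTriangulatedDisk Δ) : UniqueDiffOn ℝ Δ.space := by
  intro x hx
  obtain ⟨σ, hσ, hx⟩ := exists_triangle_mem hΔ hx
  exact (uniqueDiffOn_triangle hσ x hx).mono (Δ.convexHull_subset_space hσ.1)

theorem eq_zero_of_eval_eq_zero {σ : Finset Plane} (hσ : σ ∈ triangles Δ)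
    {p : MvPolynomial (Fin 2) ℝ}
    (hp : ∀ x ∈ convexHull ℝ (σ : Set Plane), MvPolynomial.eval (fun i => x i) p = 0) : p = 0 := by
  obtain ⟨x, hx⟩ := interior_triangle_nonempty hσ
  -- In the sup metric a ball is a product of intervals, and a polynomial vanishing on a product of
  -- infinite sets is zero.
  obtain ⟨U, hU⟩ : ∃ U, U = (WithLp.toLp 2 : (Fin 2 → ℝ) → Plane) ⁻¹'
    interior (convexHull ℝ (σ : Set Plane)) := ⟨_, rfl⟩
  have hUo : IsOpen U := hU ▸ isOpen_interior.preimage (PiLp.continuous_toLp 2 _)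
  have hxU : (fun i => x i) ∈ U := hU ▸ hx
  obtain ⟨ε, hε, hball⟩ := Metric.isOpen_iff.1 hUo _ hxU
  refine MvPolynomial.funext_set (fun i => Metric.ball (x i) ε) (fun i => ?_) fun y hy => ?_
  · rw [Real.ball_eq_Ioo]
    exact Ioo_infinite (by linarith)
  · rw [map_zero]
    rw [← ball_pi _ hε] at hy
    have : y ∈ U := hball hy
    rw [hU] at this
    exact hp _ (interior_subset this)

/-- The family of polynomials `p` has jumps which vanish to order `m` along the interior edges. -/
def JumpsDivisible (Δ : Geometry.SimplicialComplex ℝ Plane) (m : ℕ)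
    (p : triangles Δ → MvPolynomial (Fin 2) ℝ) : Prop :=
  ∀ v w (h : IsInteriorEdge Δ v w), edgePoly v w ^ m ∣
    p ⟨leftTri Δ v w, h.left_mem.1⟩ - p ⟨leftTri Δ w v, h.symm.left_mem.1⟩

/-- Two triangles meet in a common face. On a common edge their difference is divisible by its
equation; at a common vertex the values are compared step by step through the star of the vertex,
across the interior edges there. -/
theorem JumpsDivisible.eval_eq (hΔ : IsTriangulatedDisk Δ) {m : ℕ}
    {p : triangles Δ → MvPolynomial (Fin 2) ℝ} (hp : JumpsDivisible Δ (m + 1) p)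
    {σ τ : triangles Δ} {x : Plane} (hxσ : x ∈ convexHull ℝ (σ.1 : Set Plane))
    (hxτ : x ∈ convexHull ℝ (τ.1 : Set Plane)) :
    MvPolynomial.eval (fun i => x i) (p σ) = MvPolynomial.eval (fun i => x i) (p τ) := by
  have hjump : ∀ v w (h : IsInteriorEdge Δ v w), ∀ y ∈ convexHull ℝ {v, w},
      MvPolynomial.eval (fun i => y i) (p ⟨leftTri Δ v w, h.left_mem.1⟩) =
        MvPolynomial.eval (fun i => y i) (p ⟨leftTri Δ w v, h.symm.left_mem.1⟩) := by
    intro v w h y hy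
    obtain ⟨g, hg⟩ := (dvd_pow_self _ (Nat.succ_ne_zero m)).trans (hp v w h)
    rw [← sub_eq_zero, ← map_sub, hg, map_mul, eval_edgePoly_eq_zero hy, zero_mul]
  by_cases hστ : σ = τ
  · rw [hστ]
  have hστ' : σ.1 ≠ τ.1 := fun h => hστ (Subtype.ext h)
  obtain ⟨hf, hx⟩ := inter_mem_faces σ.2.1 τ.2.1 hxσ hxτ
  obtain ⟨v, hv⟩ := Δ.nonempty_of_mem_faces hf
  by_cases hv1 : σ.1 ∩ τ.1 = {v}
  · rw [hv1] at hx
    obtain rfl : x = v := by simpa using hx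
    have := eq_of_star hΔ (fun ρ => if h : ρ ∈ triangles Δ then
      MvPolynomial.eval (fun i => x i) (p ⟨ρ, h⟩) else 0) (v := x) (fun w h => by
        simp only [dif_pos h.left_mem.1, dif_pos h.symm.left_mem.1]
        exact hjump x w h x (subset_convexHull ℝ _ (by simp))) σ.2 τ.2
        (Finset.mem_of_mem_inter_left hv) (Finset.mem_of_mem_inter_right hv)
    simpa only [dif_pos σ.2, dif_pos τ.2] using this
  · obtain ⟨w, hw, hwv⟩ := Finset.exists_mem_ne (a := v) (s := σ.1 ∩ τ.1) (by
      by_contra hle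
      exact hv1 (Finset.eq_singleton_iff_unique_mem.2
        ⟨hv, fun y hy => Finset.card_le_one.1 (not_lt.1 hle) y hy v hv⟩))
    have hI : σ.1 ∩ τ.1 = {v, w} := by
      symm
      apply Finset.eq_of_subset_of_card_le
      · simp only [Finset.insert_subset_iff, Finset.singleton_subset_iff]
        exact ⟨hv, hw⟩
      · rw [Finset.card_pair hwv.symm]
        by_contra hlt
        have h3 : σ.1.card ≤ (σ.1 ∩ τ.1).card := by rw [σ.2.2]; omega
        have h3' : τ.1.card ≤ (σ.1 ∩ τ.1).card := by rw [τ.2.2]; omega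
        exact hστ' ((Finset.eq_of_subset_of_card_le Finset.inter_subset_left h3).symm.trans
          (Finset.eq_of_subset_of_card_le Finset.inter_subset_right h3'))
    rw [hI, Finset.coe_pair] at hx
    obtain ⟨σ, hσ⟩ := σ
    obtain ⟨τ, hτ⟩ := τ
    obtain ⟨h, ⟨rfl, rfl⟩ | ⟨rfl, rfl⟩⟩ := isInteriorEdge_of_mem hσ hτ hστ' hwv.symm
      (Finset.mem_of_mem_inter_left hv) (Finset.mem_of_mem_inter_left hw)
      (Finset.mem_of_mem_inter_right hv) (Finset.mem_of_mem_inter_right hw)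
    · exact hjump v w h x hx
    · exact (hjump v w h x hx).symm

/-- The function on the plane which is given on each triangle by the corresponding polynomial. -/
def glue (p : triangles Δ → MvPolynomial (Fin 2) ℝ) (x : Plane) : ℝ :=
  if h : ∃ σ : triangles Δ, x ∈ convexHull ℝ (σ.1 : Set Plane) then
    MvPolynomial.eval (fun i => x i) (p h.choose) else 0

theorem JumpsDivisible.glue_eq (hΔ : IsTriangulatedDisk Δ) {m : ℕ}
    {p : triangles Δ → MvPolynomial (Fin 2) ℝ} (hp : JumpsDivisible Δ (m + 1) p)
    (σ : triangles Δ) {x : Plane} (hx : x ∈ convexHull ℝ (σ.1 : Set Plane)) :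
    glue p x = MvPolynomial.eval (fun i => x i) (p σ) := by
  have h : ∃ σ : triangles Δ, x ∈ convexHull ℝ (σ.1 : Set Plane) := ⟨σ, hx⟩
  rw [glue, dif_pos h]
  exact hp.eval_eq hΔ h.choose_spec hx

theorem JumpsDivisible.pderiv {m : ℕ} {p : triangles Δ → MvPolynomial (Fin 2) ℝ}
    (hp : JumpsDivisible Δ (m + 1) p) (i : Fin 2) :
    JumpsDivisible Δ m fun σ => MvPolynomial.pderiv i (p σ) := fun v w h => by
  rw [← map_sub]
  exact pow_dvd_pderiv i (hp v w h)

/-- The partial derivatives still have jumps divisible to order `m + 1 ≥ 1`, so all triangles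
containing `x` give the same gradient. Triangles not containing `x` are closed and impose nothing.
-/
theorem JumpsDivisible.hasFDerivWithinAt_glue (hΔ : IsTriangulatedDisk Δ) {m : ℕ}
    {p : triangles Δ → MvPolynomial (Fin 2) ℝ} (hp : JumpsDivisible Δ (m + 2) p)
    (x : Plane) : HasFDerivWithinAt (glue p)
      (∑ i, glue (fun σ => MvPolynomial.pderiv i (p σ)) x •
        (EuclideanSpace.proj i : Plane →L[ℝ] ℝ)) Δ.space x := by
  rw [space_eq_biUnion_triangles hΔ]
  refine hasFDerivWithinAt_biUnion (finite_triangles hΔ) fun σ hσ => ?_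
  by_cases hxσ : x ∈ convexHull ℝ (σ : Set Plane)
  · simp only [fun i => (hp.pderiv i).glue_eq hΔ ⟨σ, hσ⟩ hxσ]
    exact (hasFDerivAt_eval (p ⟨σ, hσ⟩) x).hasFDerivWithinAt.congr
      (fun y hy => hp.glue_eq hΔ ⟨σ, hσ⟩ hy) (hp.glue_eq hΔ ⟨σ, hσ⟩ hxσ)
  · exact HasFDerivWithinAt.of_notMem_closure
      (by rwa [(isClosed_convexHull_finset σ).closure_eq])

/-- Induction on `r`: the partial derivatives of a glued function are glued from the partial
derivatives, at the cost of one order of divisibility. -/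
theorem JumpsDivisible.contDiffOn_glue (hΔ : IsTriangulatedDisk Δ) (r : ℕ) :
    ∀ {p : triangles Δ → MvPolynomial (Fin 2) ℝ}, JumpsDivisible Δ (r + 1) p →
      ContDiffOn ℝ r (glue p) Δ.space := by
  induction r with
  | zero =>
    intro p hp
    rw [Nat.cast_zero, contDiffOn_zero, space_eq_biUnion_triangles hΔ, biUnion_eq_iUnion]
    have : Finite (triangles Δ) := (finite_triangles hΔ).to_subtype
    refine (locallyFinite_of_finite _).continuousOn_iUnion
      (fun σ => isClosed_convexHull_finset σ.1) fun σ => ?_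
    exact (continuous_eval (p σ)).continuousOn.congr fun y hy => hp.glue_eq hΔ σ hy
  | succ r ih =>
    intro p hp
    rw [Nat.cast_succ, contDiffOn_succ_iff_hasFDerivWithinAt_of_uniqueDiffOn
      (uniqueDiffOn_space hΔ)]
    refine ⟨by simp, _, ?_, fun x _ => hp.hasFDerivWithinAt_glue hΔ x⟩
    exact ContDiffOn.sum fun i _ => (ih (hp.pderiv i)).smul contDiffOn_const

/-- Continuity at the edge gives one factor. The partial derivatives of `F` within `|Δ|` are again
piecewise polynomial, with one class of smoothness less, so `edgePoly_pow_succ_dvd` raises the order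
inductively. -/
theorem jumpsDivisible_of_contDiffOn (hΔ : IsTriangulatedDisk Δ) (r : ℕ) :
    ∀ {p : triangles Δ → MvPolynomial (Fin 2) ℝ} {F : Plane → ℝ}, ContDiffOn ℝ r F Δ.space →
      (∀ σ : triangles Δ, ∀ x ∈ convexHull ℝ (σ.1 : Set Plane),
        F x = MvPolynomial.eval (fun i => x i) (p σ)) → JumpsDivisible Δ (r + 1) p := by
  have hbase : ∀ {p : triangles Δ → MvPolynomial (Fin 2) ℝ} {F : Plane → ℝ},
      (∀ σ : triangles Δ, ∀ x ∈ convexHull ℝ (σ.1 : Set Plane),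
        F x = MvPolynomial.eval (fun i => x i) (p σ)) → ∀ v w (h : IsInteriorEdge Δ v w),
      edgePoly v w ∣
        p ⟨leftTri Δ v w, h.left_mem.1⟩ - p ⟨leftTri Δ w v, h.symm.left_mem.1⟩ := by
    intro p F hF v w h
    refine edgePoly_dvd_of_eval_eq_zero h.ne fun x hx => ?_
    rw [map_sub, ← hF, ← hF, sub_self]
    · refine convexHull_mono ?_ hx
      simp [insert_subset_iff, h.symm.left_mem.2.1, h.symm.left_mem.2.2]
    · refine convexHull_mono ?_ hx
      simp [insert_subset_iff, h.left_mem.2.1, h.left_mem.2.2]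
  induction r with
  | zero =>
    intro p F _ hF v w h
    simpa using hbase hF v w h
  | succ r ih =>
    intro p F hFr hF v w h
    rw [Nat.cast_succ, contDiffOn_succ_iff_fderivWithin (uniqueDiffOn_space hΔ)] at hFr
    refine edgePoly_pow_succ_dvd h.ne (hbase hF v w h) fun i => ?_
    rw [map_sub]
    refine ih (p := fun σ => MvPolynomial.pderiv i (p σ))
      (F := fun x => fderivWithin ℝ F Δ.space x (EuclideanSpace.single i 1))
      (hFr.2.2.clm_apply contDiffOn_const) (fun σ x hx => ?_) v w h
    have hxs := Δ.convexHull_subset_space σ.2.1 hx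
    -- A triangle has interior points, so the derivative within it is unique, and that of `F` is
    -- that of the polynomial, even at boundary points.
    have h1 : HasFDerivWithinAt F (fderivWithin ℝ F Δ.space x)
        (convexHull ℝ (σ.1 : Set Plane)) x :=
      (hFr.1 x hxs).hasFDerivWithinAt.mono (Δ.convexHull_subset_space σ.2.1)
    have h2 := ((hasFDerivAt_eval (p σ) x).hasFDerivWithinAt
      (s := convexHull ℝ (σ.1 : Set Plane))).congr (hF σ) (hF σ x hx)
    rw [(uniqueDiffOn_triangle σ.2 x hx).eq h1 h2]
    fin_cases i <;> simp

end Splines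

/-! ### The dimension of the spline space -/

section SplineSpace

variable {Δ : Geometry.SimplicialComplex ℝ Plane}

theorem jumpsDivisible_of_mem_jumpSpace {r k : ℕ} {p : triangles Δ → Poly k}
    (hp : p ∈ jumpSpace Δ (edgeSpace r k)) :
    JumpsDivisible Δ (r + 1) fun σ => (p σ : MvPolynomial (Fin 2) ℝ) := hp

/-- Splines as families of polynomials on the triangles. -/
def splineOfJumpSpace (hΔ : IsTriangulatedDisk Δ) (r k : ℕ) :
    jumpSpace Δ (edgeSpace r k) →ₗ[ℝ] splineSpace Δ r k where
  toFun p := ⟨fun x => glue (fun σ => (p.1 σ : MvPolynomial (Fin 2) ℝ)) x, by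
    have hp := jumpsDivisible_of_mem_jumpSpace p.2
    refine ⟨_, fun _ => rfl, hp.contDiffOn_glue hΔ r, fun s hs => ?_⟩
    obtain ⟨σ, hσ, hsσ⟩ := face_subset_triangle hΔ hs
    exact ⟨p.1 ⟨σ, hσ⟩, (MvPolynomial.mem_restrictTotalDegree _ _ _).1 (p.1 ⟨σ, hσ⟩).2,
      fun x hx => hp.glue_eq hΔ ⟨σ, hσ⟩ (convexHull_mono (Finset.coe_subset.2 hsσ) hx)⟩⟩
  map_add' p q := by
    refine Subtype.ext (funext fun x => ?_)
    simp only [glue, Submodule.coe_add, Pi.add_apply]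
    split_ifs <;> simp
  map_smul' c p := by
    refine Subtype.ext (funext fun x => ?_)
    simp only [glue, Submodule.coe_smul, Pi.smul_apply, RingHom.id_apply]
    split_ifs <;> simp

theorem splineOfJumpSpace_bijective (hΔ : IsTriangulatedDisk Δ) (r k : ℕ) :
    Function.Bijective (splineOfJumpSpace hΔ r k) := by
  constructor
  · rw [injective_iff_map_eq_zero]
    intro p hp
    refine Subtype.ext (funext fun σ => Subtype.ext ?_)
    refine eq_zero_of_eval_eq_zero σ.2 fun x hx => ?_
    rw [← (jumpsDivisible_of_mem_jumpSpace p.2).glue_eq hΔ σ hx]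
    exact congrFun (congrArg Subtype.val hp) ⟨x, Δ.convexHull_subset_space σ.2.1 hx⟩
  · rintro ⟨f, F, hFf, hFr, hFk⟩
    choose p hpk hp using fun σ : triangles Δ => hFk σ.1 σ.2.1
    have hj := jumpsDivisible_of_contDiffOn hΔ r hFr hp
    refine ⟨⟨fun σ => ⟨p σ, (MvPolynomial.mem_restrictTotalDegree _ _ _).2 (hpk σ)⟩, hj⟩,
      Subtype.ext (funext fun x => ?_)⟩
    obtain ⟨σ, hσ, hx⟩ := exists_triangle_mem hΔ x.2
    refine Eq.trans ?_ (hFf x)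
    rw [hp ⟨σ, hσ⟩ x hx]
    exact hj.glue_eq hΔ ⟨σ, hσ⟩ hx

/-- The spline space is isomorphic to the space of families of polynomials with divisible
jumps. -/
def splineEquiv (hΔ : IsTriangulatedDisk Δ) (r k : ℕ) :
    jumpSpace Δ (edgeSpace r k) ≃ₗ[ℝ] splineSpace Δ r k :=
  LinearEquiv.ofBijective _ (splineOfJumpSpace_bijective hΔ r k)

/-- The ends of a boundary edge are boundary vertices. So the slopes at an interior vertex are those
of the edges that carry jumps. -/
theorem isEdge_iff_isInteriorEdge (hΔ : IsTriangulatedDisk Δ) {v w : Plane}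
    (hv : v ∈ interiorVertices Δ) : IsEdge Δ v w ↔ IsInteriorEdge Δ v w := by
  constructor
  · rintro ⟨hvw, e, he, hve, hwe⟩
    have hsub : ({v, w} : Finset Plane) ⊆ e := by
      simp [Finset.insert_subset_iff, hve, hwe]
    obtain rfl : {v, w} = e :=
      Finset.eq_of_subset_of_card_le hsub (by rw [he.2, Finset.card_pair hvw])
    refine (mem_interiorEdges_iff hΔ hvw).1 ⟨he, ?_⟩
    rintro ⟨-, e', he', hsub', hu⟩
    exact hv.2 ⟨hv.1, e', he', (Finset.singleton_subset_iff.2 hve).trans hsub', hu⟩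
  · intro h
    exact ⟨h.ne, {v, w}, ((mem_interiorEdges_iff hΔ h.ne).2 h).1, by simp, by simp⟩

theorem slopes_eq_image (hΔ : IsTriangulatedDisk Δ) {v : Plane} (hv : v ∈ interiorVertices Δ)
    (S : Set Plane) : slopes Δ v S =
      ((((nbrs hΔ v).filter (· ∈ S)).image fun w => Submodule.span ℝ {w - v} : Finset _) :
        Set (Submodule ℝ Plane)) := by
  ext L
  simp only [slopes, Finset.coe_image, Finset.coe_filter, mem_image, mem_ofPred_eq, mem_nbrs,
    isEdge_iff_isInteriorEdge hΔ hv]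
  constructor
  · rintro ⟨w, hw, h, rfl⟩
    exact ⟨w, ⟨h, hw⟩, rfl⟩
  · rintro ⟨w, ⟨h, hw⟩, rfl⟩
    exact ⟨w, hw, h, rfl⟩

theorem finite_slopes (hΔ : IsTriangulatedDisk Δ) {v : Plane} (hv : v ∈ interiorVertices Δ)
    (S : Set Plane) : (slopes Δ v S).Finite := by
  rw [slopes_eq_image hΔ hv]
  exact Finset.finite_toSet _

theorem finrank_vertexSpace (hΔ : IsTriangulatedDisk Δ) (r k : ℕ) {v : Plane}
    (hv : v ∈ interiorVertices Δ) (S : Set Plane) :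
    Module.finrank ℝ (vertexSpace Δ (edgeSpace r k) v S) = dimSum r k (slopes Δ v S).ncard := by
  rw [slopes_eq_image hΔ hv, ncard_coe_finset, ← finrank_iSup_edgeSpace]
  · have : vertexSpace Δ (edgeSpace r k) v S =
        ⨆ w ∈ (nbrs hΔ v).filter (· ∈ S), edgeSpace r k v w :=
      iSup_congr fun w => iSup_congr_Prop (by rw [Finset.mem_filter, mem_nbrs]; rfl) fun _ => rfl
    rw [this]
  · simp only [Finset.mem_filter, mem_nbrs]
    exact fun h => h.1.ne rfl

/-- Two sides of a triangle at `v` are not parallel. This makes `vertexTerm_eq_dimSum` applicable.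
-/
theorem two_le_slopeCount (hΔ : IsTriangulatedDisk Δ) {v : Plane}
    (hv : v ∈ interiorVertices Δ) : 2 ≤ slopeCount Δ v := by
  obtain ⟨σ, hσ, hvσ⟩ := face_subset_triangle hΔ hv.1
  obtain ⟨w, x, rfl, h⟩ := exists_tri hσ (Finset.singleton_subset_iff.1 hvσ)
  have hedge : ∀ y ∈ ({v, w, x} : Finset Plane), v ≠ y → IsEdge Δ v y := fun y hy hvy =>
    ⟨hvy, {v, y}, ⟨Δ.down_closed hσ.1 (by
      simp only [Finset.insert_subset_iff, Finset.singleton_subset_iff]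
      exact ⟨by simp, hy⟩) (by simp), Finset.card_pair hvy⟩, by simp, by simp⟩
  have hw : IsEdge Δ v w := hedge w (by simp) h.ne
  have hx : IsEdge Δ v x := hedge x (by simp) h.rotate.rotate.ne.symm
  have hne : Submodule.span ℝ {w - v} ≠ Submodule.span ℝ {x - v} := by
    intro he
    have := (span_eq_iff_det2 (sub_ne_zero.2 h.ne.symm)
      (sub_ne_zero.2 h.rotate.rotate.ne)).1 he
    exact h.2.ne' this
  refine (ncard_pair hne).symm.le.trans ?_
  exact ncard_le_ncard (by
    rintro L (rfl | rfl)
    · exact ⟨w, mem_univ _, hw, rfl⟩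
    · exact ⟨x, mem_univ _, hx, rfl⟩) (finite_slopes hΔ hv _)

/-- The set of the ends of the edges which count for `earlierSlopeCount`. -/
def earlierVertices (Δ : Geometry.SimplicialComplex ℝ Plane) {n : ℕ}
    (γ : Fin n ≃ interiorVertices Δ) (i : Fin n) : Set Plane :=
  {w | ∃ j < i, w = γ j} ∪ boundaryVertices Δ

theorem notMem_earlierVertices {n : ℕ} (γ : Fin n ≃ interiorVertices Δ) {i j : Fin n}
    (hij : i ≤ j) : (γ j : Plane) ∉ earlierVertices Δ γ i := by
  rintro (⟨l, hl, h⟩ | h)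
  · rw [γ.injective (Subtype.ext h)] at hij
    exact absurd hl (not_lt.2 hij)
  · exact (γ j).2.2 h

theorem earlierSlopeCount_le (hΔ : IsTriangulatedDisk Δ) {n : ℕ} (γ : Fin n ≃ interiorVertices Δ)
    (i : Fin n) : earlierSlopeCount Δ γ i ≤ slopeCount Δ (γ i) := by
  refine ncard_le_ncard ?_ (finite_slopes hΔ (γ i).2 univ)
  rintro L ⟨w, -, h⟩
  exact ⟨w, mem_univ w, h⟩

theorem dimSum_earlierSlopeCount (hΔ : IsTriangulatedDisk Δ) {r n : ℕ} (k : ℕ)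
    (γ : Fin n ≃ interiorVertices Δ) {i : Fin n}
    (h : earlierSlopeCount Δ γ i = slopeCount Δ (γ i) ∨ r + 1 < earlierSlopeCount Δ γ i) :
    dimSum r k (earlierSlopeCount Δ γ i) = dimSum r k (slopeCount Δ (γ i)) := by
  obtain h | h := h
  · rw [h]
  · exact dimSum_eq_of_lt h (h.trans_le (earlierSlopeCount_le hΔ γ i))

theorem upperBound_eq_lowerBound (hΔ : IsTriangulatedDisk Δ) {r n : ℕ} (k : ℕ)
    (γ : Fin n ≃ interiorVertices Δ)
    (hγ : ∀ i, earlierSlopeCount Δ γ i = slopeCount Δ (γ i) ∨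
      r + 1 < earlierSlopeCount Δ γ i) : upperBound Δ γ r k = lowerBound Δ γ r k := by
  rw [upperBound, lowerBound]
  congr 1
  refine Finset.sum_congr rfl fun i _ => ?_
  have h2 := two_le_slopeCount hΔ (γ i).2
  have h2' : 2 ≤ earlierSlopeCount Δ γ i := by
    rcases hγ i with h | h <;> omega
  rw [vertexTerm_eq_dimSum r k h2, vertexTerm_eq_dimSum r k h2',
    dimSum_earlierSlopeCount hΔ k γ (hγ i)]

/-- One space contains the other, and the hypothesis gives them equal dimensions. This is the
spanning condition required by `range_outflow`. -/
theorem vertexSpace_earlierVertices (hΔ : IsTriangulatedDisk Δ) {r n : ℕ} (k : ℕ)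
    (γ : Fin n ≃ interiorVertices Δ) {i : Fin n}
    (h : earlierSlopeCount Δ γ i = slopeCount Δ (γ i) ∨ r + 1 < earlierSlopeCount Δ γ i) :
    vertexSpace Δ (edgeSpace r k) (γ i) (earlierVertices Δ γ i) =
      vertexSpace Δ (edgeSpace r k) (γ i) univ := by
  apply Submodule.eq_of_le_of_finrank_eq
  · exact biSup_mono fun w hw => ⟨hw.1, mem_univ w⟩
  · rw [finrank_vertexSpace hΔ r k (γ i).2, finrank_vertexSpace hΔ r k (γ i).2]
    exact dimSum_earlierSlopeCount hΔ k γ h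

theorem finrank_splineSpace (hΔ : IsTriangulatedDisk Δ) {r n : ℕ} (k : ℕ)
    (γ : Fin n ≃ interiorVertices Δ)
    (hγ : ∀ i, earlierSlopeCount Δ γ i = slopeCount Δ (γ i) ∨
      r + 1 < earlierSlopeCount Δ γ i) :
    (Module.finrank ℝ (splineSpace Δ r k) : ℤ) = lowerBound Δ γ r k := by
  rw [← (splineEquiv hΔ r k).finrank_eq,
    finrank_jumpSpace hΔ (edgeSpace r k) (edgeSpace_swap r k) γ
      (fun v w h => finrank_edgeSpace r k h.ne) (earlierVertices Δ γ)
      (fun i j hij => notMem_earlierVertices γ hij)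
      (fun i => vertexSpace_earlierVertices hΔ k γ (hγ i)),
    lowerBound, binom_zero, binom_eq_dimSum, finrank_poly]
  push_cast
  congr 1
  refine Finset.sum_congr rfl fun i _ => ?_
  rw [finrank_vertexSpace hΔ r k (γ i).2]
  exact (vertexTerm_eq_dimSum r k (two_le_slopeCount hΔ (γ i).2)).symm

theorem finite_splineSpace (hΔ : IsTriangulatedDisk Δ) (r k : ℕ) :
    Module.Finite ℝ (splineSpace Δ r k) := by
  have := (finite_triangles hΔ).to_subtype
  exact Module.Finite.equiv (splineEquiv hΔ r k)

end SplineSpace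

end BivariateSpline

end

theorem mainTheorem4 (Δ : Geometry.SimplicialComplex ℝ BivariateSpline.Plane)
    (hΔ : BivariateSpline.IsTriangulatedDisk Δ) (r k n : ℕ)
    (γ : Fin n ≃ BivariateSpline.interiorVertices Δ)
    (hγ : ∀ i : Fin n,
      BivariateSpline.earlierSlopeCount Δ γ i = BivariateSpline.slopeCount Δ (γ i) ∨
        r + 1 < BivariateSpline.earlierSlopeCount Δ γ i) :
    BivariateSpline.upperBound Δ γ r k = BivariateSpline.lowerBound Δ γ r k ∧
      Module.Finite ℝ (BivariateSpline.splineSpace Δ r k) ∧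
      (Module.finrank ℝ (BivariateSpline.splineSpace Δ r k) : ℤ) =
        BivariateSpline.upperBound Δ γ r k := by
  have h := BivariateSpline.upperBound_eq_lowerBound hΔ k γ hγ
  exact ⟨h, BivariateSpline.finite_splineSpace hΔ r k,
    (BivariateSpline.finrank_splineSpace hΔ k γ hγ).trans h.symm⟩
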